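/- **Theorem 1 (Exact recovery in Gaussian contextual graph matching).** For each $n$ let $d=d_n\in\mathbb N$ and $\rho=\rho_n,\ \eta=\eta_n\in[-1,1]$. Let $\pi^*$ be a uniformly random permutation of $[n]$. Independently of $\pi^*$, draw i.i.d. pairs $(A_{ij},\widetilde B_{ij})$, $1\le i<j\le n$, of standard Gaussian variables with correlation $\rho$ and, independently of these, i.i.d. pairs $(X_{ik},\widetilde Y_{ik})$, $1\le i\le n$, $1\le k\le d$, of standard Gaussian variables with correlation $\eta$. Regard $A$ and $\widetilde B$ as weighted adjacency matrices (symmetric, with zero diagonal), and define $B$ and $Y$ by $B_{\pi^*(i)\pi^*(j)}=\widetilde B_{ij}$ and $Y_{\pi^*(i)k}=\widetilde Y_{ik}$. An estimator is a measurable map $\hat\pi=\hat\pi(A,B,X,Y)$ with values in the permutations of $[n]$. A maximum a posteriori (MAP) estimator is one that, almost surely, maximizes $\pi\mapsto\mathbb P(\pi^*=\pi\mid A,B,X,Y)$. Put $$S_n=\frac{\rho^2 n}{1-\rho^2}+\frac{\eta^2 d}{1-\eta^2},$$ where a term is read as $+\infty$ if its denominator is $0$. All asymptotics are for $n\to\infty$.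 (i) (Achievability) Suppose that $d=\omega(\log n)$ and that, for some $\varepsilon>0$, $S_n\ge 4(1+\varepsilon)\log n$ for all sufficiently large $n$. Then MAP estimators exist, and every sequence of MAP estimators satisfies $\mathbb P(\hat\pi=\pi^*)=1-o(1)$. (ii) (Converse) Suppose that $d=\omega((\log n)^2)$ and $S_n\le 4\log n-\log\log n-\omega(1)$, i.e. there is a sequence $a_n\to+\infty$ with $S_n\le 4\log n-\log\log n-a_n$ for all sufficiently large $n$. Then every sequence of estimators satisfies $\mathbb P(\hat\pi=\pi^*)=o(1)$. -/

import Mathlib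

open MeasureTheory ProbabilityTheory Filter Topology Asymptotics

namespace ContextualMatching

/-- Permutations of `[n]` carry the discrete σ-algebra. -/
instance permMeasurableSpace (n : ℕ) : MeasurableSpace (Equiv.Perm (Fin n)) := ⊤

instance permDiscrete (n : ℕ) : DiscreteMeasurableSpace (Equiv.Perm (Fin n)) := ⟨fun _ => trivial⟩

/-- Unordered pairs `{i, j}` of distinct nodes of `[n]`. -/
abbrev Edge (n : ℕ) : Type := {e : Sym2 (Fin n) // ¬ e.IsDiag}

/-- The (symmetric, zero diagonal) weighted adjacency matrix with edge weights `w`. -/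
noncomputable def adjacency {n : ℕ} (w : Edge n → ℝ) : Fin n → Fin n → ℝ :=
  fun i j => if h : i = j then 0 else w ⟨s(i, j), by simpa using h⟩

/-- The law of a pair of standard Gaussian variables with correlation `r ∈ [-1, 1]`. -/
noncomputable def corrGaussian (r : ℝ) : Measure (EuclideanSpace ℝ (Fin 2)) :=
  multivariateGaussian 0 !![1, r; r, 1]

instance corrGaussian_isProbabilityMeasure (r : ℝ) : IsProbabilityMeasure (corrGaussian r) := by
  unfold corrGaussian; infer_instance

/-- Observed data `(A, B, X, Y)`: two weighted adjacency matrices and two `n × d` feature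
matrices. -/
abbrev Data (n d : ℕ) : Type :=
  (Fin n → Fin n → ℝ) × (Fin n → Fin n → ℝ) × (Fin n → Fin d → ℝ) × (Fin n → Fin d → ℝ)

/-- The sources of randomness: the hidden permutation `π`, the pairs `(A e, B' e)` of edge weights,
and the pairs `(X i k, Y' i k)` of features, before relabelling the second graph and database. -/
abbrev Latent (n d : ℕ) : Type :=
  Equiv.Perm (Fin n) ×
    (Edge n → EuclideanSpace ℝ (Fin 2)) × (Fin n × Fin d → EuclideanSpace ℝ (Fin 2))

/-- `π` is uniform, the edge weight pairs are i.i.d. with correlation `ρ`, the feature pairs are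
i.i.d. with correlation `η`, and these three families are independent. -/
noncomputable def latentLaw (n d : ℕ) (ρ η : ℝ) : Measure (Latent n d) :=
  (uniformOn (Set.univ : Set (Equiv.Perm (Fin n)))).prod
    ((Measure.pi fun _ : Edge n => corrGaussian ρ).prod
      (Measure.pi fun _ : Fin n × Fin d => corrGaussian η))

/-- The data: `A` and `X` are left as they are, while `B` and `Y` are obtained by relabelling the
nodes by `π`, so that `B (π i) (π j) = B' i j` and `Y (π i) k = Y' i k`. -/
noncomputable def observe {n d : ℕ} (p : Latent n d) : Data n d :=
  (adjacency fun e => p.2.1 e 0,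
    fun i j => adjacency (fun e => p.2.1 e 1) (p.1.symm i) (p.1.symm j),
    fun i k => p.2.2 (i, k) 0,
    fun i k => p.2.2 (p.1.symm i, k) 1)

/-- The joint law of the hidden permutation and of the data. -/
noncomputable def jointLaw (n d : ℕ) (ρ η : ℝ) : Measure (Equiv.Perm (Fin n) × Data n d) :=
  (latentLaw n d ρ η).map fun p => (p.1, observe p)

instance latentLaw_isProbabilityMeasure (n d : ℕ) (ρ η : ℝ) :
    IsProbabilityMeasure (latentLaw n d ρ η) := by
  have : IsProbabilityMeasure (uniformOn (Set.univ : Set (Equiv.Perm (Fin n)))) :=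
    isProbabilityMeasure_uniformOn Set.finite_univ Set.univ_nonempty
  unfold latentLaw; infer_instance

theorem measurable_observe (n d : ℕ) :
    Measurable fun p : Latent n d => (p.1, observe p) := by
  have hw (e : Edge n) (k : Fin 2) : Measurable fun q :
      (Edge n → EuclideanSpace ℝ (Fin 2)) × (Fin n × Fin d → EuclideanSpace ℝ (Fin 2)) =>
      q.1 e k := by fun_prop
  have hf (x : Fin n × Fin d) (k : Fin 2) : Measurable fun q :
      (Edge n → EuclideanSpace ℝ (Fin 2)) × (Fin n × Fin d → EuclideanSpace ℝ (Fin 2)) =>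
      q.2 x k := by fun_prop
  have hA (i j : Fin n) (k : Fin 2) : Measurable fun q :
      (Edge n → EuclideanSpace ℝ (Fin 2)) × (Fin n × Fin d → EuclideanSpace ℝ (Fin 2)) =>
      adjacency (fun e => q.1 e k) i j := by
    unfold adjacency
    by_cases h : i = j
    · simp [h]
    · simpa [h] using hw _ k
  refine measurable_from_prod_countable_right fun π => measurable_const.prodMk ?_
  refine Measurable.prodMk ?_ (Measurable.prodMk ?_ (Measurable.prodMk ?_ ?_))
  · exact measurable_pi_lambda _ fun i => measurable_pi_lambda _ fun j => hA i j 0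
  · exact measurable_pi_lambda _ fun i => measurable_pi_lambda _ fun j =>
      hA (π.symm i) (π.symm j) 1
  · exact measurable_pi_lambda _ fun i => measurable_pi_lambda _ fun k => hf (i, k) 0
  · exact measurable_pi_lambda _ fun i => measurable_pi_lambda _ fun k => hf (π.symm i, k) 1

instance jointLaw_isProbabilityMeasure (n d : ℕ) (ρ η : ℝ) :
    IsProbabilityMeasure (jointLaw n d ρ η) :=
  Measure.isProbabilityMeasure_map (measurable_observe n d).aemeasurable

/-- An estimator is a measurable map from the data to the permutations. -/
abbrev Estimator (n d : ℕ) : Type := {f : Data n d → Equiv.Perm (Fin n) // Measurable f}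

/-- The probability that the estimator `f` equals the hidden permutation. -/
noncomputable def successProb {n d : ℕ} (ρ η : ℝ) (f : Estimator n d) : ℝ :=
  (jointLaw n d ρ η).real {p | f.1 p.2 = p.1}

/-- The posterior distribution of the hidden permutation given the data. -/
noncomputable def posterior (n d : ℕ) (ρ η : ℝ) : Kernel (Data n d) (Equiv.Perm (Fin n)) :=
  condDistrib Prod.fst Prod.snd (jointLaw n d ρ η)

/-- `f` is a maximum a posteriori estimator: for almost every data, its value maximizes the
posterior probability (ties may be broken arbitrarily). -/
def IsMAP {n d : ℕ} (ρ η : ℝ) (f : Estimator n d) : Prop :=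
  ∀ᵐ D ∂((jointLaw n d ρ η).map Prod.snd), ∀ σ : Equiv.Perm (Fin n),
    posterior n d ρ η D {σ} ≤ posterior n d ρ η D {f.1 D}

/-- The quantity `r² m / (1 - r²)`, equal to `+∞` when `r² = 1`. -/
noncomputable def signal (r : ℝ) (m : ℕ) : EReal :=
  if r ^ 2 = 1 then ⊤ else ((r ^ 2 * m / (1 - r ^ 2) : ℝ) : EReal)

end ContextualMatching

namespace ContextualMatching
open scoped ENNReal

/-! Given the hidden permutation, the data are built from two independent standard Gaussian vectors:
the coordinates `a` of (A, X) and the noise `g` of the second copy. Relabelling the truth by σ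
multiplies the likelihood by exp(-|u|²/2 + ⟨u, g⟩), where u_j = t_j (a_{σ j} - a_j) and t = r/√(1 -
r²) (`lintegral_noisy_comp_perm`). A transposition moves about 2n edges and 2d features, so |u|² is
about 4S with S = S_n, and S governs both directions.

Achievability. A MAP estimator is at least as good as any other estimator, so it suffices to analyse
the maximizer of a linear score, by a union bound over the at most n^m permutations moving m nodes.
All the exponential moments come from `lintegral_exp_perm_le`, an inequality of Hölder type that
replaces the cycle decomposition: the displacement at each moved coordinate contributes as if alone.
For m ≤ δn a Chernoff bound gives about exp(-mS/4), which beats n^m. For larger m an edge with two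
moved endpoints is counted only once, the number of moved edges can drop to mn/2, and this bound is
too weak. There ⟨u, g⟩ is split into its two halves, and the event is intersected with typical
values of |ta|² and ⟨ta, g⟩ over the coordinates touching the support (`measure_llr_nonneg_le`). The
result is exp(-Λ/2), where Λ is at least about mS/2. The typical event depends only on the set of
moved nodes, so its failure costs 2^n exp(-2n) up to a constant. These estimates need small t; if
one correlation is not small, that source alone suffices, with a possibly suboptimal weight
(`exists_weight_or_lt`).

Converse. If the likelihoods of the relabelled truths add up to K times that of the truth, success
has probability at most 1/K (`ofReal_successProb_le`). The sum over transpositions is bounded below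
by a second moment argument conditional on `a`. Since exp(llr) has too large a variance, it is
replaced by the smaller bump exp(x/2 - x²/2), whose mean is (1 + v)^(-1/2) exp(-v/8) for v = |u|².
With v at most 4S + 1 for most of the n²/2 transpositions, the expected sum is of order n²
exp(-S/2)/√(log n), which diverges precisely when 4 log n - log log n - S does. Disjoint
transpositions are nearly uncorrelated because their displacements share at most four edges; the n³
overlapping pairs are controlled by a cruder bound averaged over `a`. -/

/-! ### A Hölder inequality for products with few factors per coordinate -/

theorem lintegral_pi_prod {ι : Type*} [Fintype ι] {X : ι → Type*} [∀ i, MeasurableSpace (X i)]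
    (μ : ∀ i, Measure (X i)) [∀ i, IsProbabilityMeasure (μ i)] {f : ∀ i, X i → ℝ≥0∞}
    (hf : ∀ i, Measurable (f i)) :
    ∫⁻ x, ∏ i, f i (x i) ∂Measure.pi μ = ∏ i, ∫⁻ x, f i x ∂μ i := by
  have hind : iIndepFun (fun i (x : ∀ i, X i) => f i (x i)) (Measure.pi μ) :=
    iIndepFun_pi fun i => (hf i).aemeasurable
  rw [lintegral_prod_eq_prod_lintegral_of_indepFun Finset.univ _ hind
    fun i => (hf i).comp (measurable_pi_apply i)]
  refine Finset.prod_congr rfl fun i _ => ?_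
  rw [← (measurePreserving_eval μ i).lintegral_comp (hf i)]

/-- A product of functions of which at most two depend on each coordinate integrates to at most
the product of the `L²` norms. -/
theorem lmarginal_prod_le {ι κ : Type*} [DecidableEq ι] [DecidableEq κ] {X : ι → Type*}
    [∀ i, MeasurableSpace (X i)] (μ : ∀ i, Measure (X i)) [∀ i, IsProbabilityMeasure (μ i)]
    (E : Finset κ) (S : κ → Set ι) (F : κ → (∀ i, X i) → ℝ≥0∞)
    (hF : ∀ e, Measurable (F e)) (hS : ∀ e, DependsOn (F e) (S e))
    (hcard : ∀ i, ∃ t : Finset κ, t.card ≤ 2 ∧ ∀ e ∈ E, i ∈ S e → e ∈ t) (s : Finset ι)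
    (x : ∀ i, X i) :
    lmarginal μ s (fun x => ∏ e ∈ E, F e x) x ≤
      ∏ e ∈ E, (lmarginal μ s (fun x => F e x ^ 2) x) ^ (1 / 2 : ℝ) := by
  have hF2 : ∀ e, Measurable fun x => F e x ^ 2 := fun e => (hF e).pow_const 2
  induction s using Finset.induction_on generalizing x with
  | empty =>
    simp only [lmarginal_empty]
    refine le_of_eq (Finset.prod_congr rfl fun e _ => ?_)
    rw [← ENNReal.rpow_natCast, ← ENNReal.rpow_mul]
    norm_num
  | insert i s hi ih =>
    rw [lmarginal_insert _ (Finset.measurable_fun_prod _ fun e _ => hF e) hi]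
    obtain ⟨t, ht2, ht⟩ := hcard i
    set G : κ → (∀ i, X i) → ℝ≥0∞ := fun e => lmarginal μ s (fun x => F e x ^ 2) with hG
    have hGm : ∀ e, Measurable (G e) := fun e => (hF2 e).lmarginal μ
    have hGc : ∀ e ∈ E, e ∉ t → ∀ y, G e (Function.update x i y) = G e x := by
      intro e he het y
      have hie : i ∉ S e := fun h => het (ht e he h)
      simp only [hG, lmarginal]
      refine lintegral_congr fun z => ?_
      congr 1
      refine hS e fun j hj => ?_
      have hji : j ≠ i := fun h => hie (h ▸ hj)
      by_cases hjs : j ∈ s <;> simp [Function.updateFinset, hjs, hji]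
    have hins : ∀ e, lmarginal μ (insert i s) (fun x => F e x ^ 2) x =
        ∫⁻ y, G e (Function.update x i y) ∂μ i := fun e => lmarginal_insert _ (hF2 e) hi x
    calc ∫⁻ y, lmarginal μ s (fun x => ∏ e ∈ E, F e x) (Function.update x i y) ∂μ i
        ≤ ∫⁻ y, ∏ e ∈ E, (G e (Function.update x i y)) ^ (1 / 2 : ℝ) ∂μ i :=
          lintegral_mono fun y => ih _
      _ = ∫⁻ y, (∏ e ∈ E with e ∉ t, (G e x) ^ (1 / 2 : ℝ)) *
            ∏ e ∈ E with e ∈ t, (G e (Function.update x i y)) ^ (1 / 2 : ℝ) ∂μ i := by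
          refine lintegral_congr fun y => ?_
          rw [← Finset.prod_filter_mul_prod_filter_not E (fun e => e ∈ t), mul_comm]
          congr 1
          refine Finset.prod_congr rfl fun e he => ?_
          rw [Finset.mem_filter] at he
          rw [hGc e he.1 he.2]
      _ = (∏ e ∈ E with e ∉ t, (G e x) ^ (1 / 2 : ℝ)) *
            ∫⁻ y, ∏ e ∈ E with e ∈ t, (G e (Function.update x i y)) ^ (1 / 2 : ℝ) ∂μ i := by
          rw [lintegral_const_mul]
          exact Finset.measurable_fun_prod _ fun e _ =>
            ((hGm e).comp (measurable_update x)).pow_const _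
      _ ≤ (∏ e ∈ E with e ∉ t, (G e x) ^ (1 / 2 : ℝ)) *
            ∏ e ∈ E with e ∈ t,
              (∫⁻ y, G e (Function.update x i y) ∂μ i) ^ (1 / 2 : ℝ) := by
          gcongr
          set E' := E.filter (fun e => e ∈ t)
          have hc : E'.card ≤ 2 := (Finset.card_le_card (fun e he =>
            (Finset.mem_filter.1 he).2)).trans ht2
          have hc' : (E'.card : ℝ) ≤ 2 := by exact_mod_cast hc
          -- Hölder with exponent 1/2 on each of the at most two factors that see coordinate `i`;
          -- the leftover weight goes to the constant 1, which costs nothing under a probability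
          -- measure.
          have := ENNReal.lintegral_mul_prod_norm_pow_le (μ := μ i) E'
            (g := fun _ => 1) (f := fun e y => G e (Function.update x i y)) aemeasurable_const
            (fun e _ => ((hGm e).comp (measurable_update x)).aemeasurable)
            (1 - E'.card / 2) (p := fun _ => 1 / 2) (by simp; ring) (by linarith)
            (fun _ _ => by norm_num)
          simpa using this
      _ = _ := by
          rw [← Finset.prod_filter_mul_prod_filter_not E (fun e => e ∈ t), mul_comm]
          congr 1
          · exact Finset.prod_congr rfl fun e _ => by rw [hins]
          · refine Finset.prod_congr rfl fun e he => ?_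
            rw [Finset.mem_filter] at he
            rw [hins]
            simp [hGc e he.1 he.2]

theorem lintegral_pi_pair {ι : Type*} [Fintype ι] [DecidableEq ι] {α : Type*} [MeasurableSpace α]
    (μ : Measure α) [IsProbabilityMeasure μ] {i j : ι} (hij : i ≠ j) {f : α → α → ℝ≥0∞}
    (hf : Measurable (Function.uncurry f)) :
    ∫⁻ x, f (x i) (x j) ∂Measure.pi (fun _ : ι => μ) = ∫⁻ y, ∫⁻ z, f y z ∂μ ∂μ := by
  have hind : IndepFun (fun x : ι → α => x i) (fun x => x j) (Measure.pi fun _ : ι => μ) :=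
    (iIndepFun_pi (μ := fun _ : ι => μ) (X := fun _ x => x)
      fun i => aemeasurable_id).indepFun hij
  have hmap := (indepFun_iff_map_prod_eq_prod_map_map (measurable_pi_apply i).aemeasurable
    (measurable_pi_apply j).aemeasurable).1 hind
  rw [(measurePreserving_eval (fun _ : ι => μ) i).map_eq,
    (measurePreserving_eval (fun _ : ι => μ) j).map_eq] at hmap
  calc ∫⁻ x, f (x i) (x j) ∂Measure.pi (fun _ : ι => μ)
      = ∫⁻ p, Function.uncurry f p ∂(Measure.pi fun _ : ι => μ).map fun x => (x i, x j) := by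
        rw [lintegral_map hf (by fun_prop)]
        rfl
    _ = _ := by
        rw [hmap, lintegral_prod _ hf.aemeasurable]
        rfl

/-- The factor at `i` involves the coordinates `i` and `φ i` only, so coordinate `i` occurs in the
factors at `i` and `φ⁻¹ i` only. The two-fold Hölder bound therefore applies to every permutation,
whatever its cycle type. -/
theorem lintegral_prod_perm_le {ι : Type*} [Fintype ι] [DecidableEq ι] {α : Type*}
    [MeasurableSpace α] (μ : Measure α) [IsProbabilityMeasure μ] (φ : Equiv.Perm ι)
    (K : ι → α → α → ℝ≥0∞) (hK : ∀ i, Measurable (Function.uncurry (K i))) :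
    ∫⁻ x, ∏ i ∈ φ.support, K i (x i) (x (φ i)) ∂Measure.pi (fun _ : ι => μ) ≤
      ∏ i ∈ φ.support, (∫⁻ y, ∫⁻ z, K i y z ^ 2 ∂μ ∂μ) ^ (1 / 2 : ℝ) := by
  have hne : Nonempty α := by
    by_contra h
    rw [not_nonempty_iff] at h
    exact IsProbabilityMeasure.ne_zero μ (Measure.eq_zero_of_isEmpty μ)
  have h := lmarginal_prod_le (fun _ : ι => μ) φ.support (fun i => {i, φ i})
    (fun i x => K i (x i) (x (φ i)))
    (fun i => by
      have := (hK i).comp ((measurable_pi_apply i).prodMk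
        (measurable_pi_apply (X := fun _ : ι => α) (φ i)))
      exact this)
    (fun i x y hxy => by
      simp only
      rw [hxy i (by simp), hxy (φ i) (by simp)])
    (fun i => ⟨{i, φ⁻¹ i}, Finset.card_le_two, fun e _ he => by
      rcases he with he | he
      · simp [he]
      · simp [Set.mem_singleton_iff.1 he]⟩) Finset.univ (fun _ => hne.some)
  rw [lmarginal_univ] at h
  refine h.trans (le_of_eq (Finset.prod_congr rfl fun i hi => ?_))
  rw [lmarginal_univ, lintegral_pi_pair μ (f := fun y z => K i y z ^ 2)
    (Equiv.Perm.mem_support.1 hi).symm ((hK i).pow_const 2)]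

/-! ### Exponential moments of Gaussian vectors -/

/-- The standard Gaussian law on the line. -/
noncomputable abbrev stdNormal : Measure ℝ := gaussianReal 0 1

/-- The law of a family of independent standard Gaussian variables. -/
noncomputable abbrev stdNormalPi (ι : Type*) [Fintype ι] : Measure (ι → ℝ) :=
  Measure.pi fun _ : ι => stdNormal

theorem lintegral_exp_quadratic {α β : ℝ} (hα : 0 < 1 + α) :
    ∫⁻ x, ENNReal.ofReal (Real.exp (β * x - α * x ^ 2 / 2)) ∂stdNormal =
      ENNReal.ofReal ((1 + α) ^ (-(1 / 2) : ℝ) * Real.exp (β ^ 2 / (2 * (1 + α)))) := by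
  have hv : (1 : NNReal) ≠ 0 := one_ne_zero
  set v : NNReal := ⟨(1 + α)⁻¹, (inv_pos.2 hα).le⟩ with hvdef
  have hv0 : v ≠ 0 := by
    intro h
    have : (v : ℝ) = 0 := by rw [h]; rfl
    exact (inv_pos.2 hα).ne' this
  rw [stdNormal, gaussianReal_of_var_ne_zero 0 hv, lintegral_withDensity_eq_lintegral_mul _
    (measurable_gaussianPDF 0 1) (by fun_prop)]
  have key : ∀ x : ℝ, gaussianPDF 0 1 x * ENNReal.ofReal (Real.exp (β * x - α * x ^ 2 / 2)) =
      ENNReal.ofReal ((1 + α) ^ (-(1 / 2) : ℝ) * Real.exp (β ^ 2 / (2 * (1 + α)))) *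
        gaussianPDF (β / (1 + α)) v x := by
    intro x
    rw [gaussianPDF, gaussianPDF, ← ENNReal.ofReal_mul (gaussianPDFReal_nonneg _ _ _),
      ← ENNReal.ofReal_mul (by positivity)]
    congr 1
    rw [gaussianPDFReal_def, gaussianPDFReal_def]
    have hvr : (v : ℝ) = (1 + α)⁻¹ := rfl
    rw [hvr, Real.rpow_neg hα.le, ← Real.sqrt_eq_rpow]
    have h1 : √(2 * Real.pi * (1 + α)⁻¹) = √(2 * Real.pi) * (√(1 + α))⁻¹ := by
      rw [Real.sqrt_mul (by positivity), Real.sqrt_inv]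
    have h2 : √(1 + α) ≠ 0 := (Real.sqrt_pos.2 hα).ne'
    have h3 : √(2 * Real.pi) ≠ 0 := (Real.sqrt_pos.2 (by positivity)).ne'
    rw [h1]
    simp only [NNReal.coe_one, mul_one, sub_zero]
    rw [mul_assoc, ← Real.exp_add, show (√(1 + α))⁻¹ * Real.exp (β ^ 2 / (2 * (1 + α))) *
      ((√(2 * Real.pi) * (√(1 + α))⁻¹)⁻¹ *
        Real.exp (-(x - β / (1 + α)) ^ 2 / (2 * (1 + α)⁻¹))) =
      (√(2 * Real.pi))⁻¹ * (Real.exp (β ^ 2 / (2 * (1 + α))) *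
        Real.exp (-(x - β / (1 + α)) ^ 2 / (2 * (1 + α)⁻¹))) by field_simp, ← Real.exp_add]
    congr 2
    field_simp
    ring
  calc _ = ∫⁻ x, ENNReal.ofReal ((1 + α) ^ (-(1 / 2) : ℝ) *
        Real.exp (β ^ 2 / (2 * (1 + α)))) * gaussianPDF (β / (1 + α)) v x :=
        lintegral_congr fun x => key x
    _ = _ := by
        rw [lintegral_const_mul _ (measurable_gaussianPDF _ _), lintegral_gaussianPDF_eq_one _ hv0,
          mul_one]

theorem lintegral_exp_mul_sq {w : ℝ} (hw : 0 < 1 - 2 * w) :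
    ∫⁻ x, ENNReal.ofReal (Real.exp (w * x ^ 2)) ∂stdNormal =
      ENNReal.ofReal ((1 - 2 * w) ^ (-(1 / 2) : ℝ)) := by
  have := lintegral_exp_quadratic (α := -(2 * w)) (β := 0) (by linarith)
  simp only [zero_mul, zero_sub] at this
  rw [show 1 + -(2 * w) = 1 - 2 * w by ring] at this
  simpa [show ∀ x : ℝ, -(-(2 * w * x ^ 2) / 2) = w * x ^ 2 from fun x => by ring] using this

theorem lintegral_exp_mul (t : ℝ) :
    ∫⁻ x, ENNReal.ofReal (Real.exp (t * x)) ∂stdNormal = ENNReal.ofReal (Real.exp (t ^ 2 / 2)) := by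
  have := lintegral_exp_quadratic (α := 0) (β := t) (by norm_num)
  simpa using this

/-- The difference of two independent standard Gaussians has variance 2, and the square doubles `w`.
The value is finite also for negative `w > -1/8`, which upper tails of the energy require. -/
theorem lintegral_exp_neg_mul_sub_sq {w : ℝ} (hw : 0 < 1 + 8 * w) :
    ∫⁻ x, ∫⁻ y, ENNReal.ofReal (Real.exp (-(w * (y - x) ^ 2))) ^ 2 ∂stdNormal ∂stdNormal =
      ENNReal.ofReal ((1 + 8 * w) ^ (-(1 / 2) : ℝ)) := by
  have h4 : 0 < 1 + 4 * w := by linarith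
  have h4' : 1 + 4 * w ≠ 0 := h4.ne'
  have hin : ∀ x : ℝ, ∫⁻ y, ENNReal.ofReal (Real.exp (-(w * (y - x) ^ 2))) ^ 2 ∂stdNormal =
      ENNReal.ofReal ((1 + 4 * w) ^ (-(1 / 2) : ℝ)) *
        ENNReal.ofReal (Real.exp (0 * x - (4 * w / (1 + 4 * w)) * x ^ 2 / 2)) := by
    intro x
    have := lintegral_exp_quadratic (α := 4 * w) (β := 4 * w * x) h4
    calc _ = ∫⁻ y, ENNReal.ofReal (Real.exp (-(2 * w * x ^ 2))) *
          ENNReal.ofReal (Real.exp (4 * w * x * y - 4 * w * y ^ 2 / 2)) ∂stdNormal := by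
          refine lintegral_congr fun y => ?_
          rw [← ENNReal.ofReal_pow (Real.exp_pos _).le, ← ENNReal.ofReal_mul (Real.exp_pos _).le,
            ← Real.exp_add, ← Real.exp_nat_mul]
          congr 2
          push_cast
          ring
      _ = _ := by
          rw [lintegral_const_mul _ (by fun_prop), this, ← ENNReal.ofReal_mul (Real.exp_pos _).le,
            ← ENNReal.ofReal_mul (by positivity), mul_left_comm, ← Real.exp_add]
          congr 3
          rw [← div_div]
          linear_combination (2 * w * x ^ 2) * mul_inv_cancel₀ h4'
  simp_rw [hin]
  have h8 : 1 + 4 * w / (1 + 4 * w) = (1 + 8 * w) / (1 + 4 * w) := by field_simp; ring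
  have h8p : 0 < 1 + 4 * w / (1 + 4 * w) := by rw [h8]; positivity
  rw [lintegral_const_mul _ (by fun_prop), lintegral_exp_quadratic h8p, h8,
    ← ENNReal.ofReal_mul (by positivity)]
  congr 1
  rw [Real.div_rpow hw.le h4.le]
  have := Real.rpow_pos_of_pos h4 (-(1 / 2))
  field_simp
  simp

/-- Exponential moments of the squared displacement of a Gaussian vector under a permutation of
its coordinates. -/
theorem lintegral_exp_perm_le {ι : Type*} [Fintype ι] [DecidableEq ι] (φ : Equiv.Perm ι)
    (w : ι → ℝ) (hw : ∀ i, 0 < 1 + 8 * w i) :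
    ∫⁻ a, ENNReal.ofReal (Real.exp (-∑ i, w i * (a (φ i) - a i) ^ 2)) ∂stdNormalPi ι ≤
      ENNReal.ofReal (∏ i ∈ φ.support, (1 + 8 * w i) ^ (-(1 / 4) : ℝ)) := by
  have h := lintegral_prod_perm_le stdNormal φ
    (fun i x y => ENNReal.ofReal (Real.exp (-(w i * (y - x) ^ 2)))) (fun i => by
      unfold Function.uncurry; fun_prop)
  have hL : ∀ a : ι → ℝ, ENNReal.ofReal (Real.exp (-∑ i, w i * (a (φ i) - a i) ^ 2)) =
      ∏ i ∈ φ.support, ENNReal.ofReal (Real.exp (-(w i * (a (φ i) - a i) ^ 2))) := by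
    intro a
    rw [← ENNReal.ofReal_prod_of_nonneg fun _ _ => (Real.exp_pos _).le, ← Real.exp_sum,
      Finset.sum_neg_distrib]
    congr 3
    refine (Finset.sum_subset (Finset.subset_univ _) fun i _ hi => ?_).symm
    rw [Equiv.Perm.notMem_support.1 hi]
    simp
  simp_rw [hL]
  refine h.trans (le_of_eq ?_)
  rw [ENNReal.ofReal_prod_of_nonneg fun i _ => Real.rpow_nonneg (hw i).le _]
  refine Finset.prod_congr rfl fun i _ => ?_
  rw [lintegral_exp_neg_mul_sub_sq (hw i), ENNReal.ofReal_rpow_of_nonneg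
    (Real.rpow_nonneg (hw i).le _) (by norm_num), ← Real.rpow_mul (hw i).le]
  norm_num

theorem lintegral_exp_sum_mul_sq {ι : Type*} [Fintype ι] {w : ι → ℝ}
    (hw : ∀ i, 0 < 1 - 2 * w i) :
    ∫⁻ a, ENNReal.ofReal (Real.exp (∑ i, w i * a i ^ 2)) ∂stdNormalPi ι =
      ENNReal.ofReal (∏ i, (1 - 2 * w i) ^ (-(1 / 2) : ℝ)) := by
  have hL : ∀ a : ι → ℝ, ENNReal.ofReal (Real.exp (∑ i, w i * a i ^ 2)) =
      ∏ i, ENNReal.ofReal (Real.exp (w i * a i ^ 2)) := by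
    intro a
    rw [← ENNReal.ofReal_prod_of_nonneg fun _ _ => (Real.exp_pos _).le, ← Real.exp_sum]
  simp_rw [hL]
  rw [lintegral_pi_prod (fun _ : ι => stdNormal)
    (f := fun i x => ENNReal.ofReal (Real.exp (w i * x ^ 2))) (fun i => by fun_prop),
    ENNReal.ofReal_prod_of_nonneg fun i _ => Real.rpow_nonneg (hw i).le _]
  exact Finset.prod_congr rfl fun i _ => lintegral_exp_mul_sq (hw i)

theorem lintegral_exp_sum_mul {ι : Type*} [Fintype ι] (u : ι → ℝ) :
    ∫⁻ g, ENNReal.ofReal (Real.exp (∑ i, u i * g i)) ∂stdNormalPi ι =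
      ENNReal.ofReal (Real.exp ((∑ i, u i ^ 2) / 2)) := by
  have hL : ∀ a : ι → ℝ, ENNReal.ofReal (Real.exp (∑ i, u i * a i)) =
      ∏ i, ENNReal.ofReal (Real.exp (u i * a i)) := by
    intro a
    rw [← ENNReal.ofReal_prod_of_nonneg fun _ _ => (Real.exp_pos _).le, ← Real.exp_sum]
  simp_rw [hL]
  rw [lintegral_pi_prod (fun _ : ι => stdNormal)
    (f := fun i x => ENNReal.ofReal (Real.exp (u i * x))) (fun i => by fun_prop),
    Finset.sum_div, Real.exp_sum, ENNReal.ofReal_prod_of_nonneg fun i _ => (Real.exp_pos _).le]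
  exact Finset.prod_congr rfl fun i _ => lintegral_exp_mul _

theorem integral_cexp_mul_stdNormal (z : ℂ) :
    ∫ x, Complex.exp (z * x) ∂stdNormal = Complex.exp (z ^ 2 / 2) := by
  have := complexMGF_id_gaussianReal (μ := 0) (v := 1) z
  rw [complexMGF] at this
  simpa using this

theorem integral_cexp_sum_mul {ι : Type*} [Fintype ι] (z : ι → ℂ) :
    ∫ g, Complex.exp (∑ i, z i * (g i : ℂ)) ∂stdNormalPi ι =
      Complex.exp ((∑ i, z i ^ 2) / 2) := by
  simp_rw [Complex.exp_sum]
  rw [integral_fintype_prod_eq_prod (μ := fun _ : ι => stdNormal)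
    (fun i (x : ℝ) => Complex.exp (z i * x)), Finset.sum_div, Complex.exp_sum]
  exact Finset.prod_congr rfl fun i _ => integral_cexp_mul_stdNormal _

/-! ### First and second moments of the bump of a log likelihood ratio -/

/-- The log likelihood ratio of two shifted standard Gaussian vectors, `u` being the shift. -/
noncomputable def llr {ι : Type*} [Fintype ι] (u g : ι → ℝ) : ℝ :=
  -(∑ i, u i ^ 2) / 2 + ∑ i, u i * g i

/-- A smooth substitute for the indicator that `x` is close to `0`, tilted by `exp (x / 2)`. -/
noncomputable def bump (x : ℝ) : ℝ := Real.exp (x / 2 - x ^ 2 / 2)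

theorem bump_pos (x : ℝ) : 0 < bump x := Real.exp_pos _

@[fun_prop]
theorem measurable_llr {ι : Type*} [Fintype ι] (u : ι → ℝ) : Measurable (llr u) := by
  unfold llr; fun_prop

@[fun_prop]
theorem measurable_bump : Measurable bump := by
  unfold bump; fun_prop

theorem bump_le_exp (x : ℝ) : bump x ≤ Real.exp (1 / 8) * Real.exp x := by
  rw [bump, ← Real.exp_add, Real.exp_le_exp]
  nlinarith [sq_nonneg (x + 1 / 2)]

theorem bump_le (x : ℝ) : bump x ≤ Real.exp (1 / 8) := by
  rw [bump, Real.exp_le_exp]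
  nlinarith [sq_nonneg (x - 1 / 2)]

theorem bump_le_exp_third (x : ℝ) : bump x ≤ Real.exp (1 / 8) * Real.exp (x / 3) := by
  rw [bump, ← Real.exp_add, Real.exp_le_exp]
  nlinarith [sq_nonneg (x - 1 / 6)]

theorem map_sum_mul_stdNormalPi {ι : Type*} [Fintype ι] (u : ι → ℝ) :
    (stdNormalPi ι).map (fun g => ∑ i, u i * g i) =
      stdNormal.map (fun x => √(∑ i, u i ^ 2) * x) := by
  have hm : Measurable fun g : ι → ℝ => ∑ i, u i * g i := by fun_prop
  have := Measure.isProbabilityMeasure_map (μ := stdNormalPi ι) hm.aemeasurable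
  have hm2 : Measurable fun x : ℝ => √(∑ i, u i ^ 2) * x := by fun_prop
  have := Measure.isProbabilityMeasure_map (μ := stdNormal) hm2.aemeasurable
  refine Measure.ext_of_charFun (funext fun t => ?_)
  rw [charFun_apply_real, charFun_apply_real, integral_map hm.aemeasurable (by fun_prop),
    integral_map hm2.aemeasurable (by fun_prop)]
  calc _ = ∫ g, Complex.exp (∑ i, (t * u i * Complex.I) * (g i : ℂ)) ∂stdNormalPi ι := by
        congr 1
        ext g
        push_cast
        rw [Finset.mul_sum, Finset.sum_mul]
        congr 1
        refine Finset.sum_congr rfl fun i _ => ?_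
        ring
    _ = Complex.exp ((t * √(∑ i, u i ^ 2) * Complex.I) ^ 2 / 2) := by
        rw [integral_cexp_sum_mul]
        congr 2
        rw [mul_pow, mul_pow, ← Complex.ofReal_pow (√_), Real.sq_sqrt
          (Finset.sum_nonneg fun i _ => sq_nonneg _)]
        simp_rw [mul_pow]
        rw [← Finset.sum_mul, ← Finset.mul_sum]
        push_cast
        rfl
    _ = _ := by
        rw [← integral_cexp_mul_stdNormal]
        congr 1
        ext x
        congr 1
        push_cast
        ring

/-- Under the noise the log likelihood ratio is Gaussian with mean -v/2 and variance v, where v =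
|u|². The tilt `exp (x / 2)` recentres it at 0 at the price exp(-v/8), and the quadratic cutoff
contributes (1 + v)^(-1/2). -/
theorem lintegral_bump_llr {ι : Type*} [Fintype ι] (u : ι → ℝ) :
    ∫⁻ g, ENNReal.ofReal (bump (llr u g)) ∂stdNormalPi ι =
      ENNReal.ofReal ((1 + ∑ i, u i ^ 2) ^ (-(1 / 2) : ℝ) *
        Real.exp (-(∑ i, u i ^ 2) / 8)) := by
  set v := ∑ i, u i ^ 2 with hv
  have hv0 : 0 ≤ v := Finset.sum_nonneg fun i _ => sq_nonneg _
  have hsq : √v ^ 2 = v := Real.sq_sqrt hv0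
  have hα : 0 < 1 + v := by linarith
  have hα' : 1 + v ≠ 0 := hα.ne'
  calc _ = ∫⁻ y, ENNReal.ofReal (bump (-v / 2 + y)) ∂(stdNormalPi ι).map
        (fun g => ∑ i, u i * g i) := by
        rw [lintegral_map (by fun_prop) (by fun_prop)]
        rfl
    _ = ∫⁻ x, ENNReal.ofReal (bump (-v / 2 + √v * x)) ∂stdNormal := by
        rw [map_sum_mul_stdNormalPi, lintegral_map (by fun_prop) (by fun_prop)]
    _ = ∫⁻ x, ENNReal.ofReal (Real.exp (-v / 4 - v ^ 2 / 8)) *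
          ENNReal.ofReal (Real.exp ((√v * (1 + v) / 2) * x - v * x ^ 2 / 2)) ∂stdNormal := by
        refine lintegral_congr fun x => ?_
        rw [← ENNReal.ofReal_mul (Real.exp_pos _).le, ← Real.exp_add, bump]
        congr 2
        linear_combination (-x ^ 2 / 2) * hsq
    _ = _ := by
        rw [lintegral_const_mul _ (by fun_prop), lintegral_exp_quadratic hα,
          ← ENNReal.ofReal_mul (Real.exp_pos _).le, mul_left_comm, ← Real.exp_add]
        congr 3
        rw [show (√v * (1 + v) / 2) ^ 2 = v * (1 + v) ^ 2 / 4 by rw [← hsq]; simp; ring]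
        field_simp
        ring

theorem integral_cexp_mul_I (x : ℝ) :
    ∫ ξ, Complex.exp (ξ * Complex.I * x) ∂stdNormal = Complex.exp (-(x : ℂ) ^ 2 / 2) := by
  have := integral_cexp_mul_stdNormal (Complex.I * x)
  rw [mul_pow, Complex.I_sq, neg_one_mul] at this
  rw [← this]
  congr 1
  ext ξ
  ring_nf

/-- Fourier representation: `bump x` is the mean of exp((1/2 + iξ)x) over a standard Gaussian ξ.
After exchanging integrals the noise integrates explicitly, and the two frequencies are coupled only
through exp(-cξζ). Bounding |cξζ| by |c|(ξ² + ζ²)/2 decouples them, so that for small `c` the result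
is close to the product of the two means. -/
theorem lintegral_bump_mul_bump_le {ι : Type*} [Fintype ι] (u w : ι → ℝ) {v v' c : ℝ}
    (hv : ∑ i, u i ^ 2 = v) (hv' : ∑ i, w i ^ 2 = v') (hc : ∑ i, u i * w i = c)
    (h1 : 0 < 1 + v - |c|) (h2 : 0 < 1 + v' - |c|) :
    ∫⁻ g, ENNReal.ofReal (bump (llr u g) * bump (llr w g)) ∂stdNormalPi ι ≤
      ENNReal.ofReal (Real.exp (-(v + v') / 8 + c / 4) *
        ((1 + v - |c|) ^ (-(1 / 2) : ℝ) * (1 + v' - |c|) ^ (-(1 / 2) : ℝ))) := by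
  set P := stdNormalPi ι
  set Q := stdNormal.prod stdNormal
  set f : (ι → ℝ) → ℝ × ℝ → ℂ := fun g q =>
    Complex.exp ((1 / 2 + q.1 * Complex.I) * llr u g + (1 / 2 + q.2 * Complex.I) * llr w g) with hf
  have hfm : Measurable (Function.uncurry f) := by
    unfold f Function.uncurry
    fun_prop
  have hnorm : ∀ g q, ‖f g q‖ = Real.exp (llr u g / 2 + llr w g / 2) := by
    intro g q
    rw [hf, Complex.norm_exp]
    congr 1
    simp
    ring
  have hexp : Integrable (fun g => Real.exp (llr u g / 2 + llr w g / 2)) P := by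
    refine ⟨by fun_prop, ?_⟩
    rw [hasFiniteIntegral_iff_ofReal (Eventually.of_forall fun _ => (Real.exp_pos _).le)]
    have : ∀ g, ENNReal.ofReal (Real.exp (llr u g / 2 + llr w g / 2)) =
        ENNReal.ofReal (Real.exp (-(v + v') / 4)) *
          ENNReal.ofReal (Real.exp (∑ i, (u i / 2 + w i / 2) * g i)) := by
      intro g
      rw [← ENNReal.ofReal_mul (Real.exp_pos _).le, ← Real.exp_add, llr, llr, hv, hv']
      simp_rw [add_mul, Finset.sum_add_distrib, div_mul_eq_mul_div, ← Finset.sum_div]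
      congr 2
      ring
    simp_rw [this]
    rw [lintegral_const_mul _ (by fun_prop), lintegral_exp_sum_mul]
    exact ENNReal.mul_lt_top ENNReal.ofReal_lt_top ENNReal.ofReal_lt_top
  have hfi : Integrable (Function.uncurry f) (P.prod Q) := by
    refine (hexp.comp_fst Q).mono hfm.aestronglyMeasurable (Eventually.of_forall fun p => ?_)
    rw [Function.uncurry, hnorm, Real.norm_of_nonneg (Real.exp_pos _).le]
  have hinner : ∀ g, ∫ q, f g q ∂Q = ((bump (llr u g) * bump (llr w g) : ℝ) : ℂ) := by
    intro g
    have : ∀ q : ℝ × ℝ, f g q = Complex.exp (llr u g / 2 + llr w g / 2) *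
        (Complex.exp (q.1 * Complex.I * llr u g) * Complex.exp (q.2 * Complex.I * llr w g)) := by
      intro q
      simp only [hf, ← Complex.exp_add]
      congr 1
      ring
    simp_rw [this]
    rw [integral_const_mul, integral_prod_mul
      (fun ξ : ℝ => Complex.exp (ξ * Complex.I * llr u g))
      (fun ξ : ℝ => Complex.exp (ξ * Complex.I * llr w g)), integral_cexp_mul_I,
      integral_cexp_mul_I, bump, bump]
    push_cast
    rw [← Complex.exp_add, ← Complex.exp_add, ← Complex.exp_add]
    congr 1
    ring
  have houter : ∀ q : ℝ × ℝ, ‖∫ g, f g q ∂P‖ₑ = ENNReal.ofReal (Real.exp (-(v + v') / 8 + c / 4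
      - q.1 ^ 2 * v / 2 - q.2 ^ 2 * v' / 2 - c * q.1 * q.2)) := by
    intro q
    have : ∀ g, f g q = Complex.exp (-((1 / 2 + q.1 * Complex.I) * v +
        (1 / 2 + q.2 * Complex.I) * v') / 2) * Complex.exp (∑ i, ((1 / 2 + q.1 * Complex.I) * u i +
          (1 / 2 + q.2 * Complex.I) * w i) * (g i : ℂ)) := by
      intro g
      simp only [hf, ← Complex.exp_add]
      congr 1
      simp_rw [add_mul _ _ (Complex.ofReal (g _)), Finset.sum_add_distrib, mul_assoc,
        ← Finset.mul_sum]
      rw [llr, llr, hv, hv']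
      push_cast
      ring
    simp_rw [this]
    rw [integral_const_mul, integral_cexp_sum_mul, ← Complex.exp_add]
    have hs : (∑ i, ((1 / 2 + q.1 * Complex.I) * u i + (1 / 2 + q.2 * Complex.I) * w i) ^ 2) =
        (1 / 2 + q.1 * Complex.I) ^ 2 * (v : ℂ) + (1 / 2 + q.2 * Complex.I) ^ 2 * (v' : ℂ) +
          2 * (1 / 2 + q.1 * Complex.I) * (1 / 2 + q.2 * Complex.I) * (c : ℂ) := by
      rw [← hv, ← hv', ← hc]
      push_cast
      rw [Finset.mul_sum, Finset.mul_sum, Finset.mul_sum, ← Finset.sum_add_distrib,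
        ← Finset.sum_add_distrib]
      exact Finset.sum_congr rfl fun i _ => by ring
    rw [hs, ← ofReal_norm, Complex.norm_exp]
    congr 2
    simp [pow_two]
    ring
  calc ∫⁻ g, ENNReal.ofReal (bump (llr u g) * bump (llr w g)) ∂P
      = ‖∫ g, ((bump (llr u g) * bump (llr w g) : ℝ) : ℂ) ∂P‖ₑ := by
        rw [integral_complex_ofReal, ← ofReal_norm, Complex.norm_real,
          Real.norm_of_nonneg (integral_nonneg fun g => (mul_pos (bump_pos _) (bump_pos _)).le),
          ofReal_integral_eq_lintegral_ofReal _ (Eventually.of_forall fun g =>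
            (mul_pos (bump_pos _) (bump_pos _)).le)]
        refine Integrable.of_bound (by fun_prop) (Real.exp (1 / 8) * Real.exp (1 / 8))
          (Eventually.of_forall fun g => ?_)
        rw [Real.norm_of_nonneg (mul_pos (bump_pos _) (bump_pos _)).le]
        exact mul_le_mul (bump_le _) (bump_le _) (bump_pos _).le (Real.exp_pos _).le
    _ = ‖∫ q, ∫ g, f g q ∂P ∂Q‖ₑ := by
        rw [← integral_integral_swap hfi]
        simp_rw [hinner]
    _ ≤ ∫⁻ q, ‖∫ g, f g q ∂P‖ₑ ∂Q := enorm_integral_le_lintegral_enorm _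
    _ ≤ ∫⁻ q, ENNReal.ofReal (Real.exp (-(v + v') / 8 + c / 4)) *
          (ENNReal.ofReal (Real.exp (0 * q.1 - (v - |c|) * q.1 ^ 2 / 2)) *
            ENNReal.ofReal (Real.exp (0 * q.2 - (v' - |c|) * q.2 ^ 2 / 2))) ∂Q := by
        refine lintegral_mono fun q => ?_
        rw [houter, ← ENNReal.ofReal_mul (Real.exp_pos _).le,
          ← ENNReal.ofReal_mul (Real.exp_pos _).le, ← Real.exp_add, ← Real.exp_add]
        refine ENNReal.ofReal_le_ofReal (Real.exp_le_exp.2 ?_)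
        have : -(c * q.1 * q.2) ≤ |c| * (q.1 ^ 2 + q.2 ^ 2) / 2 := by
          rcases abs_cases c with ⟨h, h0⟩ | ⟨h, h0⟩ <;> rw [h] <;>
            nlinarith [sq_nonneg (q.1 + q.2), sq_nonneg (q.1 - q.2)]
        linarith
    _ = _ := by
        rw [lintegral_const_mul _ (by fun_prop), lintegral_prod_mul
          (f := fun x => ENNReal.ofReal (Real.exp (0 * x - (v - |c|) * x ^ 2 / 2)))
          (g := fun x => ENNReal.ofReal (Real.exp (0 * x - (v' - |c|) * x ^ 2 / 2)))
          (by fun_prop) (by fun_prop),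
          lintegral_exp_quadratic (by linarith), lintegral_exp_quadratic (by linarith),
          ENNReal.ofReal_mul (Real.exp_pos _).le,
          ENNReal.ofReal_mul (Real.rpow_nonneg h1.le _)]
        simp [add_sub_assoc]

/-- A cruder bound for strongly correlated displacements, with no condition on the inner product:
each bump is at most a constant times exp(x/3), and the noise integrates to an exponential that
keeps the gain from |u - w|². -/
theorem lintegral_bump_mul_bump_le_exp {ι : Type*} [Fintype ι] (u w : ι → ℝ) :
    ∫⁻ g, ENNReal.ofReal (bump (llr u g) * bump (llr w g)) ∂stdNormalPi ι ≤
      ENNReal.ofReal (Real.exp (1 / 4) * Real.exp (-(∑ i, u i ^ 2 + ∑ i, w i ^ 2 +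
        ∑ i, (u i - w i) ^ 2) / 18)) := by
  calc _ ≤ ∫⁻ g, ENNReal.ofReal (Real.exp (1 / 4 - (∑ i, u i ^ 2 + ∑ i, w i ^ 2) / 6)) *
        ENNReal.ofReal (Real.exp (∑ i, ((u i + w i) / 3) * g i)) ∂stdNormalPi ι := by
        refine lintegral_mono fun g => ?_
        rw [← ENNReal.ofReal_mul (Real.exp_pos _).le]
        refine ENNReal.ofReal_le_ofReal ?_
        refine (mul_le_mul (bump_le_exp_third _) (bump_le_exp_third _) (bump_pos _).le
          (by positivity)).trans (le_of_eq ?_)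
        rw [← Real.exp_add, ← Real.exp_add, ← Real.exp_add, ← Real.exp_add, llr, llr]
        simp_rw [div_mul_eq_mul_div, add_mul, ← Finset.sum_div, Finset.sum_add_distrib]
        congr 1
        ring
    _ = _ := by
        rw [lintegral_const_mul _ (by fun_prop), lintegral_exp_sum_mul,
          ← ENNReal.ofReal_mul (Real.exp_pos _).le, ← Real.exp_add, ← Real.exp_add]
        congr 2
        have h1 : ∑ i, ((u i + w i) / 3) ^ 2 = (2 * ∑ i, u i ^ 2 + 2 * ∑ i, w i ^ 2 -
            ∑ i, (u i - w i) ^ 2) / 9 := by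
          rw [Finset.mul_sum, Finset.mul_sum, ← Finset.sum_add_distrib, ← Finset.sum_sub_distrib,
            Finset.sum_div]
          exact Finset.sum_congr rfl fun i _ => by ring
        rw [h1]
        ring

theorem measure_le_lintegral_exp {Ω : Type*} [MeasurableSpace Ω] (μ : Measure Ω) {A : Set Ω}
    {F : Ω → ℝ} (hF : Measurable F) (hA : ∀ x ∈ A, 0 ≤ F x) :
    μ A ≤ ∫⁻ x, ENNReal.ofReal (Real.exp (F x)) ∂μ := by
  have hm : Measurable fun x => ENNReal.ofReal (Real.exp (F x)) := by fun_prop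
  calc μ A ≤ μ {x | 1 ≤ ENNReal.ofReal (Real.exp (F x))} := by
        refine measure_mono fun x hx => ?_
        simpa using hA x hx
    _ ≤ _ := by simpa using mul_meas_ge_le_lintegral hm 1

/-! ### Translation and relabelling of Gaussian noise -/

section CameronMartin

theorem gaussianReal_eq_withDensity_stdNormal (u : ℝ) :
    gaussianReal u 1 = stdNormal.withDensity
      fun x => ENNReal.ofReal (Real.exp (u * x - u ^ 2 / 2)) := by
  rw [stdNormal, gaussianReal_of_var_ne_zero u one_ne_zero,
    gaussianReal_of_var_ne_zero 0 one_ne_zero,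
    ← withDensity_mul _ (measurable_gaussianPDF 0 1) (by fun_prop)]
  congr 1
  ext x
  rw [Pi.mul_apply, gaussianPDF, gaussianPDF, ← ENNReal.ofReal_mul (gaussianPDFReal_nonneg _ _ _),
    gaussianPDFReal_def, gaussianPDFReal_def]
  simp only [mul_assoc]
  rw [← Real.exp_add]
  congr 4
  simp
  ring

variable {ι : Type*} [Fintype ι]

/-- The Cameron–Martin formula; both sides factor over coordinates, so the one-dimensional density
suffices. -/
theorem map_add_stdNormalPi (u : ι → ℝ) :
    (stdNormalPi ι).map (fun g => g + u) =
      (stdNormalPi ι).withDensity fun g => ENNReal.ofReal (Real.exp (llr u g)) := by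
  have h1 : (stdNormalPi ι).map (fun g => g + u) = Measure.pi fun i => gaussianReal (u i) 1 := by
    have h := Measure.pi_map_pi (μ := fun _ : ι => stdNormal) (f := fun i (x : ℝ) => x + u i)
      (hμ := fun i => by
        have : IsProbabilityMeasure (stdNormal.map fun x => x + u i) :=
          Measure.isProbabilityMeasure_map (Measurable.aemeasurable (by fun_prop))
        infer_instance) (fun i => Measurable.aemeasurable (by fun_prop))
    have h2 : (fun g : ι → ℝ => g + u) = fun g i => g i + u i := rfl
    rw [h2, h]
    congr 1
    ext1 i
    rw [gaussianReal_map_add_const, zero_add]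
  rw [h1]
  refine Measure.pi_eq fun s hs => ?_
  rw [withDensity_apply _ (MeasurableSet.univ_pi hs), ← lintegral_indicator
    (MeasurableSet.univ_pi hs)]
  calc _ = ∫⁻ g, ∏ i, (s i).indicator
        (fun x => ENNReal.ofReal (Real.exp (u i * x - u i ^ 2 / 2))) (g i) ∂stdNormalPi ι := by
        refine lintegral_congr fun g => ?_
        by_cases hg : g ∈ Set.univ.pi s
        · rw [Set.indicator_of_mem hg]
          have : ∀ i, (s i).indicator
              (fun x => ENNReal.ofReal (Real.exp (u i * x - u i ^ 2 / 2))) (g i) =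
              ENNReal.ofReal (Real.exp (u i * g i - u i ^ 2 / 2)) := fun i =>
            Set.indicator_of_mem (hg i (Set.mem_univ i)) _
          simp_rw [this]
          rw [← ENNReal.ofReal_prod_of_nonneg fun _ _ => (Real.exp_pos _).le, ← Real.exp_sum,
            Finset.sum_sub_distrib, llr, ← Finset.sum_div]
          congr 2
          ring
        · rw [Set.indicator_of_notMem hg]
          simp only [Set.mem_pi, Set.mem_univ, true_implies, not_forall] at hg
          obtain ⟨i, hi⟩ := hg
          exact (Finset.prod_eq_zero (Finset.mem_univ i) (Set.indicator_of_notMem hi _)).symm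
    _ = _ := by
        rw [lintegral_pi_prod (fun _ : ι => stdNormal) (fun i =>
          Measurable.indicator (by fun_prop) (hs i))]
        refine Finset.prod_congr rfl fun i _ => ?_
        rw [gaussianReal_eq_withDensity_stdNormal, withDensity_apply _ (hs i),
          ← lintegral_indicator (hs i)]

theorem lintegral_comp_perm_stdNormalPi (φ : Equiv.Perm ι) {H : (ι → ℝ) → ℝ≥0∞}
    (hH : Measurable H) :
    ∫⁻ g, H (g ∘ φ) ∂stdNormalPi ι = ∫⁻ g, H g ∂stdNormalPi ι := by
  have h := Measure.pi_map_piCongrLeft (μ := fun _ : ι => stdNormal) φ.symm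
  have hfun : (fun g : ι → ℝ => g ∘ φ) =
      MeasurableEquiv.piCongrLeft (fun _ : ι => ℝ) φ.symm := by
    ext g i
    rw [MeasurableEquiv.coe_piCongrLeft]
    have := Equiv.piCongrLeft_apply_apply (P := fun _ : ι => ℝ) (e := φ.symm) g (φ i)
    simpa using this.symm
  have hm : Measurable fun g : ι → ℝ => g ∘ φ :=
    measurable_pi_lambda _ fun i => measurable_pi_apply (φ i)
  rw [← lintegral_map (f := H) (g := fun g : ι → ℝ => g ∘ φ) hH hm, hfun, h]

end CameronMartin

/-! ### Likelihood ratios and linear scores of a relabelling -/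

section Model

variable {ι : Type*}

/-- The second coordinates of Gaussian pairs whose first coordinates are `a`, with correlations
`r`; the vector `g` is the independent noise. -/
noncomputable def noisy (r a g : ι → ℝ) : ι → ℝ := fun i => r i * a i + √(1 - r i ^ 2) * g i

/-- The signal to noise amplitude `r / √(1 - r²)`. -/
noncomputable def amp (r : ι → ℝ) : ι → ℝ := fun i => r i / √(1 - r i ^ 2)

/-- The displacement of `a` under a permutation of the coordinates, scaled by `t`. -/
def shift (t : ι → ℝ) (φ : Equiv.Perm ι) (a : ι → ℝ) : ι → ℝ := fun i => t i * (a (φ i) - a i)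

@[fun_prop]
theorem measurable_noisy (r : ι → ℝ) :
    Measurable fun p : (ι → ℝ) × (ι → ℝ) => noisy r p.1 p.2 := by
  unfold noisy; fun_prop

theorem amp_sq {r : ι → ℝ} {i : ι} (hr : r i ^ 2 < 1) :
    amp r i ^ 2 = r i ^ 2 / (1 - r i ^ 2) := by
  rw [amp, div_pow, Real.sq_sqrt (by linarith)]

variable [Fintype ι]

@[fun_prop]
theorem measurable_llr_shift (t : ι → ℝ) (φ : Equiv.Perm ι) :
    Measurable fun p : (ι → ℝ) × (ι → ℝ) => llr (shift t φ p.1) p.2 := by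
  unfold llr shift; fun_prop

/-- Relabelling the noisy vector amounts to reweighting with the exponential of the log
likelihood ratio. -/
theorem lintegral_noisy_comp_perm {r : ι → ℝ} (hr : ∀ i, r i ^ 2 < 1) (φ : Equiv.Perm ι)
    (hφ : ∀ i, r (φ i) = r i) {H : (ι → ℝ) × (ι → ℝ) → ℝ≥0∞} (hH : Measurable H) :
    ∫⁻ p, H (p.1, noisy r p.1 p.2 ∘ φ) ∂(stdNormalPi ι).prod (stdNormalPi ι) =
      ∫⁻ p, H (p.1, noisy r p.1 p.2) * ENNReal.ofReal (Real.exp (llr (shift (amp r) φ p.1) p.2))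
        ∂(stdNormalPi ι).prod (stdNormalPi ι) := by
  have hcomp : Measurable fun b : ι → ℝ => b ∘ φ :=
    measurable_pi_lambda _ fun i => measurable_pi_apply (φ i)
  have hm1 : Measurable fun p : (ι → ℝ) × (ι → ℝ) => H (p.1, noisy r p.1 p.2) :=
    hH.comp (measurable_fst.prodMk (measurable_noisy r))
  have hm2 : Measurable fun p : (ι → ℝ) × (ι → ℝ) => H (p.1, noisy r p.1 p.2 ∘ φ) :=
    hH.comp (measurable_fst.prodMk (hcomp.comp (measurable_noisy r)))
  have hm3 : Measurable fun p : (ι → ℝ) × (ι → ℝ) =>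
      ENNReal.ofReal (Real.exp (llr (shift (amp r) φ p.1) p.2)) := by fun_prop
  have hm4 : Measurable fun p : (ι → ℝ) × (ι → ℝ) => H (p.1, noisy r p.1 p.2) *
      ENNReal.ofReal (Real.exp (llr (shift (amp r) φ p.1) p.2)) := hm1.mul hm3
  rw [lintegral_prod _ hm2.aemeasurable, lintegral_prod _ hm4.aemeasurable]
  refine lintegral_congr fun a => ?_
  have hma : Measurable fun g => H (a, noisy r a g) := hm1.comp measurable_prodMk_left
  -- Relabelling the second copy permutes the noise, which keeps its law, and translates it by the
  -- scaled displacement of `a`.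
  have hkey : ∀ g, noisy r a g ∘ φ = noisy r a (g ∘ φ + shift (amp r) φ a) := by
    intro g
    ext i
    have h0 : √(1 - r i ^ 2) ≠ 0 := (Real.sqrt_pos.2 (by linarith [hr i])).ne'
    simp only [noisy, Function.comp_apply, hφ, Pi.add_apply, shift, amp]
    field_simp
    ring
  simp_rw [hkey]
  rw [lintegral_comp_perm_stdNormalPi φ (H := fun g => H (a, noisy r a (g + shift (amp r) φ a)))
    (hma.comp (measurable_id.add_const _))]
  rw [← lintegral_map (f := fun g => H (a, noisy r a g)) (g := fun g => g + shift (amp r) φ a) hma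
    (measurable_id.add_const (shift (amp r) φ a))]
  rw [map_add_stdNormalPi, lintegral_withDensity_eq_lintegral_mul _ (by fun_prop) hma]
  refine lintegral_congr fun g => ?_
  rw [Pi.mul_apply, mul_comm]

/-- The sum of k a² is invariant under `φ`, so the cross term is a negative half square. -/
theorem sum_mul_perm_sub {k a : ι → ℝ} {φ : Equiv.Perm ι} (hk : ∀ i, k (φ i) = k i) :
    ∑ i, k i * a i * (a (φ i) - a i) = -(∑ i, k i * (a (φ i) - a i) ^ 2) / 2 := by
  have h : ∑ i, k i * a (φ i) ^ 2 = ∑ i, k i * a i ^ 2 := by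
    rw [← Equiv.sum_comp φ (fun i => k i * a i ^ 2)]
    simp_rw [hk]
  have h2 : ∑ i, k i * (a (φ i) - a i) ^ 2 = ∑ i, k i * a (φ i) ^ 2 + ∑ i, k i * a i ^ 2 -
      2 * ∑ i, k i * a i * a (φ i) := by
    rw [Finset.mul_sum, ← Finset.sum_add_distrib, ← Finset.sum_sub_distrib]
    exact Finset.sum_congr rfl fun i _ => by ring
  have h3 : ∑ i, k i * a i * (a (φ i) - a i) = ∑ i, k i * a i * a (φ i) - ∑ i, k i * a i ^ 2 := by
    rw [← Finset.sum_sub_distrib]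
    exact Finset.sum_congr rfl fun i _ => by ring
  rw [h3, h2, h]
  ring

theorem sum_score_sub {r c : ι → ℝ} {φ : Equiv.Perm ι} (hr : ∀ i, r (φ i) = r i)
    (hc : ∀ i, c (φ i) = c i) (a g : ι → ℝ) :
    ∑ i, c i * noisy r a g i * (a (φ i) - a i) =
      -(∑ i, c i * r i * (a (φ i) - a i) ^ 2) / 2 +
        ∑ i, c i * √(1 - r i ^ 2) * (a (φ i) - a i) * g i := by
  rw [← sum_mul_perm_sub (k := fun i => c i * r i) (fun i => by rw [hr, hc]),
    ← Finset.sum_add_distrib]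
  refine Finset.sum_congr rfl fun i _ => ?_
  rw [noisy]
  ring

/-- For the optimal weights the score difference is the log likelihood ratio. -/
theorem sum_score_sub_eq_llr {r : ι → ℝ} (hr1 : ∀ i, r i ^ 2 < 1) {φ : Equiv.Perm ι}
    (hr : ∀ i, r (φ i) = r i) (a g : ι → ℝ) :
    ∑ i, r i / (1 - r i ^ 2) * noisy r a g i * (a (φ i) - a i) =
      llr (shift (amp r) φ a) g := by
  rw [sum_score_sub hr (c := fun i => r i / (1 - r i ^ 2)) (fun i => by rw [hr]), llr]
  congr 1
  · congr 2
    refine Finset.sum_congr rfl fun i _ => ?_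
    rw [shift, mul_pow, amp_sq (hr1 i)]
    ring
  · refine Finset.sum_congr rfl fun i _ => ?_
    have h1 : 0 < 1 - r i ^ 2 := by linarith [hr1 i]
    have h0 : √(1 - r i ^ 2) ≠ 0 := (Real.sqrt_pos.2 h1).ne'
    rw [shift, amp]
    congr 2
    rw [div_mul_eq_mul_div, div_eq_div_iff h1.ne' h0, mul_assoc, Real.mul_self_sqrt h1.le]

theorem lintegral_exp_linear (e : (ι → ℝ) → ℝ) (he : Measurable e) (u : (ι → ℝ) → ι → ℝ)
    (hu : Measurable u) :
    ∫⁻ p, ENNReal.ofReal (Real.exp (e p.1 + ∑ i, u p.1 i * p.2 i))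
        ∂(stdNormalPi ι).prod (stdNormalPi ι) =
      ∫⁻ a, ENNReal.ofReal (Real.exp (e a + (∑ i, u a i ^ 2) / 2)) ∂stdNormalPi ι := by
  have hu' : ∀ i, Measurable fun a => u a i := fun i => (measurable_pi_apply i).comp hu
  have hu'' : ∀ i, Measurable fun p : (ι → ℝ) × (ι → ℝ) => u p.1 i := fun i =>
    (hu' i).comp measurable_fst
  rw [lintegral_prod _ (by fun_prop)]
  refine lintegral_congr fun a => ?_
  simp_rw [Real.exp_add, ENNReal.ofReal_mul (Real.exp_pos (e a)).le]
  rw [lintegral_const_mul _ (by fun_prop), lintegral_exp_sum_mul]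

/-- Probability that a relabelling beats the truth, for the score with weights `c`. -/
theorem measure_score_nonneg_le [DecidableEq ι] {r c : ι → ℝ} {φ : Equiv.Perm ι}
    (hr1 : ∀ i, r i ^ 2 ≤ 1)
    (hr : ∀ i, r (φ i) = r i) (hc : ∀ i, c (φ i) = c i)
    (hpos : ∀ i, 0 < 1 + 4 * (c i * r i - c i ^ 2 * (1 - r i ^ 2))) :
    (stdNormalPi ι).prod (stdNormalPi ι)
        {p | 0 ≤ ∑ i, c i * noisy r p.1 p.2 i * (p.1 (φ i) - p.1 i)} ≤
      ENNReal.ofReal (∏ i ∈ φ.support,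
        (1 + 4 * (c i * r i - c i ^ 2 * (1 - r i ^ 2))) ^ (-(1 / 4) : ℝ)) := by
  have h8 : ∀ i, 1 + 8 * ((c i * r i - c i ^ 2 * (1 - r i ^ 2)) / 2) =
    1 + 4 * (c i * r i - c i ^ 2 * (1 - r i ^ 2)) := fun i => by ring
  have hm := lintegral_exp_perm_le φ (fun i => (c i * r i - c i ^ 2 * (1 - r i ^ 2)) / 2)
    (fun i => by rw [h8]; exact hpos i)
  simp_rw [h8] at hm
  -- Chernoff with exponent one: the free scale of `c` already plays the role of the Chernoff
  -- parameter.
  refine (measure_le_lintegral_exp _ (by unfold noisy; fun_prop) fun p hp => hp).trans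
    (le_trans (le_of_eq ?_) hm)
  simp_rw [sum_score_sub hr hc]
  rw [lintegral_exp_linear (fun a => -(∑ i, c i * r i * (a (φ i) - a i) ^ 2) / 2) (by fun_prop)
    (fun a i => c i * √(1 - r i ^ 2) * (a (φ i) - a i)) (by fun_prop)]
  refine lintegral_congr fun a => ?_
  congr 2
  rw [← add_div, ← Finset.sum_neg_distrib, ← Finset.sum_add_distrib, ← Finset.sum_neg_distrib,
    Finset.sum_div]
  refine Finset.sum_congr rfl fun i _ => ?_
  rw [mul_pow, mul_pow, Real.sq_sqrt (by linarith [hr1 i])]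
  ring

/-! ### Tail bounds on typical events, for permutations moving many nodes -/

section Restricted

variable (t : ι → ℝ) (T : Finset ι)

theorem measure_energy_gt_le (δ : ℝ) (ht : ∀ i, 0 < 1 - 2 * t i ^ 2) :
    (stdNormalPi ι).prod (stdNormalPi ι)
        {p | (1 + δ) * ∑ i ∈ T, t i ^ 2 < ∑ i ∈ T, t i ^ 2 * p.1 i ^ 2} ≤
      ENNReal.ofReal (Real.exp (-((1 + δ) * ∑ i ∈ T, t i ^ 2)) *
        ∏ i ∈ T, (1 - 2 * t i ^ 2) ^ (-(1 / 2) : ℝ)) := by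
  classical
  refine (measure_le_lintegral_exp _ (F := fun p => -((1 + δ) * ∑ i ∈ T, t i ^ 2) +
    ∑ i ∈ T, t i ^ 2 * p.1 i ^ 2) (by fun_prop) fun p hp => ?_).trans ?_
  · simp only [Set.mem_ofPred_eq] at hp
    linarith
  have h := lintegral_exp_sum_mul_sq (w := fun i => if i ∈ T then t i ^ 2 else 0) (fun i => by
    by_cases hi : i ∈ T <;> simp [hi, ht i])
  have h1 := lintegral_exp_linear (fun a : ι → ℝ => -((1 + δ) * ∑ i ∈ T, t i ^ 2) +
    ∑ i ∈ T, t i ^ 2 * a i ^ 2) (by fun_prop) (fun _ _ => 0) (by fun_prop)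
  simp only [zero_mul, Finset.sum_const_zero, add_zero, ne_eq, OfNat.ofNat_ne_zero,
    not_false_eq_true, zero_pow, zero_div] at h1
  rw [h1]
  simp_rw [Real.exp_add, ENNReal.ofReal_mul (Real.exp_pos (-((1 + δ) * ∑ i ∈ T, t i ^ 2))).le]
  rw [lintegral_const_mul _ (by fun_prop)]
  gcongr
  refine le_of_eq ?_
  simp only [ite_mul, zero_mul, Finset.sum_ite_mem, Finset.univ_inter] at h
  rw [h]
  congr 1
  rw [← Finset.prod_subset (Finset.subset_univ T)]
  · exact Finset.prod_congr rfl fun i hi => by simp [hi]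
  · intro i _ hi
    simp [hi]

/-- Chernoff with parameter δ/2. Integrating the noise produces the random quantity δ²/8 Σ t² a²;
the assumed upper bound on Σ t² a² enters the exponent with multiplier δ²/8 and cancels it exactly.
-/
theorem measure_noise_lt_le (δ : ℝ) (hδ : 0 ≤ δ) (hδ1 : δ ≤ 1) :
    (stdNormalPi ι).prod (stdNormalPi ι)
        {p | ∑ i ∈ T, t i ^ 2 * p.1 i ^ 2 ≤ (1 + δ) * ∑ i ∈ T, t i ^ 2 ∧
          ∑ i ∈ T, t i * p.1 i * p.2 i < -(δ * ∑ i ∈ T, t i ^ 2)} ≤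
      ENNReal.ofReal (Real.exp (-(δ ^ 2 / 4 * ∑ i ∈ T, t i ^ 2))) := by
  classical
  set L := ∑ i ∈ T, t i ^ 2 with hL
  have hL0 : 0 ≤ L := Finset.sum_nonneg fun i _ => sq_nonneg _
  refine (measure_le_lintegral_exp _ (F := fun p => (-(δ / 2 * (δ * L)) +
    δ ^ 2 / 8 * ((1 + δ) * L - ∑ i ∈ T, t i ^ 2 * p.1 i ^ 2)) +
    ∑ i, (if i ∈ T then -(δ / 2) * (t i * p.1 i) else 0) * p.2 i) ?_ fun p hp => ?_).trans ?_
  · refine Measurable.add (by fun_prop) (Finset.measurable_fun_sum _ fun i _ => ?_)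
    split_ifs <;> fun_prop
  · obtain ⟨hp1, hp2⟩ := hp
    simp only [ite_mul, zero_mul, Finset.sum_ite_mem, Finset.univ_inter, mul_assoc (-(δ / 2)),
      ← Finset.mul_sum]
    have h1 : 0 ≤ δ ^ 2 / 8 * ((1 + δ) * L - ∑ i ∈ T, t i ^ 2 * p.1 i ^ 2) := by
      have : 0 ≤ (1 + δ) * L - ∑ i ∈ T, t i ^ 2 * p.1 i ^ 2 := by linarith
      positivity
    nlinarith
  rw [lintegral_exp_linear (fun a : ι → ℝ => -(δ / 2 * (δ * L)) +
    δ ^ 2 / 8 * ((1 + δ) * L - ∑ i ∈ T, t i ^ 2 * a i ^ 2)) (by fun_prop)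
    (fun a i => if i ∈ T then -(δ / 2) * (t i * a i) else 0)
    (measurable_pi_lambda _ fun i => by split_ifs <;> fun_prop)]
  calc _ ≤ ∫⁻ _, ENNReal.ofReal (Real.exp (-(δ ^ 2 / 4 * L))) ∂stdNormalPi ι := by
        refine lintegral_mono fun a => ENNReal.ofReal_le_ofReal (Real.exp_le_exp.2 ?_)
        have h2 : ∑ i, (if i ∈ T then -(δ / 2) * (t i * a i) else 0) ^ 2 =
            δ ^ 2 / 4 * ∑ i ∈ T, t i ^ 2 * a i ^ 2 := by
          simp only [ite_pow, ne_eq, OfNat.ofNat_ne_zero, not_false_eq_true, zero_pow,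
            Finset.sum_ite_mem, Finset.univ_inter, Finset.mul_sum]
          exact Finset.sum_congr rfl fun i _ => by ring
        rw [h2]
        have : δ ^ 2 * L * δ ≤ δ ^ 2 * L * 1 := by gcongr
        nlinarith
    _ = _ := by simp

/-- The pairing with the noise splits into a permuted and an unpermuted part. On the typical event
the latter is at least -δL, with L = Σ t² over `T`, so only the permuted part is exponentiated.
Integrating it gives exp(½ Σ t² a²), which the bound on Σ t² a² turns into exp(L/2), while the full
factor exp(-|u|²/2) survives. A plain Chernoff bound with parameter 1/2 would retain only
exp(-|u|²/8). -/
theorem measure_llr_nonneg_le [DecidableEq ι] {φ : Equiv.Perm ι} (ht : ∀ i, t (φ i) = t i)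
    (hT : φ.support ⊆ T) (δ : ℝ) :
    (stdNormalPi ι).prod (stdNormalPi ι)
        {p | 0 ≤ llr (shift t φ p.1) p.2 ∧
          ∑ i ∈ T, t i ^ 2 * p.1 i ^ 2 ≤ (1 + δ) * ∑ i ∈ T, t i ^ 2 ∧
          -(δ * ∑ i ∈ T, t i ^ 2) ≤ ∑ i ∈ T, t i * p.1 i * p.2 i} ≤
      ENNReal.ofReal (Real.exp ((1 / 2 + 3 / 2 * δ) * ∑ i ∈ T, t i ^ 2) *
        ∏ i ∈ φ.support, (1 + 4 * t i ^ 2) ^ (-(1 / 4) : ℝ)) := by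
  set L := ∑ i ∈ T, t i ^ 2 with hL
  have hcomp : ∀ f : ι → ℝ, ∑ i ∈ T, f (φ i) = ∑ i ∈ T, f i := by
    intro f
    refine Finset.sum_equiv φ (fun i => ?_) (fun i _ => rfl)
    by_cases hi : i ∈ φ.support
    · exact iff_of_true (hT hi) (hT (Equiv.Perm.apply_mem_support.2 hi))
    · rw [Equiv.Perm.notMem_support.1 hi]
  have hN : ∀ a : ι → ℝ, ∑ i ∈ T, t i ^ 2 * a (φ i) ^ 2 = ∑ i ∈ T, t i ^ 2 * a i ^ 2 := by
    intro a
    rw [← hcomp fun i => t i ^ 2 * a i ^ 2]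
    simp_rw [ht]
  have hsplit : ∀ a g : ι → ℝ, ∑ i, shift t φ a i * g i =
      ∑ i ∈ T, t i * a (φ i) * g i - ∑ i ∈ T, t i * a i * g i := by
    intro a g
    rw [← Finset.sum_sub_distrib, ← Finset.sum_subset (Finset.subset_univ T)]
    · exact Finset.sum_congr rfl fun i _ => by rw [shift]; ring
    · intro i _ hi
      have : φ i = i := Equiv.Perm.notMem_support.1 fun h => hi (hT h)
      simp [shift, this]
  refine (measure_le_lintegral_exp _ (F := fun p => (-(∑ i, shift t φ p.1 i ^ 2) / 2 + δ * L +
    ((1 + δ) * L - ∑ i ∈ T, t i ^ 2 * p.1 i ^ 2) / 2) +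
    ∑ i, (if i ∈ T then t i * p.1 (φ i) else 0) * p.2 i) ?_ fun p hp => ?_).trans ?_
  · refine Measurable.add (by unfold shift; fun_prop) (Finset.measurable_fun_sum _ fun i _ => ?_)
    split_ifs <;> fun_prop
  · obtain ⟨hp0, hp1, hp2⟩ := hp
    rw [llr, hsplit] at hp0
    simp only [ite_mul, zero_mul, Finset.sum_ite_mem, Finset.univ_inter]
    linarith
  rw [lintegral_exp_linear (fun a : ι → ℝ => -(∑ i, shift t φ a i ^ 2) / 2 + δ * L +
    ((1 + δ) * L - ∑ i ∈ T, t i ^ 2 * a i ^ 2) / 2) (by unfold shift; fun_prop)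
    (fun a i => if i ∈ T then t i * a (φ i) else 0)
    (measurable_pi_lambda _ fun i => by split_ifs <;> fun_prop)]
  have hm := lintegral_exp_perm_le φ (fun i => t i ^ 2 / 2) (fun i => by positivity)
  simp_rw [show ∀ i, 1 + 8 * (t i ^ 2 / 2) = 1 + 4 * t i ^ 2 from fun i => by ring] at hm
  calc _ = ∫⁻ a, ENNReal.ofReal (Real.exp ((1 / 2 + 3 / 2 * δ) * L)) *
        ENNReal.ofReal (Real.exp (-∑ i, t i ^ 2 / 2 * (a (φ i) - a i) ^ 2)) ∂stdNormalPi ι := by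
        refine lintegral_congr fun a => ?_
        rw [← ENNReal.ofReal_mul (Real.exp_pos _).le, ← Real.exp_add]
        have h2 : ∑ i, (if i ∈ T then t i * a (φ i) else 0) ^ 2 =
            ∑ i ∈ T, t i ^ 2 * a i ^ 2 := by
          simp only [ite_pow, ne_eq, OfNat.ofNat_ne_zero, not_false_eq_true, zero_pow,
            Finset.sum_ite_mem, Finset.univ_inter]
          rw [← hN]
          exact Finset.sum_congr rfl fun i _ => by ring
        have h3 : ∑ i, t i ^ 2 / 2 * (a (φ i) - a i) ^ 2 = (∑ i, shift t φ a i ^ 2) / 2 := by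
          rw [Finset.sum_div]
          exact Finset.sum_congr rfl fun i _ => by rw [shift]; ring
        rw [h2, h3]
        congr 2
        ring
    _ ≤ _ := by
        rw [lintegral_const_mul _ (by fun_prop), ENNReal.ofReal_mul (Real.exp_pos _).le]
        gcongr

end Restricted

end Model

/-! ### Node permutations acting on edges and features -/

section Action

variable {n d : ℕ}

/-- The index set of the pairs of edge weights and of the pairs of features. -/
abbrev Coord (n d : ℕ) : Type := Edge n ⊕ (Fin n × Fin d)

/-- The action of a permutation of the nodes on the edges. -/
def edgeAct (σ : Equiv.Perm (Fin n)) : Equiv.Perm (Edge n) where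
  toFun e := ⟨e.1.map σ, by rw [Sym2.isDiag_map σ.injective]; exact e.2⟩
  invFun e := ⟨e.1.map σ.symm, by rw [Sym2.isDiag_map σ.symm.injective]; exact e.2⟩
  left_inv e := Subtype.ext (by simp [Sym2.map_map])
  right_inv e := Subtype.ext (by simp [Sym2.map_map])

/-- The action of a permutation of the nodes on the edges and the feature coordinates. -/
def act (d : ℕ) (σ : Equiv.Perm (Fin n)) : Equiv.Perm (Coord n d) :=
  Equiv.sumCongr (edgeAct σ) (Equiv.prodCongr σ (Equiv.refl _))

@[simp]
theorem act_inl (σ : Equiv.Perm (Fin n)) (e : Edge n) :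
    act d σ (Sum.inl e) = Sum.inl (edgeAct σ e) := rfl

@[simp]
theorem act_inr (σ : Equiv.Perm (Fin n)) (x : Fin n × Fin d) :
    act d σ (Sum.inr x) = Sum.inr (σ x.1, x.2) := rfl

theorem edgeAct_mul (σ τ : Equiv.Perm (Fin n)) : edgeAct (σ * τ) = edgeAct σ * edgeAct τ := by
  ext1 e
  exact Subtype.ext (by simp [edgeAct, Sym2.map_map])

theorem act_mul (σ τ : Equiv.Perm (Fin n)) : act d (σ * τ) = act d σ * act d τ := by
  ext1 j
  rcases j with e | x
  · simp [edgeAct_mul]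
  · simp

theorem act_one : act d (1 : Equiv.Perm (Fin n)) = 1 := by
  have h := act_mul (d := d) (1 : Equiv.Perm (Fin n)) 1
  rw [mul_one] at h
  exact (mul_eq_left.1 h.symm)

theorem act_inv (σ : Equiv.Perm (Fin n)) : act d σ⁻¹ = (act d σ)⁻¹ := by
  rw [eq_inv_iff_mul_eq_one, ← act_mul, inv_mul_cancel, act_one]

/-- A family that is constant on edges and on feature coordinates. -/
def uniformWeights (n d : ℕ) (x y : ℝ) : Coord n d → ℝ := Sum.elim (fun _ => x) (fun _ => y)

@[simp]
theorem uniformWeights_inl (x y : ℝ) (e : Edge n) : uniformWeights n d x y (Sum.inl e) = x := rfl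

@[simp]
theorem uniformWeights_inr (x y : ℝ) (z : Fin n × Fin d) :
    uniformWeights n d x y (Sum.inr z) = y := rfl

theorem uniformWeights_act (x y : ℝ) (σ : Equiv.Perm (Fin n)) (j : Coord n d) :
    uniformWeights n d x y (act d σ j) = uniformWeights n d x y j := by
  rcases j with e | z <;> rfl

theorem forall_uniformWeights {x y : ℝ} {p : ℝ → Prop} (hx : p x) (hy : p y) (j : Coord n d) :
    p (uniformWeights n d x y j) := by
  rcases j with e | z
  · exact hx
  · exact hy

theorem amp_uniformWeights (x y : ℝ) :
    amp (uniformWeights n d x y) = uniformWeights n d (x / √(1 - x ^ 2)) (y / √(1 - y ^ 2)) := by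
  ext j
  rcases j with e | z <;> rfl

end Action

/-! ### Counting moved edges and edges touching a set -/

section Counting

variable {n d : ℕ}

theorem two_mul_card_edges (Q : Sym2 (Fin n) → Prop) [DecidablePred Q] :
    2 * (Finset.univ.filter fun e : Edge n => Q e.1).card =
      ∑ i : Fin n, (Finset.univ.filter fun j : Fin n => i ≠ j ∧ Q s(i, j)).card := by
  classical
  set S : Finset (Fin n × Fin n) := Finset.univ.filter fun p => p.1 ≠ p.2 ∧ Q s(p.1, p.2) with hS
  have h1 : ∑ i : Fin n, (Finset.univ.filter fun j : Fin n => i ≠ j ∧ Q s(i, j)).card =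
      S.card := by
    simp_rw [hS, Finset.card_filter, Fintype.sum_prod_type]
  have h2 : (Finset.univ.filter fun e : Edge n => Q e.1).card =
      (S.image fun p => s(p.1, p.2)).card := by
    rw [← Finset.card_map (Function.Embedding.subtype _)]
    congr 1
    ext z
    induction z using Sym2.ind with
    | _ a b =>
      simp only [Finset.mem_map, Finset.mem_filter, Finset.mem_univ, true_and,
        Function.Embedding.coe_subtype, Subtype.exists, exists_and_right, exists_eq_right,
        Finset.mem_image, hS, Prod.exists, Sym2.mk_isDiag_iff]
      constructor
      · rintro ⟨hab, hQ⟩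
        exact ⟨a, b, ⟨hab, hQ⟩, rfl⟩
      · rintro ⟨a', b', ⟨hne, hQ⟩, h⟩
        rw [← h]
        refine ⟨?_, hQ⟩
        rcases Sym2.eq_iff.1 h with ⟨rfl, rfl⟩ | ⟨rfl, rfl⟩
        · exact hne
        · exact hne.symm
  -- Each edge has exactly two orderings of its endpoints.
  rw [h1, h2, Finset.card_eq_sum_card_image (fun p : Fin n × Fin n => s(p.1, p.2)) S, mul_comm,
    Finset.sum_const_nat]
  intro z hz
  obtain ⟨⟨a, b⟩, hab, rfl⟩ := Finset.mem_image.1 hz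
  have hab' := (Finset.mem_filter.1 hab).2
  have : (S.filter fun p => s(p.1, p.2) = s(a, b)) = {(a, b), (b, a)} := by
    ext ⟨x, y⟩
    simp only [hS, Finset.mem_filter, Finset.mem_univ, true_and, Sym2.eq_iff, Finset.mem_insert,
      Finset.mem_singleton, Prod.mk.injEq, and_iff_right_iff_imp]
    rintro (⟨rfl, rfl⟩ | ⟨rfl, rfl⟩)
    · exact hab'
    · exact ⟨hab'.1.symm, by rw [Sym2.eq_swap]; exact hab'.2⟩
  rw [this, Finset.card_pair]
  intro h
  exact hab'.1 (Prod.mk.inj h).1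

/-- The edges that touch a set of nodes. -/
def touching (V : Finset (Fin n)) : Finset (Edge n) :=
  Finset.univ.filter fun e => ∃ i ∈ V, i ∈ e.1

/-- The coordinates that touch a set of nodes. -/
def touchingCoord (d : ℕ) (V : Finset (Fin n)) : Finset (Coord n d) :=
  (touching V).disjSum (V ×ˢ Finset.univ)

theorem sum_ite_mem_card (V : Finset (Fin n)) (x y : ℕ) :
    ∑ i : Fin n, (if i ∈ V then x else y) = V.card * x + (n - V.card) * y := by
  rw [Finset.sum_ite, Finset.sum_const, Finset.sum_const, smul_eq_mul, smul_eq_mul,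
    Finset.filter_mem_eq_inter, Finset.univ_inter, Finset.filter_not, Finset.filter_mem_eq_inter,
    Finset.univ_inter, Finset.card_sdiff_of_subset (Finset.subset_univ _), Finset.card_univ,
    Fintype.card_fin]

theorem two_mul_card_touching (V : Finset (Fin n)) :
    2 * (touching V).card = V.card * (n - 1) + (n - V.card) * V.card := by
  classical
  rw [touching, two_mul_card_edges (fun z => ∃ i ∈ V, i ∈ z), ← sum_ite_mem_card]
  refine Finset.sum_congr rfl fun i _ => ?_
  split_ifs with hi
  · have hc := Finset.card_erase_of_mem (Finset.mem_univ i)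
    rw [Finset.card_univ, Fintype.card_fin] at hc
    rw [← hc]
    congr 1
    ext j
    simp only [Finset.mem_filter, Finset.mem_univ, true_and, Finset.mem_erase, and_true]
    constructor
    · rintro ⟨h, -⟩
      exact h.symm
    · intro h
      exact ⟨h.symm, i, hi, by simp⟩
  · congr 1
    ext j
    simp only [Finset.mem_filter, Finset.mem_univ, true_and, Sym2.mem_iff]
    constructor
    · rintro ⟨h, k, hk, rfl | rfl⟩
      · exact absurd hk hi
      · exact hk
    · intro h
      exact ⟨fun h' => hi (h' ▸ h), j, h, by simp⟩

/-- Count ordered pairs by first endpoint. If `i` is moved, the only edge at `i` that can be fixed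
is {i, σ i}, whence n - 2; if `i` is fixed, every edge from `i` to a moved node is moved. -/
theorem two_mul_card_support_edgeAct_ge (σ : Equiv.Perm (Fin n)) :
    σ.support.card * (n - 2) + (n - σ.support.card) * σ.support.card ≤
      2 * (edgeAct σ).support.card := by
  classical
  have h0 : (edgeAct σ).support = Finset.univ.filter fun e : Edge n => e.1.map σ ≠ e.1 := by
    ext e
    simp [edgeAct, Subtype.ext_iff]
  rw [h0, two_mul_card_edges (fun z => z.map σ ≠ z), ← sum_ite_mem_card]
  refine Finset.sum_le_sum fun i _ => ?_
  split_ifs with hi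
  · have hc := Finset.card_sdiff_of_subset (Finset.subset_univ {i, σ i})
    rw [Finset.card_univ, Fintype.card_fin,
      Finset.card_pair (Equiv.Perm.mem_support.1 hi).symm] at hc
    rw [← hc]
    refine Finset.card_le_card fun j hj => ?_
    simp only [Finset.mem_sdiff, Finset.mem_univ, Finset.mem_insert, Finset.mem_singleton,
      not_or, true_and] at hj
    simp only [ne_eq, Finset.mem_filter, Finset.mem_univ, true_and, Sym2.map_mk, Sym2.eq_iff,
      not_or, not_and]
    exact ⟨fun h => hj.1 h.symm, fun h => absurd h (Equiv.Perm.mem_support.1 hi),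
      fun h => absurd h.symm hj.2⟩
  · refine Finset.card_le_card fun j hj => ?_
    have hσi := Equiv.Perm.notMem_support.1 hi
    have hσj := Equiv.Perm.mem_support.1 hj
    simp only [ne_eq, Finset.mem_filter, Finset.mem_univ, true_and, Sym2.map_mk, Sym2.eq_iff,
      not_or, not_and]
    have hij : i ≠ j := fun h => hi (h ▸ hj)
    exact ⟨hij, fun _ => hσj, fun h => absurd (hσi.symm.trans h) hij⟩

theorem support_edgeAct_subset (σ : Equiv.Perm (Fin n)) :
    (edgeAct σ).support ⊆ touching σ.support := by
  intro e he
  rw [Equiv.Perm.mem_support] at he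
  rw [touching, Finset.mem_filter]
  refine ⟨Finset.mem_univ _, ?_⟩
  by_contra h
  push Not at h
  refine he (Subtype.ext ?_)
  obtain ⟨z, hz⟩ := e
  induction z using Sym2.ind with
  | _ a b =>
    have ha : σ a = a := Equiv.Perm.notMem_support.1 fun h' => h a h' (by simp)
    have hb : σ b = b := Equiv.Perm.notMem_support.1 fun h' => h b h' (by simp)
    simp [edgeAct, ha, hb]

theorem support_act (σ : Equiv.Perm (Fin n)) :
    (act d σ).support = (edgeAct σ).support.disjSum (σ.support ×ˢ Finset.univ) := by
  ext j
  rcases j with e | x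
  · simp
  · rcases x with ⟨i, k⟩
    simp

theorem support_act_subset (σ : Equiv.Perm (Fin n)) :
    (act d σ).support ⊆ touchingCoord d σ.support := by
  rw [support_act, touchingCoord]
  exact Finset.disjSum_mono (support_edgeAct_subset σ) (Finset.Subset.refl _)

theorem prod_support_act (σ : Equiv.Perm (Fin n)) (x y : ℝ) (f : ℝ → ℝ) :
    ∏ j ∈ (act d σ).support, f (uniformWeights n d x y j) =
      f x ^ (edgeAct σ).support.card * f y ^ (σ.support.card * d) := by
  rw [support_act, Finset.prod_disjSum]
  simp

theorem prod_touchingCoord (V : Finset (Fin n)) (x y : ℝ) (f : ℝ → ℝ) :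
    ∏ j ∈ touchingCoord d V, f (uniformWeights n d x y j) =
      f x ^ (touching V).card * f y ^ (V.card * d) := by
  rw [touchingCoord, Finset.prod_disjSum]
  simp

theorem sum_touchingCoord (V : Finset (Fin n)) (x y : ℝ) (f : ℝ → ℝ) :
    ∑ j ∈ touchingCoord d V, f (uniformWeights n d x y j) =
      (touching V).card * f x + (V.card * d : ℕ) * f y := by
  rw [touchingCoord, Finset.sum_disjSum]
  simp

end Counting

/-! ### Correlated pairs from independent Gaussians -/

section Law

theorem posSemidef_corr {r : ℝ} (hr : r ∈ Set.Icc (-1 : ℝ) 1) :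
    (!![1, r; r, 1] : Matrix (Fin 2) (Fin 2) ℝ).PosSemidef := by
  refine Matrix.PosSemidef.of_dotProduct_mulVec_nonneg ?_ fun x => ?_
  · ext i j
    fin_cases i <;> fin_cases j <;> simp
  · simp only [star_trivial, dotProduct, Matrix.mulVec, Fin.sum_univ_two, Matrix.of_apply,
      Matrix.cons_val_zero, Matrix.cons_val_one, Matrix.cons_val', Matrix.cons_val_fin_one]
    have h2 : r ^ 2 ≤ 1 := by nlinarith [hr.1, hr.2]
    nlinarith [sq_nonneg (x 0 + r * x 1), sq_nonneg (x 1)]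

/-- A Gaussian pair with correlation `r`, built from two independent standard Gaussians. -/
noncomputable def gaussianPair (r : ℝ) (x : ℝ × ℝ) : EuclideanSpace ℝ (Fin 2) :=
  !₂[x.1, r * x.1 + √(1 - r ^ 2) * x.2]

theorem measurable_gaussianPair (r : ℝ) : Measurable (gaussianPair r) := by
  refine (WithLp.measurable_toLp 2 _).comp (measurable_pi_lambda _ fun i => ?_)
  fin_cases i
  · simpa using measurable_fst
  · simp only [Fin.mk_one, Matrix.cons_val_one, Matrix.cons_val_fin_one]
    fun_prop

theorem measurePreserving_gaussianPair {r : ℝ} (hr : r ∈ Set.Icc (-1 : ℝ) 1) :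
    MeasurePreserving (gaussianPair r) (stdNormal.prod stdNormal) (corrGaussian r) := by
  refine ⟨measurable_gaussianPair r, ?_⟩
  have := Measure.isProbabilityMeasure_map (μ := stdNormal.prod stdNormal)
    (measurable_gaussianPair r).aemeasurable
  refine Measure.ext_of_charFun (funext fun t => ?_)
  have h2 : r ^ 2 ≤ 1 := by nlinarith [hr.1, hr.2]
  have hs : √(1 - r ^ 2) ^ 2 = 1 - r ^ 2 := Real.sq_sqrt (by linarith)
  rw [corrGaussian, charFun_multivariateGaussian (posSemidef_corr hr), charFun_apply,
    integral_map (measurable_gaussianPair r).aemeasurable (by fun_prop)]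
  calc _ = ∫ x : ℝ × ℝ, Complex.exp (((t 0 + r * t 1) * Complex.I) * x.1) *
        Complex.exp ((√(1 - r ^ 2) * t 1 * Complex.I) * x.2) ∂stdNormal.prod stdNormal := by
        congr 1
        ext x
        rw [← Complex.exp_add]
        congr 1
        simp only [gaussianPair, PiLp.inner_apply, Fin.sum_univ_two, RCLike.inner_apply,
          conj_trivial, Matrix.cons_val_zero, Matrix.cons_val_one, Matrix.cons_val_fin_one]
        push_cast
        ring
    _ = _ := by
        rw [integral_prod_mul (fun y : ℝ => Complex.exp (((t 0 + r * t 1) * Complex.I) * y))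
          (fun y : ℝ => Complex.exp ((√(1 - r ^ 2) * t 1 * Complex.I) * y)),
          integral_cexp_mul_stdNormal, integral_cexp_mul_stdNormal, ← Complex.exp_add]
        congr 1
        simp only [inner_zero_right, Complex.ofReal_zero, zero_mul, zero_sub, dotProduct,
          Matrix.mulVec, Fin.sum_univ_two, Matrix.of_apply,
          Matrix.cons_val_zero, Matrix.cons_val_one, Matrix.cons_val', Matrix.cons_val_fin_one]
        have hs' : (√(1 - r ^ 2) : ℂ) ^ 2 = 1 - (r : ℂ) ^ 2 := by
          rw [← Complex.ofReal_pow, hs]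
          push_cast
          rfl
        push_cast
        simp only [mul_pow, hs', Complex.I_sq]
        ring

variable {n d : ℕ}

/-- The Gaussian pairs of the model, built from independent standard Gaussians. -/
noncomputable def latentOf (n d : ℕ) (ρ η : ℝ) (p : (Coord n d → ℝ) × (Coord n d → ℝ)) :
    (Edge n → EuclideanSpace ℝ (Fin 2)) × (Fin n × Fin d → EuclideanSpace ℝ (Fin 2)) :=
  (fun e => gaussianPair ρ (p.1 (Sum.inl e), p.2 (Sum.inl e)),
    fun x => gaussianPair η (p.1 (Sum.inr x), p.2 (Sum.inr x)))

/-- The law of the independent standard Gaussians that generate the model. -/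
noncomputable abbrev baseLaw (n d : ℕ) : Measure ((Coord n d → ℝ) × (Coord n d → ℝ)) :=
  (stdNormalPi (Coord n d)).prod (stdNormalPi (Coord n d))

theorem measurePreserving_latentOf {ρ η : ℝ} (hρ : ρ ∈ Set.Icc (-1 : ℝ) 1)
    (hη : η ∈ Set.Icc (-1 : ℝ) 1) :
    MeasurePreserving (latentOf n d ρ η) (baseLaw n d)
      ((Measure.pi fun _ : Edge n => corrGaussian ρ).prod
        (Measure.pi fun _ : Fin n × Fin d => corrGaussian η)) := by
  have h1 := (measurePreserving_arrowProdEquivProdArrow ℝ ℝ (Coord n d)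
    (fun _ => stdNormal) (fun _ => stdNormal)).symm
  have h2 := measurePreserving_sumPiEquivProdPi
    (fun _ : Edge n ⊕ (Fin n × Fin d) => stdNormal.prod stdNormal)
  have h3 := (measurePreserving_pi (fun _ : Edge n => stdNormal.prod stdNormal) _
    fun _ => measurePreserving_gaussianPair hρ).prod
    (measurePreserving_pi (fun _ : Fin n × Fin d => stdNormal.prod stdNormal) _
      fun _ => measurePreserving_gaussianPair hη)
  exact h3.comp (h2.comp h1)

end Law

/-! ### The data as a function of the permutation and the Gaussians -/

section Observation

variable {n d : ℕ}

/-- The data attached to two families of weights and features. -/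
noncomputable def encode (x : (Coord n d → ℝ) × (Coord n d → ℝ)) : Data n d :=
  (adjacency fun e => x.1 (Sum.inl e), adjacency fun e => x.2 (Sum.inl e),
    fun i k => x.1 (Sum.inr (i, k)), fun i k => x.2 (Sum.inr (i, k)))

/-- The weight of an edge in a symmetric matrix. -/
noncomputable def edgeWeight (M : Fin n → Fin n → ℝ) (e : Edge n) : ℝ :=
  M (Quot.out e.1).1 (Quot.out e.1).2

theorem edgeWeight_adjacency (w : Edge n → ℝ) : edgeWeight (adjacency w) = w := by
  ext e
  obtain ⟨z, hz⟩ := e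
  have h : s((Quot.out z).1, (Quot.out z).2) = z := Quot.out_eq z
  have hne : (Quot.out z).1 ≠ (Quot.out z).2 := by
    intro h'
    apply hz
    rw [← h]
    exact h'
  rw [edgeWeight, adjacency, dif_neg hne]
  exact congrArg w (Subtype.ext h)

/-- The families of weights and features read off from the data. -/
noncomputable def decode (D : Data n d) : (Coord n d → ℝ) × (Coord n d → ℝ) :=
  (Sum.elim (edgeWeight D.1) fun x => D.2.2.1 x.1 x.2,
    Sum.elim (edgeWeight D.2.1) fun x => D.2.2.2 x.1 x.2)

theorem decode_encode (x : (Coord n d → ℝ) × (Coord n d → ℝ)) : decode (encode x) = x := by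
  refine Prod.ext ?_ ?_ <;> ext j <;> rcases j with e | z <;>
    simp [decode, encode, edgeWeight_adjacency]

theorem measurable_decode : Measurable (decode (n := n) (d := d)) := by
  refine Measurable.prodMk (measurable_pi_lambda _ fun j => ?_)
    (measurable_pi_lambda _ fun j => ?_) <;> rcases j with e | z <;>
    simp only [Sum.elim_inl, Sum.elim_inr, edgeWeight] <;> fun_prop

theorem measurable_encode : Measurable (encode (n := n) (d := d)) := by
  have hA (i j : Fin n) (f : (Coord n d → ℝ) × (Coord n d → ℝ) → Edge n → ℝ)
      (hf : ∀ e, Measurable fun p => f p e) : Measurable fun q => adjacency (f q) i j := by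
    unfold adjacency
    by_cases h : i = j
    · simp [h]
    · simpa [h] using hf _
  refine Measurable.prodMk ?_ (Measurable.prodMk ?_ (Measurable.prodMk ?_ ?_))
  · exact measurable_pi_lambda _ fun i => measurable_pi_lambda _ fun j =>
      hA i j (fun x e => x.1 (Sum.inl e)) fun e => by fun_prop
  · exact measurable_pi_lambda _ fun i => measurable_pi_lambda _ fun j =>
      hA i j (fun x e => x.2 (Sum.inl e)) fun e => by fun_prop
  · fun_prop
  · fun_prop

theorem adjacency_edgeAct (w : Edge n → ℝ) (σ : Equiv.Perm (Fin n)) (i j : Fin n) :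
    adjacency w (σ i) (σ j) = adjacency (w ∘ edgeAct σ) i j := by
  unfold adjacency
  by_cases h : i = j
  · simp [h]
  · simp [h, edgeAct]

/-- The data generated by the hidden permutation and the independent standard Gaussians. -/
noncomputable def observed (ρ η : ℝ) (π : Equiv.Perm (Fin n))
    (p : (Coord n d → ℝ) × (Coord n d → ℝ)) : Data n d :=
  encode (p.1, noisy (uniformWeights n d ρ η) p.1 p.2 ∘ act d π⁻¹)

theorem observe_latentOf (ρ η : ℝ) (π : Equiv.Perm (Fin n))
    (p : (Coord n d → ℝ) × (Coord n d → ℝ)) :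
    observe (π, latentOf n d ρ η p) = observed ρ η π p := by
  refine Prod.ext ?_ (Prod.ext ?_ (Prod.ext ?_ ?_))
  · simp [observe, observed, encode, latentOf, gaussianPair]
  · ext i j
    have h := adjacency_edgeAct (fun e => (latentOf n d ρ η p).1 e 1) π⁻¹ i j
    simp only [observe, observed, encode]
    exact h
  · simp [observe, observed, encode, latentOf, gaussianPair]
  · ext i k
    simp [observe, observed, encode, latentOf, gaussianPair, noisy, Equiv.Perm.inv_def]

theorem measurable_observed (ρ η : ℝ) (π : Equiv.Perm (Fin n)) :
    Measurable (observed (d := d) ρ η π) := by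
  refine measurable_encode.comp (measurable_fst.prodMk ?_)
  exact measurable_pi_lambda _ fun i =>
    (measurable_pi_apply (act d π⁻¹ i)).comp (measurable_noisy _)

/-- Reduces every probability to an average over the hidden permutation of probabilities on one
fixed Gaussian space, where all the estimates take place. -/
theorem jointLaw_apply {ρ η : ℝ} (hρ : ρ ∈ Set.Icc (-1 : ℝ) 1) (hη : η ∈ Set.Icc (-1 : ℝ) 1)
    {s : Set (Equiv.Perm (Fin n) × Data n d)} (hs : MeasurableSet s) :
    jointLaw n d ρ η s =
      (∑ π : Equiv.Perm (Fin n), baseLaw n d {p | (π, observed ρ η π p) ∈ s}) /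
        (Fintype.card (Equiv.Perm (Fin n)) : ℝ≥0∞) := by
  have hU : ∀ f : Equiv.Perm (Fin n) → ℝ≥0∞,
      ∫⁻ π, f π ∂uniformOn (Set.univ : Set (Equiv.Perm (Fin n))) =
        (∑ π, f π) / (Fintype.card (Equiv.Perm (Fin n)) : ℝ≥0∞) := by
    intro f
    rw [lintegral_fintype, ENNReal.div_eq_inv_mul, Finset.mul_sum]
    refine Finset.sum_congr rfl fun π _ => ?_
    rw [uniformOn_univ, Measure.count_singleton, one_div, mul_comm]
  have hms : MeasurableSet ((fun p : Latent n d => (p.1, observe p)) ⁻¹' s) :=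
    measurable_observe n d hs
  rw [jointLaw, Measure.map_apply (measurable_observe n d) hs, latentLaw,
    Measure.prod_apply hms, hU]
  congr 1
  refine Finset.sum_congr rfl fun π _ => ?_
  rw [← (measurePreserving_latentOf hρ hη).measure_preimage
    (measurable_prodMk_left hms).nullMeasurableSet]
  congr 1
  ext p
  simp [← observe_latentOf]

theorem successProb_eq {ρ η : ℝ} (hρ : ρ ∈ Set.Icc (-1 : ℝ) 1) (hη : η ∈ Set.Icc (-1 : ℝ) 1)
    (f : Estimator n d) :
    ENNReal.ofReal (successProb ρ η f) =
      (∑ π : Equiv.Perm (Fin n), baseLaw n d {p | f.1 (observed ρ η π p) = π}) /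
        (Fintype.card (Equiv.Perm (Fin n)) : ℝ≥0∞) := by
  rw [successProb, ofReal_measureReal, jointLaw_apply hρ hη]
  · rfl
  · exact measurableSet_eq_fun (f.2.comp measurable_snd) measurable_fst

end Observation

/-! ### Existence and optimality of MAP estimators -/

section MAP

theorem exists_measurable_argmax {Ω ι : Type*} [MeasurableSpace Ω] [MeasurableSpace ι]
    [DiscreteMeasurableSpace ι] [Finite ι] [Nonempty ι] {α : Type*} [MeasurableSpace α]
    [LinearOrder α] [TopologicalSpace α] [OrderClosedTopology α] [SecondCountableTopology α]
    [OpensMeasurableSpace α] (s : ι → Ω → α) (hs : ∀ i, Measurable (s i)) :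
    ∃ f : Ω → ι, Measurable f ∧ ∀ x i, s i x ≤ s (f x) x := by
  classical
  have hmain : ∀ t : Set ι, t.Finite → t.Nonempty →
      ∃ f : Ω → ι, Measurable f ∧ ∀ x, ∀ i ∈ t, s i x ≤ s (f x) x := by
    intro t ht
    induction t, ht using Set.Finite.induction_on with
    | empty => simp
    | @insert i t hi _ ih =>
      intro _
      rcases t.eq_empty_or_nonempty with rfl | hne
      · exact ⟨fun _ => i, measurable_const, by simp⟩
      · obtain ⟨f, hf, hmax⟩ := ih hne
        have hsf : Measurable fun x => s (f x) x := by
          have : Measurable (fun p : ι × Ω => s p.1 p.2) :=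
            measurable_from_prod_countable_right hs
          exact this.comp (hf.prodMk measurable_id)
        refine ⟨fun x => if s (f x) x ≤ s i x then i else f x,
          Measurable.ite (measurableSet_le hsf (hs i)) measurable_const hf, fun x j hj => ?_⟩
        by_cases h : s (f x) x ≤ s i x
        · simp only [h, if_true]
          rcases Set.mem_insert_iff.1 hj with rfl | hj
          · exact le_rfl
          · exact (hmax x j hj).trans h
        · simp only [h, if_false]
          rcases Set.mem_insert_iff.1 hj with rfl | hj
          · exact (not_le.1 h).le
          · exact hmax x j hj
  obtain ⟨f, hf, h⟩ := hmain Set.univ Set.finite_univ Set.univ_nonempty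
  exact ⟨f, hf, fun x i => h x i (Set.mem_univ i)⟩

variable {n d : ℕ}

theorem exists_isMAP (n d : ℕ) (ρ η : ℝ) : ∃ f : Estimator n d, IsMAP ρ η f := by
  obtain ⟨f, hf, h⟩ := exists_measurable_argmax
    (fun (σ : Equiv.Perm (Fin n)) (D : Data n d) => posterior n d ρ η D {σ})
    (fun σ => Kernel.measurable_coe _ (measurableSet_singleton σ))
  exact ⟨⟨f, hf⟩, Eventually.of_forall fun D σ => h D σ⟩

/-- Disintegrating the joint law along the data expresses success as the mean posterior mass of the
guess, so pointwise maximization of the posterior is optimal. -/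
theorem successProb_eq_lintegral (ρ η : ℝ) (f : Estimator n d) :
    ENNReal.ofReal (successProb ρ η f) =
      ∫⁻ D, posterior n d ρ η D {f.1 D} ∂(jointLaw n d ρ η).map Prod.snd := by
  rw [successProb, ofReal_measureReal]
  have h := compProd_map_condDistrib (mβ := inferInstance) (μ := jointLaw n d ρ η) (X := Prod.snd)
    (Y := Prod.fst) measurable_fst.aemeasurable
  have hs : MeasurableSet {q : Data n d × Equiv.Perm (Fin n) | q.2 = f.1 q.1} :=
    measurableSet_eq_fun measurable_snd (f.2.comp measurable_fst)
  have h1 : jointLaw n d ρ η {p | f.1 p.2 = p.1} =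
      ((jointLaw n d ρ η).map fun p => (p.2, p.1)) {q | q.2 = f.1 q.1} := by
    rw [Measure.map_apply (by fun_prop) hs]
    congr 1
    ext p
    simp [eq_comm]
  rw [h1, ← h, Measure.compProd_apply hs]
  rfl

theorem IsMAP.successProb_le {ρ η : ℝ} {f : Estimator n d} (hf : IsMAP ρ η f)
    (g : Estimator n d) : successProb ρ η g ≤ successProb ρ η f := by
  have h0 : 0 ≤ successProb ρ η f := measureReal_nonneg
  rw [← ENNReal.ofReal_le_ofReal_iff h0, successProb_eq_lintegral, successProb_eq_lintegral]
  exact lintegral_mono_ae (hf.mono fun D hD => hD _)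

end MAP

/-! ### Counting permutations by the size of their support -/

section Counting

variable {n : ℕ}

theorem card_perm_support_eq_le (V : Finset (Fin n)) :
    (Finset.univ.filter fun σ : Equiv.Perm (Fin n) => σ.support = V).card ≤ V.card.factorial := by
  classical
  have h : Fintype.card {f : Equiv.Perm (Fin n) // ∀ a, ¬ a ∈ V → f a = a} =
      V.card.factorial := by
    rw [← Fintype.card_congr (Equiv.Perm.subtypeEquivSubtypePerm fun a => a ∈ V),
      Fintype.card_perm, Fintype.card_coe]
  rw [← h, Fintype.card_subtype]
  refine Finset.card_le_card fun σ hσ => ?_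
  simp only [Finset.mem_filter, Finset.mem_univ, true_and] at hσ ⊢
  intro a ha
  rw [← hσ] at ha
  exact Equiv.Perm.notMem_support.1 ha

/-- Choosing the support and then permuting it gives at most n(n - 1)⋯(n - m + 1) possibilities. -/
theorem card_perm_card_support_eq_le (m : ℕ) :
    (Finset.univ.filter fun σ : Equiv.Perm (Fin n) => σ.support.card = m).card ≤ n ^ m := by
  classical
  have h : (Finset.univ.filter fun σ : Equiv.Perm (Fin n) => σ.support.card = m) ⊆
      (Finset.powersetCard m Finset.univ).biUnion fun V =>
        Finset.univ.filter fun σ : Equiv.Perm (Fin n) => σ.support = V := by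
    intro σ hσ
    simp only [Finset.mem_filter, Finset.mem_univ, true_and] at hσ
    simp [Finset.mem_powersetCard, hσ]
  calc _ ≤ ∑ V ∈ Finset.powersetCard m Finset.univ,
        (Finset.univ.filter fun σ : Equiv.Perm (Fin n) => σ.support = V).card :=
        (Finset.card_le_card h).trans Finset.card_biUnion_le
    _ ≤ ∑ V ∈ Finset.powersetCard m (Finset.univ : Finset (Fin n)), m.factorial := by
        refine Finset.sum_le_sum fun V hV => ?_
        rw [← (Finset.mem_powersetCard.1 hV).2]
        exact card_perm_support_eq_le V
    _ = n.descFactorial m := by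
        rw [Finset.sum_const, Finset.card_powersetCard, Finset.card_univ, Fintype.card_fin,
          smul_eq_mul, mul_comm, Nat.descFactorial_eq_factorial_mul_choose]
    _ ≤ n ^ m := Nat.descFactorial_le_pow n m

/-- The displaced permutations are outweighed by an exponential penalty on their support. -/
theorem sum_perm_pow_card_support_le {q : ℝ} (hn : 0 < n) (hq : 0 ≤ q) (hq2 : q ≤ 1 / 2) :
    ∑ σ : Equiv.Perm (Fin n) with σ ≠ 1, (q / n) ^ σ.support.card ≤ 2 * q := by
  classical
  have hn' : (0 : ℝ) < n := by exact_mod_cast hn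
  calc ∑ σ : Equiv.Perm (Fin n) with σ ≠ 1, (q / n) ^ σ.support.card
      ≤ ∑ m ∈ Finset.Icc 1 n, ∑ σ : Equiv.Perm (Fin n) with σ.support.card = m,
          (q / n) ^ σ.support.card := by
        rw [← Finset.sum_biUnion]
        · refine Finset.sum_le_sum_of_subset_of_nonneg (fun σ hσ => ?_) fun _ _ _ => by positivity
          simp only [Finset.mem_filter, Finset.mem_univ, true_and] at hσ
          simp only [Finset.mem_biUnion, Finset.mem_Icc, Finset.mem_filter, Finset.mem_univ,
            true_and, exists_eq_right']
          refine ⟨?_, (Finset.card_le_univ _).trans (by simp)⟩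
          rw [Nat.one_le_iff_ne_zero, ne_eq, Equiv.Perm.card_support_eq_zero]
          exact hσ
        · intro i _ j _ hij
          refine Finset.disjoint_left.2 fun σ hi hj => hij ?_
          simp only [Finset.mem_filter] at hi hj
          exact hi.2.symm.trans hj.2
    _ ≤ ∑ m ∈ Finset.Icc 1 n, q ^ m := by
        refine Finset.sum_le_sum fun m _ => ?_
        rw [Finset.sum_congr rfl (g := fun _ => (q / n) ^ m) fun σ hσ => by
          rw [(Finset.mem_filter.1 hσ).2], Finset.sum_const, nsmul_eq_mul]
        calc _ ≤ (n : ℝ) ^ m * (q / n) ^ m := by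
              gcongr
              exact_mod_cast card_perm_card_support_eq_le m
          _ = q ^ m := by
              rw [← mul_pow]
              congr 1
              field_simp
    _ ≤ 2 * q := by
        have h1 : q < 1 := by linarith
        have := geom_sum_Ico_le_of_lt_one (m := 1) (n := n + 1) hq h1
        rw [← Finset.Ico_add_one_right_eq_Icc]
        refine this.trans ?_
        rw [pow_one, div_le_iff₀ (by linarith)]
        nlinarith

end Counting

/-! ### Exponential forms of the product bounds -/

section Bounds

/-- From log(1 + x) ≥ x/(1 + x) ≥ (1 - δ)x: for small signals per coordinate, products over
coordinates behave like exponentials of sums. -/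
theorem rpow_neg_le_exp {x δ : ℝ} (hx : 0 ≤ x) (hxδ : x ≤ δ) {k : ℝ} (hk : 0 ≤ k) :
    (1 + x) ^ (-k) ≤ Real.exp (-((1 - δ) * x * k)) := by
  have h1 : 0 < 1 + x := by linarith
  rw [Real.rpow_def_of_pos h1, Real.exp_le_exp]
  have h2 := Real.one_sub_inv_le_log_of_pos h1
  have h3 : (1 - δ) * x ≤ 1 - (1 + x)⁻¹ := by
    rw [show 1 - (1 + x)⁻¹ = x / (1 + x) by field_simp; ring, le_div_iff₀ h1]
    nlinarith [mul_nonneg hx hx]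
  nlinarith [mul_le_mul_of_nonneg_right (h3.trans h2) hk]

theorem rpow_neg_pow_le_exp {x δ : ℝ} (hx : 0 ≤ x) (hxδ : x ≤ δ) (k : ℕ) :
    ((1 + x) ^ (-(1 / 4) : ℝ)) ^ k ≤ Real.exp (-((1 - δ) * x * (k / 4))) := by
  rw [← Real.rpow_natCast, ← Real.rpow_mul (by linarith)]
  refine le_trans (le_of_eq ?_) (rpow_neg_le_exp hx hxδ (k := k / 4) (by positivity))
  congr 1
  ring

theorem rpow_neg_half_pow_le_exp {x δ : ℝ} (hx : 0 ≤ x) (hxδ : 8 * x ≤ δ) (hδ : δ ≤ 1) (k : ℕ) :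
    ((1 - 2 * x) ^ (-(1 / 2) : ℝ)) ^ k ≤ Real.exp ((1 + δ / 2) * (k * x)) := by
  have h1 : 0 < 1 - 2 * x := by linarith
  rw [← Real.rpow_natCast, ← Real.rpow_mul h1.le, Real.rpow_def_of_pos h1, Real.exp_le_exp]
  have h2 := Real.one_sub_inv_le_log_of_pos h1
  have h3 : -((1 + δ / 2) * (2 * x)) ≤ 1 - (1 - 2 * x)⁻¹ := by
    rw [show 1 - (1 - 2 * x)⁻¹ = -(2 * x) / (1 - 2 * x) by field_simp; ring, le_div_iff₀ h1]
    nlinarith [mul_nonneg hx hx, mul_nonneg hx (sub_nonneg.2 hδ), mul_nonneg hx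
      (sub_nonneg.2 hxδ), mul_nonneg (mul_nonneg hx hx) (sub_nonneg.2 hδ)]
  have hk : (0 : ℝ) ≤ k / 2 := by positivity
  nlinarith [mul_le_mul_of_nonneg_right (h3.trans h2) hk]

/-- Chernoff with parameter 1/2, the optimal choice: integrating the noise leaves exp(-|u|²/8). -/
theorem measure_llr_nonneg_le_simple {ι : Type*} [Fintype ι] [DecidableEq ι] (t : ι → ℝ)
    (φ : Equiv.Perm ι) :
    (stdNormalPi ι).prod (stdNormalPi ι) {p | 0 ≤ llr (shift t φ p.1) p.2} ≤
      ENNReal.ofReal (∏ i ∈ φ.support, (1 + t i ^ 2) ^ (-(1 / 4) : ℝ)) := by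
  have hm := lintegral_exp_perm_le φ (fun i => t i ^ 2 / 8) (fun i => by positivity)
  simp_rw [show ∀ i, 1 + 8 * (t i ^ 2 / 8) = 1 + t i ^ 2 from fun i => by ring] at hm
  refine (measure_le_lintegral_exp _ (F := fun p => -(∑ i, shift t φ p.1 i ^ 2) / 4 +
    ∑ i, shift t φ p.1 i / 2 * p.2 i) (by unfold shift; fun_prop) fun p hp => ?_).trans
    (le_trans (le_of_eq ?_) hm)
  · have : 0 ≤ llr (shift t φ p.1) p.2 := hp
    simp_rw [div_mul_eq_mul_div, ← Finset.sum_div]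
    rw [llr] at this
    linarith
  rw [lintegral_exp_linear (fun a => -(∑ i, shift t φ a i ^ 2) / 4) (by unfold shift; fun_prop)
    (fun a i => shift t φ a i / 2) (by unfold shift; fun_prop)]
  refine lintegral_congr fun a => ?_
  congr 2
  simp_rw [div_pow, ← Finset.sum_div]
  have : ∑ i, t i ^ 2 / 8 * (a (φ i) - a i) ^ 2 = (∑ i, shift t φ a i ^ 2) / 8 := by
    rw [Finset.sum_div]
    exact Finset.sum_congr rfl fun i _ => by rw [shift]; ring
  rw [this]
  ring

end Bounds

/-! ### Score maximizers and comparison with MAP -/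

section Estimator

variable {n d : ℕ}

/-- The estimator maximizes the weighted overlap of (A, X) with the relabelled (B, Y). Reindexing by
the truth shows that an error exhibits a nontrivial σ whose relative score is nonnegative, an event
that no longer involves the hidden permutation. -/
theorem exists_estimator_of_score (ρ η c₁ c₂ : ℝ) :
    ∃ g : Estimator n d, ∀ (π : Equiv.Perm (Fin n)) (p : (Coord n d → ℝ) × (Coord n d → ℝ)),
      g.1 (observed ρ η π p) ≠ π → ∃ σ : Equiv.Perm (Fin n), σ ≠ 1 ∧
        0 ≤ ∑ j, uniformWeights n d c₁ c₂ j * noisy (uniformWeights n d ρ η) p.1 p.2 j *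
          (p.1 (act d σ j) - p.1 j) := by
  set c := uniformWeights n d c₁ c₂ with hc
  obtain ⟨f, hf, hmax⟩ := exists_measurable_argmax
    (fun (π : Equiv.Perm (Fin n)) (D : Data n d) =>
      ∑ j, c j * (decode D).1 j * (decode D).2 (act d π j)) (fun π => by
        have h1 : ∀ j, Measurable fun D : Data n d => (decode D).1 j := fun j =>
          (measurable_pi_apply j).comp (measurable_fst.comp measurable_decode)
        have h2 : ∀ j, Measurable fun D : Data n d => (decode D).2 j := fun j =>
          (measurable_pi_apply j).comp (measurable_snd.comp measurable_decode)
        fun_prop)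
  refine ⟨⟨f, hf⟩, fun π p hne => ?_⟩
  set b := noisy (uniformWeights n d ρ η) p.1 p.2 with hb
  have hscore : ∀ π', ∑ j, c j * (decode (observed ρ η π p)).1 j *
      (decode (observed ρ η π p)).2 (act d π' j) =
      ∑ j, c j * p.1 (act d (π⁻¹ * π')⁻¹ j) * b j := by
    intro π'
    rw [observed, decode_encode]
    simp only [Function.comp_apply]
    rw [← Equiv.sum_comp (act d (π⁻¹ * π'))
      (fun j => c j * p.1 (act d (π⁻¹ * π')⁻¹ j) * b j)]
    refine Finset.sum_congr rfl fun j _ => ?_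
    have hinv : (act d (π⁻¹ * π'))⁻¹ (act d (π⁻¹ * π') j) = j := Equiv.symm_apply_apply _ _
    rw [hc, uniformWeights_act, act_inv (π⁻¹ * π'), hinv, act_mul, Equiv.Perm.mul_apply]
  have h := hmax (observed ρ η π p) π
  rw [hscore, hscore] at h
  simp only [inv_mul_cancel, inv_one, act_one, Equiv.Perm.one_apply] at h
  refine ⟨(π⁻¹ * f (observed ρ η π p))⁻¹, ?_, ?_⟩
  · rw [ne_eq, inv_eq_one, inv_mul_eq_one]
    exact fun h => hne h.symm
  · rw [← sub_nonneg, ← Finset.sum_sub_distrib] at h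
    refine h.trans (le_of_eq (Finset.sum_congr rfl fun j _ => ?_))
    ring

theorem IsMAP.one_sub_le_successProb {ρ η : ℝ} (hρ : ρ ∈ Set.Icc (-1 : ℝ) 1)
    (hη : η ∈ Set.Icc (-1 : ℝ) 1) {f : Estimator n d} (hf : IsMAP ρ η f) (c₁ c₂ : ℝ) {x : ℝ}
    (hx : 0 ≤ x)
    (h : baseLaw n d {p | ∃ σ : Equiv.Perm (Fin n), σ ≠ 1 ∧
        0 ≤ ∑ j, uniformWeights n d c₁ c₂ j * noisy (uniformWeights n d ρ η) p.1 p.2 j *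
          (p.1 (act d σ j) - p.1 j)} ≤ ENNReal.ofReal x) :
    1 - x ≤ successProb ρ η f := by
  obtain ⟨g, hg⟩ := exists_estimator_of_score (n := n) (d := d) ρ η c₁ c₂
  refine le_trans ?_ (hf.successProb_le g)
  have h0 : 0 ≤ successProb ρ η g := measureReal_nonneg
  rw [sub_le_iff_le_add, ← ENNReal.ofReal_le_ofReal_iff (by positivity),
    ENNReal.ofReal_add h0 hx, successProb_eq hρ hη, ENNReal.ofReal_one]
  have hN0 : (Fintype.card (Equiv.Perm (Fin n)) : ℝ≥0∞) ≠ 0 := by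
    exact_mod_cast Fintype.card_ne_zero
  have hNt : (Fintype.card (Equiv.Perm (Fin n)) : ℝ≥0∞) ≠ ⊤ := ENNReal.natCast_ne_top _
  have hterm : ∀ π : Equiv.Perm (Fin n),
      1 ≤ baseLaw n d {p | g.1 (observed ρ η π p) = π} + ENNReal.ofReal x := by
    intro π
    calc 1 = baseLaw n d Set.univ := measure_univ.symm
      _ ≤ baseLaw n d ({p | g.1 (observed ρ η π p) = π} ∪ _) :=
          measure_mono fun p _ => by
            by_cases hp : g.1 (observed ρ η π p) = π
            · exact Or.inl hp
            · exact Or.inr (hg π p hp)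
      _ ≤ _ := (measure_union_le _ _).trans (add_le_add le_rfl h)
  calc (1 : ℝ≥0∞) = (∑ _π : Equiv.Perm (Fin n), 1) /
        (Fintype.card (Equiv.Perm (Fin n)) : ℝ≥0∞) := by
        rw [Finset.sum_const, Finset.card_univ, nsmul_eq_mul, mul_one, ENNReal.div_self hN0 hNt]
    _ ≤ (∑ π : Equiv.Perm (Fin n), (baseLaw n d {p | g.1 (observed ρ η π p) = π} +
          ENNReal.ofReal x)) / (Fintype.card (Equiv.Perm (Fin n)) : ℝ≥0∞) := by
        gcongr with π
        exact hterm π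
    _ = _ := by
        rw [Finset.sum_add_distrib, ENNReal.add_div, Finset.sum_const, Finset.card_univ,
          nsmul_eq_mul, ENNReal.mul_div_right_comm, ENNReal.div_self hN0 hNt, one_mul]

end Estimator

/-! ### Union bounds and achievability -/

variable {n d : ℕ}

theorem card_support_edgeAct_ge (hn : 2 ≤ n) (σ : Equiv.Perm (Fin n)) :
    (σ.support.card : ℝ) * (2 * n - 2 - σ.support.card) ≤ 2 * (edgeAct σ).support.card := by
  have h := two_mul_card_support_edgeAct_ge σ
  have hm : σ.support.card ≤ n := (Finset.card_le_univ _).trans (by simp)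
  have h' : ((σ.support.card * (n - 2) + (n - σ.support.card) * σ.support.card : ℕ) : ℝ) ≤
      ((2 * (edgeAct σ).support.card : ℕ) : ℝ) := by exact_mod_cast h
  push_cast [Nat.cast_sub hn, Nat.cast_sub hm] at h'
  linarith

theorem card_touching_eq (hn : 1 ≤ n) (V : Finset (Fin n)) :
    2 * ((touching V).card : ℝ) = V.card * (2 * n - 1 - V.card) := by
  have h := two_mul_card_touching V
  have hm : V.card ≤ n := (Finset.card_le_univ _).trans (by simp)
  have h' : ((2 * (touching V).card : ℕ) : ℝ) =
      ((V.card * (n - 1) + (n - V.card) * V.card : ℕ) : ℝ) := by exact_mod_cast h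
  push_cast [Nat.cast_sub hn, Nat.cast_sub hm] at h'
  linarith

/-- The factor n^m counting permutations that move m nodes is absorbed by exp(-m log n), leaving a
geometric series with ratio n^(-β); the hypothesis on `β` makes this ratio at most 1/2. -/
theorem measure_exists_perm_le {Ω : Type*} [MeasurableSpace Ω] (μ : Measure Ω) (hn : 0 < n)
    {β : ℝ} (hβ : 1 ≤ β * Real.log n) (A : Equiv.Perm (Fin n) → Set Ω)
    (hA : ∀ σ, σ ≠ 1 → μ (A σ) ≤
      ENNReal.ofReal (Real.exp (-((1 + β) * Real.log n * σ.support.card)))) :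
    μ {p | ∃ σ, σ ≠ 1 ∧ p ∈ A σ} ≤ ENNReal.ofReal (2 * Real.exp (-(β * Real.log n))) := by
  classical
  have hn' : (0 : ℝ) < n := by exact_mod_cast hn
  have hq2 : Real.exp (-(β * Real.log n)) ≤ 1 / 2 := by
    calc _ ≤ Real.exp (-1) := Real.exp_le_exp.2 (by linarith)
      _ ≤ 1 / 2 := by
        rw [Real.exp_neg, one_div]
        exact inv_anti₀ (by norm_num) (by linarith [Real.add_one_le_exp 1])
  have hpow : ∀ m : ℕ, Real.exp (-((1 + β) * Real.log n * m)) =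
      (Real.exp (-(β * Real.log n)) / n) ^ m := by
    intro m
    nth_rewrite 3 [← Real.exp_log hn']
    rw [← Real.exp_sub, ← Real.exp_nat_mul]
    congr 1
    ring
  calc μ {p | ∃ σ, σ ≠ 1 ∧ p ∈ A σ}
      ≤ μ (⋃ σ ∈ Finset.univ.filter fun σ : Equiv.Perm (Fin n) => σ ≠ 1, A σ) := by
        refine measure_mono fun p => ?_
        rintro ⟨σ, hσ, hp⟩
        simp only [Set.mem_iUnion, Finset.mem_filter, Finset.mem_univ, true_and]
        exact ⟨σ, hσ, hp⟩
    _ ≤ ∑ σ : Equiv.Perm (Fin n) with σ ≠ 1, μ (A σ) := measure_biUnion_finset_le _ _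
    _ ≤ ∑ σ : Equiv.Perm (Fin n) with σ ≠ 1,
          ENNReal.ofReal ((Real.exp (-(β * Real.log n)) / n) ^ σ.support.card) := by
        refine Finset.sum_le_sum fun σ hσ => ?_
        rw [← hpow]
        exact hA σ (Finset.mem_filter.1 hσ).2
    _ = ENNReal.ofReal (∑ σ : Equiv.Perm (Fin n) with σ ≠ 1,
          (Real.exp (-(β * Real.log n)) / n) ^ σ.support.card) :=
        (ENNReal.ofReal_sum_of_nonneg fun _ _ => by positivity).symm
    _ ≤ _ := ENNReal.ofReal_le_ofReal
        (sum_perm_pow_card_support_le hn (Real.exp_pos _).le hq2)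

/-- Meant for one strong source, the other weight being 0, so constants are not optimized. For n ≥
10 at least 2mn/5 edges move, where m is the number of moved nodes; with the loss 1 - 1/2 the
exponent is at least m(y₁n + 5y₂d/2)/20, and 40 log n makes it 2m log n. -/
theorem measure_exists_score_le {ρ η c₁ c₂ : ℝ} (hρ : ρ ^ 2 ≤ 1) (hη : η ^ 2 ≤ 1)
    (hn : 10 ≤ n) {y₁ y₂ : ℝ} (hy₁ : 0 ≤ y₁) (hy₁' : y₁ ≤ 1 / 2) (hy₂ : 0 ≤ y₂)
    (hy₂' : y₂ ≤ 1 / 2)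
    (h₁ : y₁ ≤ 4 * (c₁ * ρ - c₁ ^ 2 * (1 - ρ ^ 2)))
    (h₂ : y₂ ≤ 4 * (c₂ * η - c₂ ^ 2 * (1 - η ^ 2)))
    (hy : 40 * Real.log n ≤ y₁ * n + 5 / 2 * (y₂ * d)) :
    baseLaw n d {p | ∃ σ : Equiv.Perm (Fin n), σ ≠ 1 ∧
        0 ≤ ∑ j, uniformWeights n d c₁ c₂ j * noisy (uniformWeights n d ρ η) p.1 p.2 j *
          (p.1 (act d σ j) - p.1 j)} ≤ ENNReal.ofReal (2 * Real.exp (-(1 * Real.log n))) := by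
  have hnr : (10 : ℝ) ≤ n := by exact_mod_cast hn
  have hlog : 1 ≤ Real.log n := by
    rw [Real.le_log_iff_exp_le (by linarith)]
    linarith [Real.exp_one_lt_d9]
  refine measure_exists_perm_le (n := n) (β := 1) (baseLaw n d) (by omega) (by linarith)
    (fun σ => {p | 0 ≤ ∑ j, uniformWeights n d c₁ c₂ j * noisy (uniformWeights n d ρ η) p.1 p.2 j *
          (p.1 (act d σ j) - p.1 j)}) fun σ _ => ?_
  set F : Coord n d → ℝ := fun j => 1 + 4 * (uniformWeights n d c₁ c₂ j *
    uniformWeights n d ρ η j - uniformWeights n d c₁ c₂ j ^ 2 *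
      (1 - uniformWeights n d ρ η j ^ 2)) with hF
  have hFge : ∀ j, 1 + uniformWeights n d y₁ y₂ j ≤ F j := by
    intro j
    rcases j with e | z
    · simp only [hF, uniformWeights_inl]
      linarith
    · simp only [hF, uniformWeights_inr]
      linarith
  have hy0 : ∀ j, 0 ≤ uniformWeights n d y₁ y₂ j := fun j =>
    forall_uniformWeights (p := fun x => 0 ≤ x) hy₁ hy₂ j
  have h := measure_score_nonneg_le (φ := act d σ) (r := uniformWeights n d ρ η)
    (c := uniformWeights n d c₁ c₂)
    (fun j => forall_uniformWeights (p := fun x => x ^ 2 ≤ 1) hρ hη j)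
    (uniformWeights_act _ _ _) (uniformWeights_act _ _ _)
    (fun j => by linarith [hFge j, hy0 j])
  refine h.trans (ENNReal.ofReal_le_ofReal ?_)
  calc _ ≤ ∏ j ∈ (act d σ).support, (1 + uniformWeights n d y₁ y₂ j) ^ (-(1 / 4) : ℝ) := by
        refine Finset.prod_le_prod (fun j _ => Real.rpow_nonneg ?_ _) fun j _ => ?_
        · linarith [hFge j, hy0 j]
        · exact Real.rpow_le_rpow_of_nonpos (by linarith [hy0 j]) (hFge j) (by norm_num)
    _ = ((1 + y₁) ^ (-(1 / 4) : ℝ)) ^ (edgeAct σ).support.card *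
          ((1 + y₂) ^ (-(1 / 4) : ℝ)) ^ (σ.support.card * d) :=
        prod_support_act σ y₁ y₂ fun x => (1 + x) ^ (-(1 / 4) : ℝ)
    _ ≤ Real.exp (-((1 - 1 / 2) * y₁ * ((edgeAct σ).support.card / 4))) *
          Real.exp (-((1 - 1 / 2) * y₂ * ((σ.support.card * d : ℕ) / 4))) := by
        gcongr
        · exact rpow_neg_pow_le_exp hy₁ hy₁' _
        · exact rpow_neg_pow_le_exp hy₂ hy₂' _
    _ ≤ _ := by
        rw [← Real.exp_add, Real.exp_le_exp]
        have hs := card_support_edgeAct_ge (by omega) σ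
        have hm : (σ.support.card : ℝ) ≤ n := by
          exact_mod_cast (Finset.card_le_univ _).trans (by simp)
        push_cast
        set m : ℝ := (σ.support.card : ℝ)
        have hm0 : 0 ≤ m := by positivity
        have h1 : m * (4 / 5 * n) ≤ 2 * (edgeAct σ).support.card := by
          refine le_trans ?_ hs
          gcongr
          linarith
        have h2 : y₁ * (m * (4 / 5 * n)) ≤ y₁ * (2 * (edgeAct σ).support.card) := by gcongr
        have h3 := mul_le_mul_of_nonneg_left hy hm0
        nlinarith

theorem touching_energy_ge {x y δ : ℝ} (hx : 0 ≤ x) (hy : 0 ≤ y) (hn : 1 ≤ n)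
    (hδn : 1 ≤ δ * n) (V : Finset (Fin n)) :
    V.card * ((1 - δ) / 2) * (x * n + y * d) ≤
      (touching V).card * x + (V.card * d : ℕ) * y := by
  have ht := card_touching_eq hn V
  have hm : (V.card : ℝ) ≤ n := by exact_mod_cast (Finset.card_le_univ _).trans (by simp)
  push_cast
  set m : ℝ := (V.card : ℝ)
  have hm0 : 0 ≤ m := by positivity
  have hδ0 : 0 ≤ δ := by
    by_contra h
    have : (0 : ℝ) ≤ n := by positivity
    nlinarith
  have h1 : m * ((1 - δ) * n) ≤ 2 * (touching V).card := by
    rw [ht]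
    gcongr
    linarith
  have h2 := mul_le_mul_of_nonneg_right h1 hx
  have h3 : 0 ≤ m * d * y := by positivity
  nlinarith [mul_nonneg h3 hδ0]

theorem one_add_half_le {δ ε : ℝ} (hδ : 0 < δ) (hδε : 32 * δ ≤ ε) (hε : ε ≤ 1) :
    1 + ε / 2 ≤ (1 - 8 * δ) * (1 + ε) := by
  nlinarith [mul_nonneg (sub_nonneg.2 hδε) (sub_nonneg.2 hε)]

/-- Here Λ is the energy of all touching coordinates, and moved coordinates carry at least (1 - δ)Λ.
The net exponent is then at most -(1/2 - 7δ/2)Λ, and Λ is at least about 2m(1 + ε) log n because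
touching edges number at least about mn/2. -/
theorem exponent_le_of_large {x y δ ε lam N m e s D Λ : ℝ} (hδ : 0 < δ) (hδε : 32 * δ ≤ ε)
    (hε : ε ≤ 1) (hx : 0 ≤ x) (hy : 0 ≤ y) (hlam : 0 ≤ lam) (hm0 : 0 ≤ m)
    (hm : m ≤ N) (hD : 0 ≤ D) (hδN : 2 ≤ δ * N) (hΛ : 2 * m * (1 - δ) * (1 + ε) * lam ≤ Λ)
    (hΛe : Λ = e * x + m * D * y) (he : 2 * e = m * (2 * N - 1 - m))
    (hs : m * (2 * N - 2 - m) ≤ 2 * s) :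
    (1 / 2 + 3 / 2 * δ) * Λ + (-((1 - δ) * (4 * x) * (s / 4)) +
      -((1 - δ) * (4 * y) * (m * D / 4))) ≤ -((1 + ε / 2) * lam * m) := by
  have he1 : m * (N - 1) ≤ 2 * e := by
    rw [he]
    exact mul_le_mul_of_nonneg_left (by linarith) hm0
  have hse : (1 - δ) * e ≤ s := by
    have h1 : 1 * m ≤ (δ * (N - 1)) * m := mul_le_mul_of_nonneg_right (by linarith) hm0
    have h2 := mul_le_mul_of_nonneg_left he1 hδ.le
    linarith
  have h1δ : 0 ≤ 1 - δ := by linarith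
  have hxs : (1 - δ) * Λ ≤ x * s + y * (m * D) := by
    have h1 := mul_le_mul_of_nonneg_left hse hx
    have h2 : 0 ≤ δ * (y * (m * D)) := by positivity
    rw [hΛe]
    linarith
  have hml : 0 ≤ m * lam := by positivity
  have hΛ0 : 0 ≤ Λ := by
    have : 0 ≤ 1 + ε := by linarith
    refine le_trans ?_ hΛ
    positivity
  have h3 := mul_le_mul_of_nonneg_left hxs h1δ
  have h4 := mul_le_mul_of_nonneg_left hΛ (show 0 ≤ 1 / 2 - 7 / 2 * δ by linarith)
  have h5 : 1 - 8 * δ ≤ (1 - 7 * δ) * (1 - δ) := by nlinarith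
  have h6 : 1 + ε / 2 ≤ (1 - 7 * δ) * (1 - δ) * (1 + ε) :=
    (one_add_half_le hδ hδε hε).trans (mul_le_mul_of_nonneg_right h5 (by linarith))
  have h7 := mul_le_mul_of_nonneg_left h6 hml
  have h8 : 0 ≤ δ ^ 2 * Λ := by positivity
  linarith

/-- When m ≤ δN almost no edge has both endpoints moved, so about mN edges move and the plain
Chernoff rate S/4 per moved node is already enough. -/
theorem exponent_le_of_small {x y δ ε lam N m s D : ℝ} (hδ : 0 < δ) (hδε : 32 * δ ≤ ε)
    (hε : ε ≤ 1) (hx : 0 ≤ x) (hy : 0 ≤ y) (hlam : 0 ≤ lam) (hm0 : 0 ≤ m)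
    (hD : 0 ≤ D) (hδN : 2 ≤ δ * N) (hm : m ≤ δ * N)
    (hS : 4 * (1 + ε) * lam ≤ x * N + y * D) (hs : m * (2 * N - 2 - m) ≤ 2 * s) :
    -((1 - δ) * x * (s / 4)) + -((1 - δ) * y * (m * D / 4)) ≤ -((1 + ε / 2) * lam * m) := by
  have h1δ : 0 ≤ 1 - δ := by linarith
  have h1 : m * (N * (1 - δ)) ≤ s := by
    have : m * (2 * N * (1 - δ)) ≤ m * (2 * N - 2 - m) :=
      mul_le_mul_of_nonneg_left (by linarith) hm0
    linarith
  have h2 := mul_le_mul_of_nonneg_left h1 hx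
  have h3 : 0 ≤ δ * (y * (m * D)) := by positivity
  have h4 : m * (1 - δ) * (x * N + y * D) ≤ x * s + y * (m * D) := by linarith
  have h5 := mul_le_mul_of_nonneg_left hS (show 0 ≤ m * (1 - δ) by positivity)
  have h6 := mul_le_mul_of_nonneg_left (h5.trans h4) h1δ
  have h7 : 1 - 8 * δ ≤ (1 - δ) * (1 - δ) := by nlinarith
  have h8 : 1 + ε / 2 ≤ (1 - δ) * (1 - δ) * (1 + ε) :=
    (one_add_half_le hδ hδε hε).trans (mul_le_mul_of_nonneg_right h7 (by linarith))
  have hml : 0 ≤ m * lam := by positivity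
  have h9 := mul_le_mul_of_nonneg_left h8 hml
  linarith

/-- When both correlations are weak, the probability that a relabelling is at least as likely as
the truth. -/
theorem measure_exists_llr_nonneg_le {t₁ t₂ ε δ : ℝ} (hδ : 0 < δ) (hδε : 32 * δ ≤ ε) (hε : ε ≤ 1)
    (h₁ : 8 * t₁ ^ 2 ≤ δ) (h₂ : 8 * t₂ ^ 2 ≤ δ) (hn : 2 ≤ δ * n)
    (hlog : 8 ≤ δ ^ 3 * Real.log n)
    (hS : 4 * (1 + ε) * Real.log n ≤ t₁ ^ 2 * n + t₂ ^ 2 * d) :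
    baseLaw n d {p | ∃ σ : Equiv.Perm (Fin n), σ ≠ 1 ∧
        0 ≤ llr (shift (uniformWeights n d t₁ t₂) (act d σ) p.1) p.2} ≤
      ENNReal.ofReal (2 * Real.exp (-(ε / 2 * Real.log n)) + 2 * Real.exp (-n)) := by
  classical
  have hδ1 : δ ≤ 1 / 32 := by linarith
  have hn0 : (0 : ℝ) ≤ n := by positivity
  have hn64 : (64 : ℝ) ≤ n := by nlinarith
  have hn2 : 2 ≤ n := by
    have : ((2 : ℕ) : ℝ) ≤ n := by push_cast; linarith
    exact_mod_cast this
  have hlog0 : 0 < Real.log n := Real.log_pos (by linarith)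
  set lam := Real.log n with hlam
  set x := t₁ ^ 2 with hx
  set y := t₂ ^ 2 with hy
  have hx0 : 0 ≤ x := sq_nonneg _
  have hy0 : 0 ≤ y := sq_nonneg _
  set t := uniformWeights n d t₁ t₂ with ht
  set L : Finset (Fin n) → ℝ := fun V => ∑ j ∈ touchingCoord d V, t j ^ 2 with hL
  have hLeq : ∀ V, L V = (touching V).card * x + (V.card * d : ℕ) * y := fun V =>
    sum_touchingCoord V t₁ t₂ fun z => z ^ 2
  have hLge : ∀ V, 2 * V.card * (1 - δ) * (1 + ε) * lam ≤ L V := by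
    intro V
    rw [hLeq]
    refine le_trans ?_ (touching_energy_ge hx0 hy0 (by omega) (δ := δ) (by linarith) V)
    have : (0 : ℝ) ≤ V.card * ((1 - δ) / 2) := by
      have : 0 ≤ 1 - δ := by linarith
      positivity
    nlinarith [mul_le_mul_of_nonneg_left hS this]
  have hLge' : ∀ V : Finset (Fin n), V.card * lam ≤ L V := by
    intro V
    refine le_trans ?_ (hLge V)
    have h0 : (0 : ℝ) ≤ V.card * lam := by positivity
    have h1 : 1 ≤ 2 * (1 - δ) * (1 + ε) := by nlinarith
    nlinarith
  -- The atypical events are indexed by the set of moved nodes rather than by the permutation, so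
  -- the union has 2^n members instead of n!.
  set B : Finset (Fin n) → Set ((Coord n d → ℝ) × (Coord n d → ℝ)) := fun V =>
    {p | (1 + δ) * ∑ i ∈ touchingCoord d V, t i ^ 2 <
      ∑ i ∈ touchingCoord d V, t i ^ 2 * p.1 i ^ 2} ∪
    {p | ∑ i ∈ touchingCoord d V, t i ^ 2 * p.1 i ^ 2 ≤
      (1 + δ) * ∑ i ∈ touchingCoord d V, t i ^ 2 ∧
      ∑ i ∈ touchingCoord d V, t i * p.1 i * p.2 i <
        -(δ * ∑ i ∈ touchingCoord d V, t i ^ 2)} with hB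
  set A : Equiv.Perm (Fin n) → Set ((Coord n d → ℝ) × (Coord n d → ℝ)) := fun σ =>
    {p | 0 ≤ llr (shift t (act d σ) p.1) p.2 ∧ (δ * n < σ.support.card → p ∉ B σ.support)}
    with hA
  have hAbound : ∀ σ : Equiv.Perm (Fin n), σ ≠ 1 → baseLaw n d (A σ) ≤
      ENNReal.ofReal (Real.exp (-((1 + ε / 2) * lam * σ.support.card))) := by
    intro σ _
    have hm : (σ.support.card : ℝ) ≤ n := by
      exact_mod_cast (Finset.card_le_univ _).trans (by simp)
    have hs := card_support_edgeAct_ge hn2 σ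
    have hm0 : (0 : ℝ) ≤ σ.support.card := by positivity
    by_cases hbig : δ * n < σ.support.card
    · have h := measure_llr_nonneg_le t (touchingCoord d σ.support) (φ := act d σ)
        (uniformWeights_act _ _ _) (support_act_subset σ) δ
      refine (measure_mono fun p hp => ?_).trans (h.trans (ENNReal.ofReal_le_ofReal ?_))
      · obtain ⟨hp1, hp2⟩ := hp
        have hp3 := hp2 hbig
        simp only [hB, Set.mem_union, Set.mem_ofPred_eq, not_or, not_lt, not_and] at hp3
        exact ⟨hp1, hp3.1, hp3.2 hp3.1⟩
      · rw [ht, prod_support_act σ t₁ t₂ fun z => (1 + 4 * z ^ 2) ^ (-(1 / 4) : ℝ)]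
        calc _ ≤ Real.exp ((1 / 2 + 3 / 2 * δ) * L σ.support) *
              (Real.exp (-((1 - δ) * (4 * x) * ((edgeAct σ).support.card / 4))) *
                Real.exp (-((1 - δ) * (4 * y) * ((σ.support.card * d : ℕ) / 4)))) := by
              gcongr
              · exact rpow_neg_pow_le_exp (by positivity) (by linarith) _
              · exact rpow_neg_pow_le_exp (by positivity) (by linarith) _
          _ ≤ _ := by
              rw [← Real.exp_add, ← Real.exp_add, Real.exp_le_exp]
              have hL1 := hLeq σ.support
              have ht1 := card_touching_eq (by omega) σ.support
              push_cast at hL1 ⊢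
              exact exponent_le_of_large hδ hδε hε hx0 hy0 hlog0.le hm0 hm
                (Nat.cast_nonneg d) (by linarith) (hLge _) hL1 ht1 hs
    · have h := measure_llr_nonneg_le_simple t (act d σ)
      refine (measure_mono fun p hp => hp.1).trans (h.trans (ENNReal.ofReal_le_ofReal ?_))
      rw [ht, prod_support_act σ t₁ t₂ fun z => (1 + z ^ 2) ^ (-(1 / 4) : ℝ)]
      calc _ ≤ Real.exp (-((1 - δ) * x * ((edgeAct σ).support.card / 4))) *
                Real.exp (-((1 - δ) * y * ((σ.support.card * d : ℕ) / 4))) := by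
              gcongr
              · exact rpow_neg_pow_le_exp hx0 (by linarith) _
              · exact rpow_neg_pow_le_exp hy0 (by linarith) _
        _ ≤ _ := by
            rw [← Real.exp_add, Real.exp_le_exp]
            rw [not_lt] at hbig
            push_cast
            exact exponent_le_of_small hδ hδε hε hx0 hy0 hlog0.le hm0
                (Nat.cast_nonneg d) hn hbig hS hs
  have hBbound : ∀ V : Finset (Fin n), δ * n < V.card → baseLaw n d (B V) ≤
      ENNReal.ofReal (2 * Real.exp (-(2 * n))) := by
    intro V hV
    -- A large support carries energy at least δ n log n, so δ³ log n ≥ 8 makes the deviation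
    -- exponent at least 2n.
    have hLn : 2 * (n : ℝ) ≤ δ ^ 2 / 4 * L V := by
      have h1 : δ * n * lam ≤ L V := le_trans (by gcongr) (hLge' V)
      have h2 : δ ^ 2 / 4 * (δ * n * lam) ≤ δ ^ 2 / 4 * L V := by gcongr
      nlinarith
    have hL0 : 0 ≤ L V := Finset.sum_nonneg fun _ _ => sq_nonneg _
    have hb1 := measure_energy_gt_le t (touchingCoord d V) δ (fun j => by
      have := forall_uniformWeights (n := n) (d := d) (p := fun z => 8 * z ^ 2 ≤ δ) h₁ h₂ j
      simp only [← ht] at this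
      linarith)
    have hb2 := measure_noise_lt_le t (touchingCoord d V) δ hδ.le (by linarith)
    have hb1' : Real.exp (-((1 + δ) * ∑ i ∈ touchingCoord d V, t i ^ 2)) *
        ∏ i ∈ touchingCoord d V, (1 - 2 * t i ^ 2) ^ (-(1 / 2) : ℝ) ≤ Real.exp (-(2 * n)) := by
      rw [ht, prod_touchingCoord V t₁ t₂ fun z => (1 - 2 * z ^ 2) ^ (-(1 / 2) : ℝ)]
      calc _ ≤ Real.exp (-((1 + δ) * L V)) * (Real.exp ((1 + δ / 2) * ((touching V).card * x)) *
            Real.exp ((1 + δ / 2) * ((V.card * d : ℕ) * y))) := by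
            have : 0 ≤ 1 - 2 * t₂ ^ 2 := by linarith
            gcongr
            · exact rpow_neg_half_pow_le_exp hx0 (by linarith) (by linarith) _
            · exact rpow_neg_half_pow_le_exp hy0 (by linarith) (by linarith) _
        _ ≤ _ := by
            rw [← Real.exp_add, ← Real.exp_add, Real.exp_le_exp]
            have h1 := hLeq V
            have h2 : δ ^ 2 / 4 * L V ≤ δ / 2 * L V :=
              mul_le_mul_of_nonneg_right (by nlinarith) hL0
            have h3 : (1 + δ / 2) * L V = (1 + δ / 2) * ((touching V).card * x) +
              (1 + δ / 2) * ((V.card * d : ℕ) * y) := by rw [h1]; ring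
            linarith
    calc baseLaw n d (B V) ≤ ENNReal.ofReal (Real.exp (-(2 * n))) +
          ENNReal.ofReal (Real.exp (-(2 * n))) := by
          refine (measure_union_le _ _).trans (add_le_add ?_ ?_)
          · exact hb1.trans (ENNReal.ofReal_le_ofReal hb1')
          · exact hb2.trans (ENNReal.ofReal_le_ofReal (Real.exp_le_exp.2 (by linarith)))
      _ = _ := by
          rw [← ENNReal.ofReal_add (Real.exp_pos _).le (Real.exp_pos _).le, ← two_mul]
  calc _ ≤ baseLaw n d ({p | ∃ σ : Equiv.Perm (Fin n), σ ≠ 1 ∧ p ∈ A σ} ∪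
        ⋃ V ∈ (Finset.univ : Finset (Finset (Fin n))).filter fun V => δ * n < V.card, B V) := by
        refine measure_mono fun p => ?_
        rintro ⟨σ, hσ, hp⟩
        by_cases hb : δ * n < σ.support.card ∧ p ∈ B σ.support
        · refine Or.inr ?_
          simp only [Set.mem_iUnion, Finset.mem_filter, Finset.mem_univ, true_and]
          exact ⟨σ.support, hb.1, hb.2⟩
        · exact Or.inl ⟨σ, hσ, hp, fun h1 h2 => hb ⟨h1, h2⟩⟩
    _ ≤ ENNReal.ofReal (2 * Real.exp (-(ε / 2 * lam))) + ENNReal.ofReal (2 * Real.exp (-n)) := by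
        refine (measure_union_le _ _).trans (add_le_add ?_ ?_)
        · exact measure_exists_perm_le _ (by omega) (by
            have h1 : δ ^ 3 ≤ δ := by
              calc δ ^ 3 = δ * (δ * δ) := by ring
                _ ≤ δ * 1 := by gcongr; nlinarith
                _ = δ := mul_one _
            nlinarith) A hAbound
        · refine (measure_biUnion_finset_le _ _).trans ?_
          calc _ ≤ ∑ V ∈ (Finset.univ : Finset (Finset (Fin n))).filter fun V => δ * n < V.card,
                ENNReal.ofReal (2 * Real.exp (-(2 * n))) :=
                Finset.sum_le_sum fun V hV => hBbound V (Finset.mem_filter.1 hV).2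
            _ ≤ ∑ V : Finset (Fin n), ENNReal.ofReal (2 * Real.exp (-(2 * n))) :=
                Finset.sum_le_sum_of_subset (Finset.filter_subset _ _)
            _ = ENNReal.ofReal (2 ^ n * (2 * Real.exp (-(2 * n)))) := by
                rw [Finset.sum_const, Finset.card_univ, Fintype.card_finset, Fintype.card_fin,
                  nsmul_eq_mul, ENNReal.ofReal_mul (by positivity)]
                norm_num
            _ ≤ _ := by
                refine ENNReal.ofReal_le_ofReal ?_
                have h2 : (2 : ℝ) ^ n ≤ Real.exp n := by
                  have h3 : (2 : ℝ) ≤ Real.exp 1 := by linarith [Real.add_one_le_exp 1]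
                  calc (2 : ℝ) ^ n ≤ Real.exp 1 ^ n := by gcongr
                    _ = Real.exp n := by rw [← Real.exp_nat_mul, mul_one]
                calc _ ≤ Real.exp n * (2 * Real.exp (-(2 * n))) := by gcongr
                  _ = 2 * Real.exp (-n) := by
                    rw [mul_left_comm, ← Real.exp_add]
                    congr 2
                    ring
    _ = _ := (ENNReal.ofReal_add (by positivity) (by positivity)).symm

/-- The maximum over c is r²/(1 - r²), attained at c = r/(2(1 - r²)). When r² = 1 the quadratic
penalty vanishes and the expression is unbounded in c. -/
theorem exists_weight_or_lt {r : ℝ} (hr : r ^ 2 ≤ 1) (y : ℝ) :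
    (∃ c, y ≤ 4 * (c * r - c ^ 2 * (1 - r ^ 2))) ∨ (r ^ 2 < 1 ∧ r ^ 2 / (1 - r ^ 2) < y) := by
  rcases hr.eq_or_lt with h | h
  · refine Or.inl ⟨r * (y / 4), le_of_eq ?_⟩
    rw [h]
    linear_combination (-y) * h
  · by_cases hy : r ^ 2 / (1 - r ^ 2) < y
    · exact Or.inr ⟨h, hy⟩
    · refine Or.inl ⟨r / (2 * (1 - r ^ 2)), (not_lt.1 hy).trans (le_of_eq ?_)⟩
      have : 1 - r ^ 2 ≠ 0 := by linarith
      field_simp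
      ring

theorem signal_eq_coe {r : ℝ} (hr : r ^ 2 < 1) (m : ℕ) :
    signal r m = ((r ^ 2 / (1 - r ^ 2) * m : ℝ) : EReal) := by
  rw [signal, if_neg hr.ne]
  congr 1
  ring

theorem sq_le_one_of_mem {r : ℝ} (hr : r ∈ Set.Icc (-1 : ℝ) 1) : r ^ 2 ≤ 1 := by
  nlinarith [hr.1, hr.2]

theorem IsMAP.one_sub_error_le_successProb {n d : ℕ} {ρ η ε δ : ℝ}
    (hρ : ρ ∈ Set.Icc (-1 : ℝ) 1) (hη : η ∈ Set.Icc (-1 : ℝ) 1) {f : Estimator n d}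
    (hf : IsMAP ρ η f) (hδ : 0 < δ) (hδε : 32 * δ ≤ ε) (hε : ε ≤ 1)
    (hn10 : 10 ≤ n) (hn : 2 ≤ δ * n) (hlog : 8 ≤ δ ^ 3 * Real.log n)
    (hnlog : 320 * Real.log n ≤ δ * n) (hdlog : 128 * Real.log n ≤ δ * d)
    (hS : ((4 * (1 + ε) * Real.log n : ℝ) : EReal) ≤ signal ρ n + signal η d) :
    1 - (2 * Real.exp (-(1 * Real.log n)) +
      (2 * Real.exp (-(ε / 2 * Real.log n)) + 2 * Real.exp (-n))) ≤ successProb ρ η f := by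
  have hnr : (10 : ℝ) ≤ n := by exact_mod_cast hn10
  have hlog0 : 0 < Real.log n := Real.log_pos (by linarith)
  have hδ1 : δ ≤ 1 / 32 := by linarith
  have hd0 : (0 : ℝ) < d := by
    by_contra h
    nlinarith [(Nat.cast_nonneg d : (0 : ℝ) ≤ d)]
  have hρ1 := sq_le_one_of_mem hρ
  have hη1 := sq_le_one_of_mem hη
  have hy₁ : 40 * Real.log n / n ≤ δ / 8 := by
    rw [div_le_iff₀ (by linarith)]
    linarith
  have hy₂ : 16 * Real.log n / d ≤ δ / 8 := by
    rw [div_le_iff₀ hd0]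
    linarith
  -- The thresholds 40 log n/n and 16 log n/d are those at which one source alone meets the crude
  -- union bound. Below both, each squared amplitude is at most δ/8, as the sharp estimate requires;
  -- for the features this uses d = ω(log n).
  rcases exists_weight_or_lt hρ1 (40 * Real.log n / n) with ⟨c, hc⟩ | ⟨hρlt, hx⟩
  · have h := measure_exists_score_le (n := n) (d := d) (c₁ := c) (c₂ := 0) hρ1 hη1 hn10
      (by positivity) (by linarith) le_rfl (by norm_num) hc (by simp)
      (le_of_eq (by field_simp; ring))
    have h2 := hf.one_sub_le_successProb hρ hη c 0 (by positivity) h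
    refine le_trans ?_ h2
    have : 0 ≤ 2 * Real.exp (-(ε / 2 * Real.log n)) + 2 * Real.exp (-n) := by positivity
    linarith
  rcases exists_weight_or_lt hη1 (16 * Real.log n / d) with ⟨c, hc⟩ | ⟨hηlt, hy⟩
  · have h := measure_exists_score_le (n := n) (d := d) (c₁ := 0) (c₂ := c) hρ1 hη1 hn10
      le_rfl (by norm_num) (by positivity) (by linarith) (by simp) hc
      (le_of_eq (by field_simp; ring))
    have h2 := hf.one_sub_le_successProb hρ hη 0 c (by positivity) h
    refine le_trans ?_ h2
    have : 0 ≤ 2 * Real.exp (-(ε / 2 * Real.log n)) + 2 * Real.exp (-n) := by positivity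
    linarith
  · have ht₁ : (ρ / √(1 - ρ ^ 2)) ^ 2 = ρ ^ 2 / (1 - ρ ^ 2) := by
      rw [div_pow, Real.sq_sqrt (by linarith)]
    have ht₂ : (η / √(1 - η ^ 2)) ^ 2 = η ^ 2 / (1 - η ^ 2) := by
      rw [div_pow, Real.sq_sqrt (by linarith)]
    rw [signal_eq_coe hρlt, signal_eq_coe hηlt, ← EReal.coe_add, EReal.coe_le_coe_iff] at hS
    have h := measure_exists_llr_nonneg_le (n := n) (d := d) (t₁ := ρ / √(1 - ρ ^ 2))
      (t₂ := η / √(1 - η ^ 2)) hδ hδε hε (by rw [ht₁]; linarith) (by rw [ht₂]; linarith) hn hlog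
      (by rw [ht₁, ht₂]; exact hS)
    have hr1 : ∀ j : Coord n d, uniformWeights n d ρ η j ^ 2 < 1 := fun j =>
      forall_uniformWeights (p := fun z => z ^ 2 < 1) hρlt hηlt j
    have h2 := hf.one_sub_le_successProb hρ hη (ρ / (1 - ρ ^ 2)) (η / (1 - η ^ 2))
      (by positivity) (le_trans (measure_mono fun p => ?_) h)
    · refine le_trans ?_ h2
      have : 0 ≤ 2 * Real.exp (-(1 * Real.log n)) := by positivity
      linarith
    · rintro ⟨σ, hσ, hp⟩
      refine ⟨σ, hσ, ?_⟩
      rw [← amp_uniformWeights, ← sum_score_sub_eq_llr hr1 (uniformWeights_act _ _ _)]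
      refine hp.trans (le_of_eq (Finset.sum_congr rfl fun j _ => ?_))
      rcases j with e | z <;> rfl

theorem tendsto_successProb_of_isMAP (d : ℕ → ℕ) (ρ η : ℕ → ℝ)
    (hρ : ∀ n, ρ n ∈ Set.Icc (-1 : ℝ) 1) (hη : ∀ n, η n ∈ Set.Icc (-1 : ℝ) 1)
    (hd : (fun n : ℕ => Real.log n) =o[atTop] (fun n : ℕ => (d n : ℝ)))
    (hS : ∃ ε : ℝ, 0 < ε ∧ ∀ᶠ n : ℕ in atTop,
      ((4 * (1 + ε) * Real.log n : ℝ) : EReal) ≤ signal (ρ n) n + signal (η n) (d n))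
    (f : (n : ℕ) → Estimator n (d n)) (hf : ∀ n, IsMAP (ρ n) (η n) (f n)) :
    Tendsto (fun n => successProb (ρ n) (η n) (f n)) atTop (𝓝 1) := by
  obtain ⟨ε₀, hε₀, hS⟩ := hS
  set ε := min ε₀ 1 with hε
  have hεpos : 0 < ε := lt_min hε₀ one_pos
  set δ := ε / 32 with hδ
  have hδpos : 0 < δ := by positivity
  have hlogtop : Tendsto (fun n : ℕ => Real.log n) atTop atTop :=
    Real.tendsto_log_atTop.comp tendsto_natCast_atTop_atTop
  have hntop : Tendsto (fun n : ℕ => (n : ℝ)) atTop atTop := tendsto_natCast_atTop_atTop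
  have hexp : ∀ {c : ℝ}, 0 < c → ∀ {g : ℕ → ℝ}, Tendsto g atTop atTop →
      Tendsto (fun n => 2 * Real.exp (-(c * g n))) atTop (𝓝 0) := by
    intro c hc g hg
    have := (Real.tendsto_exp_neg_atTop_nhds_zero.comp (hg.const_mul_atTop hc)).const_mul 2
    simpa using this
  have hu : Tendsto (fun n : ℕ => 1 - (2 * Real.exp (-(1 * Real.log n)) +
      (2 * Real.exp (-(ε / 2 * Real.log n)) + 2 * Real.exp (-n)))) atTop (𝓝 1) := by
    have h1 := hexp one_pos hlogtop
    have h2 := hexp (half_pos hεpos) hlogtop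
    have h3 := hexp one_pos hntop
    simp only [one_mul] at h3
    simpa using (h1.add (h2.add h3)).const_sub 1
  have hlogn : ∀ᶠ n : ℕ in atTop, 320 * Real.log n ≤ δ * n := by
    have h := (isLittleO_iff.1 Real.isLittleO_log_id_atTop) (show 0 < δ / 320 by positivity)
    filter_upwards [hntop.eventually h, eventually_ge_atTop 1] with n hn hn1
    have hl : 0 ≤ Real.log n := Real.log_nonneg (by exact_mod_cast hn1)
    simp only [id, Real.norm_of_nonneg hl, Real.norm_of_nonneg (Nat.cast_nonneg n : (0 : ℝ) ≤ n)]
      at hn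
    linarith
  have hlogd : ∀ᶠ n : ℕ in atTop, 128 * Real.log n ≤ δ * d n := by
    have h := (isLittleO_iff.1 hd) (show 0 < δ / 128 by positivity)
    filter_upwards [h, eventually_ge_atTop 1] with n hn hn1
    have hl : 0 ≤ Real.log n := Real.log_nonneg (by exact_mod_cast hn1)
    simp only [Real.norm_of_nonneg hl, Real.norm_of_nonneg (Nat.cast_nonneg _ : (0 : ℝ) ≤ d n)]
      at hn
    linarith
  refine tendsto_of_tendsto_of_tendsto_of_le_of_le' hu tendsto_const_nhds ?_
    (Eventually.of_forall fun n => measureReal_le_one)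
  filter_upwards [hS, hlogn, hlogd, eventually_ge_atTop 10,
    hntop.eventually_ge_atTop (2 / δ), hlogtop.eventually_ge_atTop (8 / δ ^ 3)]
    with n hn h1 h2 h3 h4 h5
  rw [div_le_iff₀' (by positivity)] at h4 h5
  refine (hf n).one_sub_error_le_successProb (hρ n) (hη n) hδpos (by rw [hδ]; linarith)
    (min_le_right _ _) h3 h4 h5 h1 h2 (le_trans ?_ hn)
  rw [EReal.coe_le_coe_iff]
  have hl : 0 ≤ Real.log n := Real.log_nonneg (by exact_mod_cast (by omega : 1 ≤ n))
  have : ε ≤ ε₀ := min_le_left _ _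
  gcongr

/-! ### Converse: competing likelihoods limit every estimator -/

/-- If the likelihoods of the truth relabelled by the elements of `s` add up to at least `K` times
the likelihood of the truth, then no estimator can succeed with probability more than `1 / K`. -/
theorem ofReal_successProb_le {n d : ℕ} {ρ η : ℝ} (hρ : ρ ∈ Set.Icc (-1 : ℝ) 1)
    (hη : η ∈ Set.Icc (-1 : ℝ) 1) (hρ1 : ρ ^ 2 < 1) (hη1 : η ^ 2 < 1) (f : Estimator n d)
    (s : Finset (Equiv.Perm (Fin n))) {K : ℝ≥0∞} (hK : K ≠ 0) (hK' : K ≠ ⊤) :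
    ENNReal.ofReal (successProb ρ η f) ≤ K⁻¹ +
      baseLaw n d {p | ∑ σ ∈ s, ENNReal.ofReal (Real.exp
        (llr (shift (amp (uniformWeights n d ρ η)) (act d σ) p.1) p.2)) < K} := by
  classical
  set r := uniformWeights n d ρ η with hr
  have hr1 : ∀ j : Coord n d, r j ^ 2 < 1 := fun j =>
    forall_uniformWeights (p := fun z => z ^ 2 < 1) hρ1 hη1 j
  set R : (Coord n d → ℝ) × (Coord n d → ℝ) → ℝ≥0∞ := fun p => ∑ σ ∈ s, ENNReal.ofReal (Real.exp
        (llr (shift (amp r) (act d σ) p.1) p.2)) with hR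
  have hRσ : ∀ σ, Measurable fun p : (Coord n d → ℝ) × (Coord n d → ℝ) =>
      ENNReal.ofReal (Real.exp (llr (shift (amp r) (act d σ) p.1) p.2)) := fun σ =>
    (measurable_llr_shift _ _).exp.ennreal_ofReal
  have hRm : Measurable R := Finset.measurable_fun_sum _ fun σ _ => hRσ σ
  have hobs : ∀ π σ : Equiv.Perm (Fin n),
      MeasurableSet {p | f.1 (observed (d := d) ρ η π p) = σ} := fun π σ =>
    (f.2.comp (measurable_observed ρ η π)) (measurableSet_singleton σ)
  -- Change of measure: weighting by the likelihood ratio of σ turns the truth π into πσ⁻¹, for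
  -- which the answer π is an error unless σ = 1.
  have hchange : ∀ π : Equiv.Perm (Fin n),
      ∫⁻ p in {p | f.1 (observed (d := d) ρ η π p) = π}, R p ∂baseLaw n d =
        ∑ σ ∈ s, baseLaw n d {p | f.1 (observed (d := d) ρ η (π * σ⁻¹) p) = π} := by
    intro π
    rw [lintegral_finsetSum _ fun σ _ => hRσ σ]
    refine Finset.sum_congr rfl fun σ _ => ?_
    set U : Set ((Coord n d → ℝ) × (Coord n d → ℝ)) :=
      {x | f.1 (encode (x.1, x.2 ∘ act d π⁻¹)) = π} with hU
    have hUm : MeasurableSet U := by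
      refine (f.2.comp (measurable_encode.comp (measurable_fst.prodMk ?_)))
        (measurableSet_singleton π)
      exact measurable_pi_lambda _ fun i =>
        (measurable_pi_apply (act d π⁻¹ i)).comp measurable_snd
    have h := lintegral_noisy_comp_perm hr1 (act d σ) (uniformWeights_act ρ η σ)
      (H := U.indicator fun _ => 1) (measurable_const.indicator hUm)
    rw [← lintegral_indicator (hobs π π)]
    calc _ = ∫⁻ p, U.indicator (fun _ => 1) (p.1, noisy r p.1 p.2) *
          ENNReal.ofReal (Real.exp (llr (shift (amp r) (act d σ) p.1) p.2)) ∂baseLaw n d := by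
          refine lintegral_congr fun p => ?_
          by_cases hp : p ∈ {p | f.1 (observed (d := d) ρ η π p) = π}
          · have hp' : (p.1, noisy r p.1 p.2) ∈ U := hp
            rw [Set.indicator_of_mem hp, Set.indicator_of_mem hp', one_mul]
          · have hp' : (p.1, noisy r p.1 p.2) ∉ U := hp
            rw [Set.indicator_of_notMem hp, Set.indicator_of_notMem hp', zero_mul]
      _ = ∫⁻ p, U.indicator (fun _ => 1) (p.1, noisy r p.1 p.2 ∘ act d σ) ∂baseLaw n d := h.symm
      _ = _ := by
          rw [← lintegral_indicator_one (hobs _ _)]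
          refine lintegral_congr fun p => ?_
          have he : observed (d := d) ρ η (π * σ⁻¹) p =
              encode (p.1, (noisy r p.1 p.2 ∘ act d σ) ∘ act d π⁻¹) := by
            rw [observed, mul_inv_rev, inv_inv, act_mul, Equiv.Perm.coe_mul]
            rfl
          simp only [Set.indicator_apply, hU, Set.mem_ofPred_eq, he, Pi.one_apply]
  have hterm : ∀ π : Equiv.Perm (Fin n),
      baseLaw n d {p | f.1 (observed (d := d) ρ η π p) = π} ≤
        K⁻¹ * ∑ σ ∈ s, baseLaw n d {p | f.1 (observed (d := d) ρ η (π * σ⁻¹) p) = π} +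
          baseLaw n d {p | R p < K} := by
    intro π
    rw [← hchange]
    calc _ ≤ baseLaw n d (({p | f.1 (observed (d := d) ρ η π p) = π} ∩ {p | K ≤ R p}) ∪
          {p | R p < K}) := by
          refine measure_mono fun p hp => ?_
          rcases le_or_gt K (R p) with h | h
          · exact Or.inl ⟨hp, h⟩
          · exact Or.inr h
      _ ≤ _ := (measure_union_le _ _).trans (add_le_add ?_ le_rfl)
    rw [← ENNReal.div_eq_inv_mul, ENNReal.le_div_iff_mul_le (Or.inl hK) (Or.inl hK'), mul_comm,
      Set.inter_comm]
    calc _ = K * (baseLaw n d).restrict {p | f.1 (observed (d := d) ρ η π p) = π}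
          {p | K ≤ R p} := by rw [Measure.restrict_apply (measurableSet_le measurable_const hRm)]
      _ ≤ _ := mul_meas_ge_le_lintegral hRm K
  have hN0 : (Fintype.card (Equiv.Perm (Fin n)) : ℝ≥0∞) ≠ 0 := by
    exact_mod_cast Fintype.card_ne_zero
  have hNt : (Fintype.card (Equiv.Perm (Fin n)) : ℝ≥0∞) ≠ ⊤ := ENNReal.natCast_ne_top _
  -- After substituting πσ for the guess, the events for different σ under one truth are disjoint,
  -- so each truth contributes at most 1.
  have hdouble : ∑ π : Equiv.Perm (Fin n), ∑ σ ∈ s,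
      baseLaw n d {p | f.1 (observed (d := d) ρ η (π * σ⁻¹) p) = π} ≤
        (Fintype.card (Equiv.Perm (Fin n)) : ℝ≥0∞) := by
    rw [Finset.sum_comm]
    calc _ = ∑ σ ∈ s, ∑ π : Equiv.Perm (Fin n),
          baseLaw n d {p | f.1 (observed (d := d) ρ η π p) = π * σ} := by
          refine Finset.sum_congr rfl fun σ _ => ?_
          rw [← Equiv.sum_comp (Equiv.mulRight σ)]
          simp
      _ = ∑ π : Equiv.Perm (Fin n), ∑ σ ∈ s,
          baseLaw n d {p | f.1 (observed (d := d) ρ η π p) = π * σ} := Finset.sum_comm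
      _ ≤ ∑ _π : Equiv.Perm (Fin n), 1 := by
          refine Finset.sum_le_sum fun π _ => ?_
          rw [← measure_biUnion_finset _ fun σ _ => hobs π (π * σ)]
          · exact prob_le_one
          · intro σ _ τ _ hστ
            refine Set.disjoint_left.2 fun p hp hp' => hστ ?_
            exact mul_left_cancel (hp.symm.trans hp')
      _ = _ := by simp
  rw [successProb_eq hρ hη]
  calc _ ≤ (∑ π : Equiv.Perm (Fin n), (K⁻¹ * ∑ σ ∈ s,
        baseLaw n d {p | f.1 (observed (d := d) ρ η (π * σ⁻¹) p) = π} +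
          baseLaw n d {p | R p < K})) / (Fintype.card (Equiv.Perm (Fin n)) : ℝ≥0∞) := by
        gcongr with π
        exact hterm π
    _ = K⁻¹ * ((∑ π : Equiv.Perm (Fin n), ∑ σ ∈ s,
        baseLaw n d {p | f.1 (observed (d := d) ρ η (π * σ⁻¹) p) = π}) /
          (Fintype.card (Equiv.Perm (Fin n)) : ℝ≥0∞)) + baseLaw n d {p | R p < K} := by
        rw [Finset.sum_add_distrib, ENNReal.add_div, Finset.sum_const, Finset.card_univ,
          nsmul_eq_mul, ENNReal.mul_div_right_comm (b := baseLaw n d _), ENNReal.div_self hN0 hNt,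
          one_mul, ← Finset.mul_sum,
          mul_div_assoc]
    _ ≤ _ := by
        gcongr
        refine (mul_le_mul_right (ENNReal.div_le_div_right hdouble _) _).trans ?_
        rw [ENNReal.div_self hN0 hNt, mul_one]

/-! ### Chebyshev's inequality for sums of bumps -/

theorem integral_le_of_lintegral_le {Ω : Type*} [MeasurableSpace Ω] {μ : Measure Ω} {f : Ω → ℝ}
    (hf : Measurable f) (h0 : ∀ x, 0 ≤ f x) {B : ℝ} (hB : 0 ≤ B)
    (h : ∫⁻ x, ENNReal.ofReal (f x) ∂μ ≤ ENNReal.ofReal B) : ∫ x, f x ∂μ ≤ B := by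
  rw [integral_eq_lintegral_of_nonneg_ae (Eventually.of_forall h0) hf.aestronglyMeasurable]
  exact ENNReal.toReal_le_of_le_ofReal hB h

theorem variance_bound_div {M : ℝ} (hM : M ≠ 0) (k b e₁ e₂ : ℝ) :
    (6 * k * M ^ 2 + e₁ * M + e₂ * b) / (M / 2) ^ 2 =
      24 * k + 4 * e₁ / M + 4 * e₂ / M ^ 2 * b := by
  field_simp
  ring

/-- Chebyshev's inequality for a sum of bumps of Gaussian log likelihood ratios most of which are
nearly uncorrelated. -/
theorem measure_sum_bump_lt_le {ι κ : Type*} [Fintype ι] [DecidableEq κ] (T : Finset κ)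
    (u : κ → ι → ℝ) (near : κ → κ → Prop) [DecidableRel near] {V k M₀ : ℝ}
    (hV : ∀ p ∈ T, ∑ i, u p i ^ 2 ≤ V) (hk0 : 0 ≤ k) (hk : k ≤ 1 / 2)
    (hfar : ∀ p ∈ T, ∀ q ∈ T, p ≠ q → ¬ near p q → |∑ i, u p i * u q i| ≤ k) (hM₀ : 0 < M₀)
    (hM : M₀ ≤ T.card * ((1 + V) ^ (-(1 / 2) : ℝ) * Real.exp (-V / 8))) :
    stdNormalPi ι {g | ∑ p ∈ T, bump (llr (u p) g) < M₀ / 2} ≤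
      ENNReal.ofReal (24 * k + 4 * Real.exp (1 / 8) / M₀ + 4 * Real.exp (1 / 4) / M₀ ^ 2 *
        ∑ p ∈ T, ∑ q ∈ T with near p q ∧ p ≠ q, Real.exp (-(∑ i, u p i ^ 2 + ∑ i, u q i ^ 2 +
          ∑ i, (u p i - u q i) ^ 2) / 18)) := by
  set P := stdNormalPi ι
  set v : κ → ℝ := fun p => ∑ i, u p i ^ 2 with hv
  have hv0 : ∀ p, 0 ≤ v p := fun p => Finset.sum_nonneg fun _ _ => sq_nonneg _
  set W : κ → (ι → ℝ) → ℝ := fun p g => bump (llr (u p) g) with hW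
  have hWm : ∀ p, Measurable (W p) := fun p => by unfold W; fun_prop
  have hW0 : ∀ p g, 0 ≤ W p g := fun p g => (bump_pos _).le
  have hWle : ∀ p g, W p g ≤ Real.exp (1 / 8) := fun p g => bump_le _
  set m : κ → ℝ := fun p => (1 + v p) ^ (-(1 / 2) : ℝ) * Real.exp (-v p / 8) with hm
  have hm0 : ∀ p, 0 < m p := fun p => by
    have := hv0 p
    unfold m
    positivity
  have hWint : ∀ p, Integrable (W p) P := fun p =>
    Integrable.of_bound (hWm p).aestronglyMeasurable (Real.exp (1 / 8))
      (Eventually.of_forall fun g => by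
        rw [Real.norm_of_nonneg (hW0 p g)]
        exact hWle p g)
  have hWWint : ∀ p q, Integrable (fun g => W p g * W q g) P := fun p q =>
    Integrable.of_bound ((hWm p).mul (hWm q)).aestronglyMeasurable
      (Real.exp (1 / 8) * Real.exp (1 / 8)) (Eventually.of_forall fun g => by
        rw [Real.norm_of_nonneg (mul_nonneg (hW0 p g) (hW0 q g))]
        exact mul_le_mul (hWle p g) (hWle q g) (hW0 q g) (Real.exp_pos _).le)
  have hmean : ∀ p, ∫ g, W p g ∂P = m p := by
    intro p
    rw [integral_eq_lintegral_of_nonneg_ae (Eventually.of_forall (hW0 p))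
      (hWm p).aestronglyMeasurable, lintegral_bump_llr, ENNReal.toReal_ofReal (hm0 p).le]
  set b : κ → κ → ℝ := fun p q => Real.exp (-(v p + v q + ∑ i, (u p i - u q i) ^ 2) / 18) with hb
  set Mn := ∑ p ∈ T, m p with hMn
  have hM0M : M₀ ≤ Mn := by
    refine hM.trans ?_
    rw [← nsmul_eq_mul]
    refine Finset.card_nsmul_le_sum _ _ _ fun p hp => ?_
    have h1 := hv0 p
    have h2 := hV p hp
    have h3 : (1 + V) ^ (-(1 / 2) : ℝ) ≤ (1 + v p) ^ (-(1 / 2) : ℝ) :=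
      Real.rpow_le_rpow_of_nonpos (by linarith) (by linarith) (by norm_num)
    have h4 : Real.exp (-V / 8) ≤ Real.exp (-v p / 8) := Real.exp_le_exp.2 (by linarith)
    exact mul_le_mul h3 h4 (Real.exp_pos _).le (Real.rpow_nonneg (by linarith) _)
  have hMpos : 0 < Mn := hM₀.trans_le hM0M
  -- Three regimes: equal indices use boundedness of the bump, near pairs the crude bound, far pairs
  -- the Fourier bound, which exceeds the product of means only by a factor 1 + 6k.
  have hpair : ∀ p ∈ T, ∀ q ∈ T, ∫ g, W p g * W q g ∂P ≤ (1 + 6 * k) * (m p * m q) +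
      (if p = q then Real.exp (1 / 8) * m p else 0) +
      (if near p q ∧ p ≠ q then Real.exp (1 / 4) * b p q else 0) := by
    intro p hp q hq
    have hbase : 0 ≤ (1 + 6 * k) * (m p * m q) := by
      have := hm0 p
      have := hm0 q
      positivity
    by_cases hpq : p = q
    · subst hpq
      have h1 : ∫ g, W p g * W p g ∂P ≤ Real.exp (1 / 8) * m p := by
        rw [← hmean, ← integral_const_mul]
        exact integral_mono (hWWint p p) ((hWint p).const_mul _) fun g =>
          mul_le_mul_of_nonneg_right (hWle p g) (hW0 p g)
      simp only [if_true, ne_eq, not_true_eq_false, and_false, if_false, add_zero]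
      linarith
    · by_cases hn : near p q
      · have h1 : ∫ g, W p g * W q g ∂P ≤ Real.exp (1 / 4) * b p q :=
          integral_le_of_lintegral_le ((hWm p).mul (hWm q))
            (fun g => mul_nonneg (hW0 p g) (hW0 q g)) (by positivity)
            (lintegral_bump_mul_bump_le_exp (u p) (u q))
        simp only [hpq, if_false, hn, ne_eq, not_false_eq_true, and_self, if_true, add_zero]
        linarith
      · simp only [hpq, if_false, hn, false_and, add_zero]
        set c := ∑ i, u p i * u q i with hc
        have hck : |c| ≤ k := hfar p hp q hq hpq hn
        have hpos : ∀ r, 0 < (1 + v r) * (1 - k) := fun r =>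
          mul_pos (by linarith [hv0 r]) (by linarith)
        have hge : ∀ r, (1 + v r) * (1 - k) ≤ 1 + v r - |c| := fun r => by
          nlinarith [mul_nonneg (hv0 r) hk0]
        have h1 : ∫ g, W p g * W q g ∂P ≤ Real.exp (-(v p + v q) / 8 + c / 4) *
            ((1 + v p - |c|) ^ (-(1 / 2) : ℝ) * (1 + v q - |c|) ^ (-(1 / 2) : ℝ)) := by
          have hp0 : 0 < 1 + v p - |c| := (hpos p).trans_le (hge p)
          have hq0 : 0 < 1 + v q - |c| := (hpos q).trans_le (hge q)
          exact integral_le_of_lintegral_le ((hWm p).mul (hWm q))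
            (fun g => mul_nonneg (hW0 p g) (hW0 q g)) (by positivity)
            (lintegral_bump_mul_bump_le (u p) (u q) rfl rfl rfl hp0 hq0)
        have h2 : ∀ r, (1 + v r - |c|) ^ (-(1 / 2) : ℝ) ≤
            (1 + v r) ^ (-(1 / 2) : ℝ) * (1 - k) ^ (-(1 / 2) : ℝ) := by
          intro r
          rw [← Real.mul_rpow (by linarith [hv0 r]) (by linarith)]
          exact Real.rpow_le_rpow_of_nonpos (hpos r) (hge r) (by norm_num)
        have h3 : (1 - k) ^ (-(1 / 2) : ℝ) * (1 - k) ^ (-(1 / 2) : ℝ) ≤ Real.exp (2 * k) := by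
          rw [← Real.rpow_add (by linarith)]
          norm_num
          rw [Real.rpow_neg_one, inv_le_comm₀ (by linarith) (Real.exp_pos _), ← Real.exp_neg]
          have h5 : Real.exp (-(2 * k)) * (1 + 2 * k) ≤ 1 := by
            calc _ ≤ Real.exp (-(2 * k)) * Real.exp (2 * k) := by
                  gcongr
                  linarith [Real.add_one_le_exp (2 * k)]
              _ = 1 := by rw [← Real.exp_add]; simp
          nlinarith [Real.exp_pos (-(2 * k))]
        -- The exponent is at most 9k/4; convexity on [0, 9/8] together with exp(9/8) ≤ 4 gives the
        -- chord 1 + 6k for k ≤ 1/2.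
        have h4 : Real.exp (c / 4) * Real.exp (2 * k) ≤ 1 + 6 * k := by
          rw [← Real.exp_add]
          have hc4 : c / 4 + 2 * k ≤ 9 / 4 * k := by linarith [le_abs_self c]
          refine (Real.exp_le_exp.2 hc4).trans ?_
          have hconv := convexOn_exp.2 (Set.mem_univ 0) (Set.mem_univ (9 / 8 : ℝ))
            (show 0 ≤ 1 - 2 * k by linarith) (show 0 ≤ 2 * k by linarith) (by ring)
          simp only [smul_eq_mul, mul_zero, zero_add, Real.exp_zero, mul_one] at hconv
          have he : Real.exp (9 / 8) ≤ 4 := by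
            have : Real.exp (9 / 8) ≤ Real.exp 1 * Real.exp (1 / 8) := by
              rw [← Real.exp_add]
              exact Real.exp_le_exp.2 (by norm_num)
            have h18 : Real.exp (1 / 8 : ℝ) ≤ 8 / 7 := by
              have := Real.add_one_le_exp (-(1 / 8) : ℝ)
              rw [Real.exp_neg, le_inv_comm₀ (by norm_num) (Real.exp_pos _)] at this
              exact this.trans (by norm_num)
            nlinarith [Real.exp_one_lt_d9, Real.exp_pos (1 / 8 : ℝ), Real.exp_pos 1]
          have he2 := mul_le_mul_of_nonneg_left he (show 0 ≤ 2 * k by linarith)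
          calc Real.exp (9 / 4 * k) = Real.exp (2 * k * (9 / 8)) := by congr 1; ring
            _ ≤ _ := by linarith
        have hmp := hm0 p
        have hmq := hm0 q
        calc ∫ g, W p g * W q g ∂P ≤ _ := h1
          _ ≤ Real.exp (-(v p + v q) / 8 + c / 4) *
              (((1 + v p) ^ (-(1 / 2) : ℝ) * (1 - k) ^ (-(1 / 2) : ℝ)) *
                ((1 + v q) ^ (-(1 / 2) : ℝ) * (1 - k) ^ (-(1 / 2) : ℝ))) := by
              have hq0 : 0 < 1 + v q - |c| := (hpos q).trans_le (hge q)
              have := h2 p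
              have := h2 q
              have : 0 ≤ (1 + v p) ^ (-(1 / 2) : ℝ) * (1 - k) ^ (-(1 / 2) : ℝ) :=
                mul_nonneg (Real.rpow_nonneg (by linarith [hv0 p]) _)
                  (Real.rpow_nonneg (by linarith) _)
              gcongr
          _ = (m p * m q) * (Real.exp (c / 4) *
              ((1 - k) ^ (-(1 / 2) : ℝ) * (1 - k) ^ (-(1 / 2) : ℝ))) := by
              rw [hm, show -(v p + v q) / 8 + c / 4 = -v p / 8 + (-v q / 8 + c / 4) by ring,
                Real.exp_add, Real.exp_add]
              ring
          _ ≤ (m p * m q) * (1 + 6 * k) := by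
              gcongr
              refine le_trans ?_ h4
              gcongr
          _ = _ := mul_comm _ _
  set Z : (ι → ℝ) → ℝ := fun g => ∑ p ∈ T, W p g with hZ
  have hZm : Measurable Z := Finset.measurable_fun_sum _ fun p _ => hWm p
  have hZmean : ∫ g, Z g ∂P = Mn := by
    rw [integral_finsetSum _ fun p _ => hWint p]
    exact Finset.sum_congr rfl fun p _ => hmean p
  set B := ∑ p ∈ T, ∑ q ∈ T with near p q ∧ p ≠ q, b p q with hB
  have hZ2 : ∫ g, Z g ^ 2 ∂P ≤ (1 + 6 * k) * Mn ^ 2 + Real.exp (1 / 8) * Mn +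
      Real.exp (1 / 4) * B := by
    have : ∀ g, Z g ^ 2 = ∑ p ∈ T, ∑ q ∈ T, W p g * W q g := fun g => by
      rw [pow_two, Finset.sum_mul_sum]
    simp_rw [this]
    rw [integral_finsetSum _ fun p _ => integrable_finsetSum _ fun q _ => hWWint p q]
    calc _ ≤ ∑ p ∈ T, ∑ q ∈ T, ((1 + 6 * k) * (m p * m q) +
          (if p = q then Real.exp (1 / 8) * m p else 0) +
          (if near p q ∧ p ≠ q then Real.exp (1 / 4) * b p q else 0)) := by
          refine Finset.sum_le_sum fun p hp => ?_
          rw [integral_finsetSum _ fun q _ => hWWint p q]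
          exact Finset.sum_le_sum fun q hq => hpair p hp q hq
      _ = _ := by
          simp_rw [Finset.sum_add_distrib]
          congr 1
          · congr 1
            · simp_rw [← Finset.mul_sum]
              rw [pow_two, hMn, Finset.sum_mul_sum]
              simp_rw [← Finset.mul_sum]
            · rw [hMn, Finset.mul_sum]
              refine Finset.sum_congr rfl fun p hp => ?_
              simp [hp]
          · rw [hB, Finset.mul_sum]
            refine Finset.sum_congr rfl fun p hp => ?_
            rw [Finset.mul_sum, Finset.sum_filter]
  have hZL : MemLp Z 2 P := MemLp.of_bound hZm.aestronglyMeasurable (T.card * Real.exp (1 / 8))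
    (Eventually.of_forall fun g => by
      rw [Real.norm_of_nonneg (Finset.sum_nonneg fun p _ => hW0 p g), ← nsmul_eq_mul]
      exact Finset.sum_le_card_nsmul _ _ _ fun p _ => hWle p g)
  have hvar : Var[Z; P] ≤ 6 * k * Mn ^ 2 + Real.exp (1 / 8) * Mn + Real.exp (1 / 4) * B := by
    rw [variance_eq_sub hZL, hZmean]
    have : ∫ g, (Z ^ 2) g ∂P = ∫ g, Z g ^ 2 ∂P := rfl
    rw [this]
    linarith
  have hcheb := meas_ge_le_variance_div_sq hZL (c := Mn / 2) (by positivity)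
  rw [hZmean] at hcheb
  refine (measure_mono fun g hg => ?_).trans (hcheb.trans (ENNReal.ofReal_le_ofReal ?_))
  · have hg' : Z g < M₀ / 2 := hg
    show Mn / 2 ≤ |Z g - Mn|
    rw [abs_sub_comm]
    refine le_trans ?_ (le_abs_self _)
    linarith
  · have hB0 : 0 ≤ B := Finset.sum_nonneg fun p _ => Finset.sum_nonneg fun q _ =>
      (Real.exp_pos _).le
    calc _ ≤ (6 * k * Mn ^ 2 + Real.exp (1 / 8) * Mn + Real.exp (1 / 4) * B) / (Mn / 2) ^ 2 := by
          gcongr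
      _ = 24 * k + 4 * Real.exp (1 / 8) / Mn + 4 * Real.exp (1 / 4) / Mn ^ 2 * B :=
          variance_bound_div hMpos.ne' _ _ _ _
      _ ≤ _ := add_le_add
          (add_le_add le_rfl (div_le_div_of_nonneg_left (by positivity) hM₀ hM0M))
          (mul_le_mul_of_nonneg_right (div_le_div_of_nonneg_left (by positivity) (by positivity)
            (pow_le_pow_left₀ hM₀.le hM0M 2)) hB0)

/-! ### Energies of transpositions and of their quotients -/

section Energy

variable {n d : ℕ}

theorem one_sub_rpow_neg_pow_le_exp {z : ℝ} (hz1 : z ≤ 1 / 2) (k : ℕ) :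
    ((1 - z) ^ (-(1 / 4) : ℝ)) ^ k ≤ Real.exp (k * (z / 4 * (1 + 2 * z))) := by
  have h1 : 0 < 1 - z := by linarith
  rw [← Real.rpow_natCast, ← Real.rpow_mul h1.le, Real.rpow_def_of_pos h1, Real.exp_le_exp]
  have h2 := Real.one_sub_inv_le_log_of_pos h1
  have h3 : -(z * (1 + 2 * z)) ≤ 1 - (1 - z)⁻¹ := by
    rw [show 1 - (1 - z)⁻¹ = -z / (1 - z) by field_simp; ring, le_div_iff₀ h1]
    nlinarith [sq_nonneg z]
  have h4 := mul_le_mul_of_nonneg_right (h3.trans h2) (Nat.cast_nonneg k : (0 : ℝ) ≤ k)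
  linarith

/-- The squared length of the displacement of the coordinates `a` by the relabelling `σ`. -/
noncomputable def energy (t₁ t₂ : ℝ) (σ : Equiv.Perm (Fin n)) (a : Coord n d → ℝ) : ℝ :=
  ∑ j, shift (uniformWeights n d t₁ t₂) (act d σ) a j ^ 2

@[fun_prop]
theorem measurable_energy (t₁ t₂ : ℝ) (σ : Equiv.Perm (Fin n)) :
    Measurable (energy (d := d) t₁ t₂ σ) := by
  unfold energy shift; fun_prop

theorem mul_energy (w t₁ t₂ : ℝ) (σ : Equiv.Perm (Fin n)) (a : Coord n d → ℝ) :
    w * energy t₁ t₂ σ a =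
      ∑ j, uniformWeights n d (w * t₁ ^ 2) (w * t₂ ^ 2) j * (a (act d σ j) - a j) ^ 2 := by
  rw [energy, Finset.mul_sum]
  refine Finset.sum_congr rfl fun j _ => ?_
  rcases j with e | z <;> simp only [shift, uniformWeights_inl, uniformWeights_inr] <;> ring

theorem lintegral_exp_neg_energy_le {w δ t₁ t₂ : ℝ} (hw : 0 ≤ w) (h₁ : 8 * (w * t₁ ^ 2) ≤ δ)
    (h₂ : 8 * (w * t₂ ^ 2) ≤ δ) (σ : Equiv.Perm (Fin n)) :
    ∫⁻ a, ENNReal.ofReal (Real.exp (-(w * energy t₁ t₂ σ a))) ∂stdNormalPi (Coord n d) ≤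
      ENNReal.ofReal (Real.exp (-((1 - δ) * (2 * w) * (t₁ ^ 2 * (edgeAct σ).support.card +
        t₂ ^ 2 * (σ.support.card * d))))) := by
  simp_rw [mul_energy]
  have hx : 0 ≤ w * t₁ ^ 2 := by positivity
  have hy : 0 ≤ w * t₂ ^ 2 := by positivity
  refine (lintegral_exp_perm_le (act d σ) _ fun j => forall_uniformWeights
    (p := fun z => 0 < 1 + 8 * z) (by linarith) (by linarith) j).trans
    (ENNReal.ofReal_le_ofReal ?_)
  rw [prod_support_act σ _ _ fun z => (1 + 8 * z) ^ (-(1 / 4) : ℝ)]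
  have hδ := rpow_neg_pow_le_exp (x := 8 * (w * t₁ ^ 2)) (by linarith) h₁ (edgeAct σ).support.card
  have hδ' := rpow_neg_pow_le_exp (x := 8 * (w * t₂ ^ 2)) (by linarith) h₂ (σ.support.card * d)
  refine (mul_le_mul hδ hδ' (by positivity) (Real.exp_pos _).le).trans (le_of_eq ?_)
  rw [← Real.exp_add]
  push_cast
  congr 1
  ring

/-- The energy of a transposition rarely exceeds four times the signal. -/
theorem measure_energy_swap_gt_le {θ t₁ t₂ : ℝ} (hθ : 0 ≤ θ) (h₁ : 16 * (θ * t₁ ^ 2) ≤ 1)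
    (h₂ : 16 * (θ * t₂ ^ 2) ≤ 1) {σ : Equiv.Perm (Fin n)} (hσ : σ.IsSwap) :
    stdNormalPi (Coord n d) {a | 4 * (t₁ ^ 2 * n + t₂ ^ 2 * d) + 1 < energy t₁ t₂ σ a} ≤
      ENNReal.ofReal (Real.exp (-θ + 64 * θ ^ 2 * (n * (t₁ ^ 2) ^ 2 + d * (t₂ ^ 2) ^ 2))) := by
  set x := t₁ ^ 2 with hx
  set y := t₂ ^ 2 with hy
  have hx0 : 0 ≤ x := sq_nonneg _
  have hy0 : 0 ≤ y := sq_nonneg _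
  set S := x * n + y * d with hS
  have hcard : σ.support.card = 2 := Equiv.Perm.card_support_eq_two.2 hσ
  have hn : 1 ≤ n := by
    have : σ.support.card ≤ n := (Finset.card_le_univ _).trans (by simp)
    omega
  refine (measure_le_lintegral_exp _ (F := fun a => -(θ * (4 * S + 1)) + θ * energy t₁ t₂ σ a)
    (by fun_prop) fun a ha => ?_).trans ?_
  · have ha' : 4 * S + 1 < energy t₁ t₂ σ a := ha
    nlinarith
  simp_rw [Real.exp_add, ENNReal.ofReal_mul (Real.exp_pos (-(θ * (4 * S + 1)))).le]
  rw [lintegral_const_mul _ (by fun_prop)]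
  have hθx : 0 ≤ θ * x := by positivity
  have hθy : 0 ≤ θ * y := by positivity
  -- The Hölder bound with negative weights controls the upper tail. At most 2n edges move, so the
  -- linear part of the exponent is at most 4θS, cancelled by the centring; the second order part is
  -- the error term.
  have h := lintegral_exp_perm_le (act d σ)
    (uniformWeights n d (-θ * x) (-θ * y)) fun j => forall_uniformWeights
    (p := fun z => 0 < 1 + 8 * z) (by linarith) (by linarith) j
  simp_rw [hx, hy, ← mul_energy, neg_mul, neg_neg] at h
  rw [prod_support_act σ _ _ fun z => (1 + 8 * z) ^ (-(1 / 4) : ℝ)] at h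
  refine (mul_le_mul_right h _).trans ?_
  rw [← ENNReal.ofReal_mul (Real.exp_pos _).le]
  refine ENNReal.ofReal_le_ofReal ?_
  rw [show 1 + 8 * -(θ * t₁ ^ 2) = 1 - 8 * (θ * x) by rw [hx]; ring,
    show 1 + 8 * -(θ * t₂ ^ 2) = 1 - 8 * (θ * y) by rw [hy]; ring]
  have h3 := one_sub_rpow_neg_pow_le_exp (z := 8 * (θ * x)) (by linarith)
    (edgeAct σ).support.card
  have h4 := one_sub_rpow_neg_pow_le_exp (z := 8 * (θ * y)) (by linarith)
    (σ.support.card * d)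
  refine (mul_le_mul_of_nonneg_left (mul_le_mul h3 h4
    (pow_nonneg (Real.rpow_nonneg (by linarith) _) _) (Real.exp_pos _).le)
    (Real.exp_pos _).le).trans ?_
  rw [← Real.exp_add, ← Real.exp_add, ← Real.exp_add, Real.exp_le_exp]
  have hk : ((edgeAct σ).support.card : ℝ) ≤ 2 * n := by
    have h5 : ((edgeAct σ).support.card : ℝ) ≤ (touching σ.support).card := by
      exact_mod_cast Finset.card_le_card (support_edgeAct_subset σ)
    have h6 := card_touching_eq hn σ.support
    rw [hcard] at h6
    push_cast at h6
    linarith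
  have h7 : (edgeAct σ).support.card * (8 * (θ * x) / 4 * (1 + 2 * (8 * (θ * x)))) ≤
      2 * n * (8 * (θ * x) / 4 * (1 + 2 * (8 * (θ * x)))) := by gcongr
  rw [hcard]
  push_cast
  nlinarith

/-- Reindexing by τ: the distance between two displacements is the length of the displacement of the
quotient, which for overlapping transpositions is a three-cycle. -/
theorem energy_mul_inv (t₁ t₂ : ℝ) (σ τ : Equiv.Perm (Fin n)) (a : Coord n d → ℝ) :
    ∑ j, (shift (uniformWeights n d t₁ t₂) (act d σ) a j -
      shift (uniformWeights n d t₁ t₂) (act d τ) a j) ^ 2 = energy t₁ t₂ (σ * τ⁻¹) a := by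
  rw [energy, ← Equiv.sum_comp (act d τ) fun j =>
    shift (uniformWeights n d t₁ t₂) (act d (σ * τ⁻¹)) a j ^ 2]
  refine Finset.sum_congr rfl fun j _ => ?_
  have h : act d (σ * τ⁻¹) (act d τ j) = act d σ j := by
    rw [act_mul, act_inv]
    simp
  rw [shift, shift, shift, h, uniformWeights_act]
  ring

theorem card_support_mul_of_not_disjoint {σ τ : Equiv.Perm (Fin n)} (hσ : σ.IsSwap)
    (hτ : τ.IsSwap) (hne : σ ≠ τ) (h : ¬ σ.Disjoint τ) : (σ * τ⁻¹).support.card = 3 := by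
  obtain ⟨i, j, hij, rfl⟩ := hσ
  obtain ⟨k, l, hkl, rfl⟩ := hτ
  rw [Equiv.swap_inv]
  have key : ∀ {a b c : Fin n}, a ≠ b → a ≠ c → Equiv.swap a b ≠ Equiv.swap a c →
      (Equiv.swap a b * Equiv.swap a c).support.card = 3 := by
    intro a b c hab hac hn
    exact (Equiv.Perm.isThreeCycle_swap_mul_swap_same hab hac
      fun hbc => hn (hbc ▸ rfl)).card_support
  by_cases h1 : i = k
  · subst h1
    exact key hij hkl hne
  by_cases h2 : i = l
  · subst h2
    rw [Equiv.swap_comm k i] at hne ⊢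
    exact key hij hkl.symm hne
  by_cases h3 : j = k
  · subst h3
    rw [Equiv.swap_comm i j] at hne ⊢
    exact key hij.symm hkl hne
  by_cases h4 : j = l
  · subst h4
    rw [Equiv.swap_comm i j, Equiv.swap_comm k j] at hne ⊢
    exact key hij.symm hkl.symm hne
  exact absurd (Equiv.Perm.disjoint_swap_swap (by simp [*])) h

end Energy

/-! ### Overlapping and disjoint pairs of transpositions -/

section Pairs

variable {n d : ℕ}

/-- Convexity of the exponential. The weights equalize the decay after averaging over `a`: a
transposition moves about 2n edges, a three-cycle about 3n, and 2·2·7/36 = 2·3·7/54 = 7/9. -/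
theorem exp_add_div_le (A B C : ℝ) : Real.exp (-(A + B + C) / 18) ≤
    2 / 7 * Real.exp (-(7 / 36 * A)) + 2 / 7 * Real.exp (-(7 / 36 * B)) +
      3 / 7 * Real.exp (-(7 / 54 * C)) := by
  have h1 := convexOn_exp.2 (Set.mem_univ (-(7 / 36 * A))) (Set.mem_univ (-(7 / 36 * B)))
    (show (0 : ℝ) ≤ 1 / 2 by norm_num) (show (0 : ℝ) ≤ 1 / 2 by norm_num) (by norm_num)
  have h2 := convexOn_exp.2 (Set.mem_univ (1 / 2 * -(7 / 36 * A) + 1 / 2 * -(7 / 36 * B)))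
    (Set.mem_univ (-(7 / 54 * C)))
    (show (0 : ℝ) ≤ 4 / 7 by norm_num) (show (0 : ℝ) ≤ 3 / 7 by norm_num) (by norm_num)
  simp only [smul_eq_mul] at h1 h2
  rw [show 4 / 7 * (1 / 2 * -(7 / 36 * A) + 1 / 2 * -(7 / 36 * B)) + 3 / 7 * -(7 / 54 * C) =
    -(A + B + C) / 18 by ring] at h2
  linarith

/-- Two transpositions sharing a vertex are rarely both nearly energy minimal. -/
theorem lintegral_exp_neg_energy_pair_le {t₁ t₂ : ℝ} (h₁ : t₁ ^ 2 ≤ 1 / 200)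
    (h₂ : t₂ ^ 2 ≤ 1 / 200) {σ τ : Equiv.Perm (Fin n)} (hσ : σ.IsSwap) (hτ : τ.IsSwap)
    (hne : σ ≠ τ) (h : ¬ σ.Disjoint τ) :
    ∫⁻ a, ENNReal.ofReal (Real.exp (-(energy t₁ t₂ σ a + energy t₁ t₂ τ a +
      energy t₁ t₂ (σ * τ⁻¹) a) / 18)) ∂stdNormalPi (Coord n d) ≤
      ENNReal.ofReal (Real.exp (-(23 / 30 * (t₁ ^ 2 * n + t₂ ^ 2 * d - 5 / 2 * t₁ ^ 2)))) := by
  have h2 : ∀ {π : Equiv.Perm (Fin n)}, π.IsSwap →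
      ∫⁻ a, ENNReal.ofReal (Real.exp (-(7 / 36 * energy t₁ t₂ π a))) ∂stdNormalPi (Coord n d) ≤
        ENNReal.ofReal (Real.exp (-(23 / 30 *
          (t₁ ^ 2 * n + t₂ ^ 2 * d - 5 / 2 * t₁ ^ 2)))) := by
    intro π hπ
    have hc : π.support.card = 2 := Equiv.Perm.card_support_eq_two.2 hπ
    have hn : 2 ≤ n := hc ▸ (Finset.card_le_univ _).trans (by simp)
    -- The loss 1 - 1/70 turns the rate 7/9 into 23/30. At least 2n - 4 edges move; the correction
    -- 5/2 is the one needed for three-cycles, which move at least 3(n - 5/2).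
    refine (lintegral_exp_neg_energy_le (δ := 1 / 70) (by norm_num) (by linarith) (by linarith)
      π).trans (ENNReal.ofReal_le_ofReal (Real.exp_le_exp.2 ?_))
    have hk := card_support_edgeAct_ge hn π
    rw [hc] at hk ⊢
    push_cast at hk ⊢
    have := mul_le_mul_of_nonneg_left hk (sq_nonneg t₁)
    nlinarith [sq_nonneg t₁]
  have h3 : ∫⁻ a, ENNReal.ofReal (Real.exp (-(7 / 54 * energy t₁ t₂ (σ * τ⁻¹) a)))
      ∂stdNormalPi (Coord n d) ≤ ENNReal.ofReal (Real.exp (-(23 / 30 *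
          (t₁ ^ 2 * n + t₂ ^ 2 * d - 5 / 2 * t₁ ^ 2)))) := by
    have hc := card_support_mul_of_not_disjoint hσ hτ hne h
    have hn : 3 ≤ n := hc ▸ (Finset.card_le_univ _).trans (by simp)
    refine (lintegral_exp_neg_energy_le (δ := 1 / 70) (by norm_num) (by linarith) (by linarith)
      _).trans (ENNReal.ofReal_le_ofReal (Real.exp_le_exp.2 ?_))
    have hk := card_support_edgeAct_ge (by omega) (σ * τ⁻¹)
    rw [hc] at hk ⊢
    push_cast at hk ⊢
    have := mul_le_mul_of_nonneg_left hk (sq_nonneg t₁)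
    nlinarith [sq_nonneg t₁]
  set E := Real.exp (-(23 / 30 * (t₁ ^ 2 * n + t₂ ^ 2 * d - 5 / 2 * t₁ ^ 2))) with hE
  have hE0 : 0 ≤ E := (Real.exp_pos _).le
  calc _ ≤ ∫⁻ a, (ENNReal.ofReal (2 / 7) *
          ENNReal.ofReal (Real.exp (-(7 / 36 * energy t₁ t₂ σ a))) +
        ENNReal.ofReal (2 / 7) * ENNReal.ofReal (Real.exp (-(7 / 36 * energy t₁ t₂ τ a))) +
        ENNReal.ofReal (3 / 7) * ENNReal.ofReal (Real.exp (-(7 / 54 * energy t₁ t₂ (σ * τ⁻¹) a))))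
        ∂stdNormalPi (Coord n d) := by
        refine lintegral_mono fun a => ?_
        rw [← ENNReal.ofReal_mul (by norm_num), ← ENNReal.ofReal_mul (by norm_num),
          ← ENNReal.ofReal_mul (by norm_num), ← ENNReal.ofReal_add (by positivity) (by positivity),
          ← ENNReal.ofReal_add (by positivity) (by positivity)]
        exact ENNReal.ofReal_le_ofReal (exp_add_div_le _ _ _)
    _ ≤ ENNReal.ofReal (2 / 7) * ENNReal.ofReal E + ENNReal.ofReal (2 / 7) * ENNReal.ofReal E +
        ENNReal.ofReal (3 / 7) * ENNReal.ofReal E := by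
        rw [lintegral_add_left (by fun_prop), lintegral_add_left (by fun_prop),
          lintegral_const_mul _ (by fun_prop), lintegral_const_mul _ (by fun_prop),
          lintegral_const_mul _ (by fun_prop)]
        exact add_le_add (add_le_add (mul_le_mul_right (h2 hσ) _) (mul_le_mul_right (h2 hτ) _))
          (mul_le_mul_right h3 _)
    _ = ENNReal.ofReal E := by
        rw [← ENNReal.ofReal_mul (by norm_num), ← ENNReal.ofReal_mul (by norm_num),
          ← ENNReal.ofReal_add (by positivity) (by positivity),
          ← ENNReal.ofReal_add (by positivity) (by positivity)]
        congr 1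
        ring

theorem card_touching_inter_le {σ τ : Equiv.Perm (Fin n)} (h : σ.Disjoint τ) :
    (touching σ.support ∩ touching τ.support).card ≤ σ.support.card * τ.support.card := by
  classical
  rw [← Finset.card_map (Function.Embedding.subtype _), ← Finset.card_product]
  refine (Finset.card_le_card fun z hz => ?_).trans
    (Finset.card_image_le (f := fun p : Fin n × Fin n => s(p.1, p.2)))
  obtain ⟨e, he, rfl⟩ := Finset.mem_map.1 hz
  rw [Finset.mem_inter, touching, touching, Finset.mem_filter, Finset.mem_filter] at he
  obtain ⟨⟨-, i, hi, hie⟩, -, j, hj, hje⟩ := he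
  have hij : i ≠ j := by
    rintro rfl
    exact Finset.disjoint_left.1 (Equiv.Perm.disjoint_iff_disjoint_support.1 h) hi hj
  refine Finset.mem_image.2 ⟨(i, j), Finset.mem_product.2 ⟨hi, hj⟩, ?_⟩
  exact ((Sym2.mem_and_mem_iff hij).1 ⟨hie, hje⟩).symm

/-- The displacements of two disjoint transpositions are nearly orthogonal. -/
theorem abs_sum_shift_mul_shift_le {t₁ t₂ M : ℝ} {a : Coord n d → ℝ}
    (ha : ∀ e, a (Sum.inl e) ^ 2 ≤ M) {σ τ : Equiv.Perm (Fin n)} (hσ : σ.IsSwap)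
    (hτ : τ.IsSwap) (h : σ.Disjoint τ) :
    |∑ j, shift (uniformWeights n d t₁ t₂) (act d σ) a j *
      shift (uniformWeights n d t₁ t₂) (act d τ) a j| ≤ 16 * t₁ ^ 2 * M := by
  classical
  rw [Fintype.sum_sum_type]
  have h0 : ∀ z : Fin n × Fin d, shift (uniformWeights n d t₁ t₂) (act d σ) a (Sum.inr z) *
      shift (uniformWeights n d t₁ t₂) (act d τ) a (Sum.inr z) = 0 := by
    intro z
    rcases h z.1 with h | h <;> simp [shift, h]
  rw [Finset.sum_congr rfl fun z _ => h0 z, Finset.sum_const_zero, add_zero]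
  set E := touching σ.support ∩ touching τ.support with hE
  have hfix : ∀ {π : Equiv.Perm (Fin n)} {e : Edge n}, e ∉ touching π.support →
      edgeAct π e = e := fun he => by
    by_contra hne
    exact he (support_edgeAct_subset _ (Equiv.Perm.mem_support.2 hne))
  rw [← Finset.sum_subset (Finset.subset_univ E) fun e _ he => by
    rw [hE, Finset.mem_inter, not_and_or] at he
    rcases he with he | he <;> simp [shift, hfix he]]
  -- An edge touching both supports joins a node of one transposition to a node of the other, and no
  -- feature coordinate is moved by both.
  have hcard : E.card ≤ 4 := by
    refine (card_touching_inter_le h).trans ?_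
    rw [Equiv.Perm.card_support_eq_two.2 hσ, Equiv.Perm.card_support_eq_two.2 hτ]
  have hterm : ∀ e ∈ E, |shift (uniformWeights n d t₁ t₂) (act d σ) a (Sum.inl e) *
      shift (uniformWeights n d t₁ t₂) (act d τ) a (Sum.inl e)| ≤ 4 * (t₁ ^ 2 * M) := by
    intro e _
    simp only [shift, uniformWeights_inl, act_inl]
    have h1 := ha e
    have h2 := ha (edgeAct σ e)
    have h3 := ha (edgeAct τ e)
    set b := a (Sum.inl e)
    set b₁ := a (Sum.inl (edgeAct σ e))
    set b₂ := a (Sum.inl (edgeAct τ e))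
    have h4 : |(b₁ - b) * (b₂ - b)| ≤ 4 * M := by
      rw [abs_le]
      constructor <;> nlinarith [sq_nonneg (b₁ - b + (b₂ - b)), sq_nonneg (b₁ - b - (b₂ - b)),
        sq_nonneg (b₁ + b), sq_nonneg (b₂ + b)]
    rw [show t₁ * (b₁ - b) * (t₁ * (b₂ - b)) = t₁ ^ 2 * ((b₁ - b) * (b₂ - b)) by ring, abs_mul,
      abs_of_nonneg (sq_nonneg t₁)]
    nlinarith [mul_le_mul_of_nonneg_left h4 (sq_nonneg t₁)]
  refine (Finset.abs_sum_le_sum_abs _ _).trans ((Finset.sum_le_card_nsmul _ _ _ hterm).trans ?_)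
  rw [nsmul_eq_mul]
  -- The sign of `M` is known only through some edge; when no edge is shared, a transposition still
  -- supplies one.
  rcases E.eq_empty_or_nonempty with hemp | ⟨e, he⟩
  · rw [hemp]
    by_cases hn : Nonempty (Edge n)
    · obtain ⟨e⟩ := hn
      have : 0 ≤ M := (sq_nonneg _).trans (ha e)
      simp only [Finset.card_empty, Nat.cast_zero, zero_mul]
      positivity
    · exfalso
      obtain ⟨i, j, hij, -⟩ := hσ
      exact hn ⟨⟨s(i, j), by simpa using hij⟩⟩
  · have hM : 0 ≤ M := (sq_nonneg _).trans (ha e)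
    have h4 : (E.card : ℝ) ≤ 4 := by exact_mod_cast hcard
    calc (E.card : ℝ) * (4 * (t₁ ^ 2 * M)) ≤ 4 * (4 * (t₁ ^ 2 * M)) := by gcongr
      _ = _ := by ring

theorem card_edge_le : Fintype.card (Edge n) ≤ n ^ 2 := by
  rw [Sym2.card_subtype_not_diag, Fintype.card_fin]
  exact Nat.choose_le_pow n 2

theorem measure_exists_edge_sq_gt_le (M : ℝ) :
    stdNormalPi (Coord n d) {a | ∃ e, M < a (Sum.inl e) ^ 2} ≤
      ENNReal.ofReal (n ^ 2 * (2 * Real.exp (-(M / 4)))) := by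
  have h1 : ∀ e : Edge n, stdNormalPi (Coord n d) {a | M < a (Sum.inl e) ^ 2} ≤
      ENNReal.ofReal (2 * Real.exp (-(M / 4))) := by
    intro e
    refine (measure_le_lintegral_exp _ (F := fun a => -(M / 4) + 1 / 4 * a (Sum.inl e) ^ 2)
      (by fun_prop) fun a ha => ?_).trans ?_
    · have : M < a (Sum.inl e) ^ 2 := ha
      linarith
    simp_rw [Real.exp_add, ENNReal.ofReal_mul (Real.exp_pos (-(M / 4))).le]
    rw [lintegral_const_mul _ (by fun_prop)]
    have h := (measurePreserving_eval (fun _ : Coord n d => stdNormal) (Sum.inl e)).lintegral_comp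
      (f := fun x => ENNReal.ofReal (Real.exp (1 / 4 * x ^ 2))) (by fun_prop)
    rw [lintegral_exp_mul_sq (by norm_num)] at h
    rw [stdNormalPi]
    simp only [Function.eval] at h
    rw [h, ← ENNReal.ofReal_mul (Real.exp_pos _).le, mul_comm]
    refine ENNReal.ofReal_le_ofReal ?_
    gcongr
    rw [show (1 - 2 * (1 / 4) : ℝ) = 2⁻¹ by norm_num, Real.inv_rpow (by norm_num),
      Real.rpow_neg (by norm_num), inv_inv]
    calc (2 : ℝ) ^ (1 / 2 : ℝ) ≤ 2 ^ (1 : ℝ) :=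
          Real.rpow_le_rpow_of_exponent_le (by norm_num) (by norm_num)
      _ = 2 := Real.rpow_one 2
  rw [Set.ofPred_exists]
  refine (measure_iUnion_fintype_le _ _).trans ((Finset.sum_le_card_nsmul _ _ _ fun e _ =>
    h1 e).trans ?_)
  rw [Finset.card_univ, nsmul_eq_mul, ENNReal.ofReal_mul (p := (n : ℝ) ^ 2) (by positivity)]
  gcongr
  rw [ENNReal.ofReal_pow (by positivity), ENNReal.ofReal_natCast]
  exact_mod_cast card_edge_le

open Classical in
/-- The transpositions of `[n]`. -/
noncomputable def swaps (n : ℕ) : Finset (Equiv.Perm (Fin n)) :=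
  Finset.univ.filter fun σ => σ.IsSwap

theorem mem_swaps {σ : Equiv.Perm (Fin n)} : σ ∈ swaps n ↔ σ.IsSwap := by
  simp [swaps]

theorem sq_le_card_swaps (hn : 2 ≤ n) : (n : ℝ) ^ 2 / 4 ≤ (swaps n).card := by
  have h : (Finset.powersetCard 2 (Finset.univ : Finset (Fin n))).card ≤ (swaps n).card := by
    refine Finset.card_le_card_of_surjOn (fun σ => σ.support) fun V hV => ?_
    obtain ⟨-, hV⟩ := Finset.mem_powersetCard.1 (Finset.mem_coe.1 hV)
    obtain ⟨i, j, hij, rfl⟩ := Finset.card_eq_two.1 hV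
    exact ⟨Equiv.swap i j, Finset.mem_coe.2 (mem_swaps.2 ⟨i, j, hij, rfl⟩),
      Equiv.Perm.support_swap hij⟩
  rw [Finset.card_powersetCard, Finset.card_univ, Fintype.card_fin] at h
  have h2 : (n.choose 2 : ℝ) ≤ (swaps n).card := by exact_mod_cast h
  rw [Nat.cast_choose_two] at h2
  have : (2 : ℝ) ≤ n := by exact_mod_cast hn
  nlinarith

/-- A commonly moved node and its two images determine the pair. -/
theorem card_not_disjoint_swaps_le [DecidableRel fun σ τ : Equiv.Perm (Fin n) => ¬ σ.Disjoint τ]: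
    ((swaps n ×ˢ swaps n).filter fun p => ¬ p.1.Disjoint p.2).card ≤ n ^ 3 := by
  classical
  refine (Finset.card_le_card (t := (Finset.univ : Finset (Fin n × Fin n × Fin n)).image
    fun q => (Equiv.swap q.1 q.2.1, Equiv.swap q.1 q.2.2)) fun p hp => ?_).trans
    (Finset.card_image_le.trans ?_)
  · obtain ⟨hp1, hp⟩ := Finset.mem_filter.1 hp
    obtain ⟨h1, h2⟩ := Finset.mem_product.1 hp1
    have key : ∀ {π : Equiv.Perm (Fin n)} {i : Fin n}, π.IsSwap → π i ≠ i →
        ∃ j, π = Equiv.swap i j := by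
      rintro π i ⟨k, l, hkl, rfl⟩ hi
      by_cases hik : i = k
      · exact ⟨l, by rw [hik]⟩
      by_cases hil : i = l
      · exact ⟨k, by rw [hil, Equiv.swap_comm]⟩
      · exact absurd (Equiv.swap_apply_of_ne_of_ne hik hil) hi
    simp only [Equiv.Perm.Disjoint, not_forall, not_or] at hp
    obtain ⟨i, hi1, hi2⟩ := hp
    obtain ⟨j, hj⟩ := key (mem_swaps.1 h1) hi1
    obtain ⟨k, hk⟩ := key (mem_swaps.1 h2) hi2
    exact Finset.mem_image.2 ⟨(i, j, k), Finset.mem_univ _, Prod.ext hj.symm hk.symm⟩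
  · rw [Finset.card_univ, Fintype.card_prod, Fintype.card_prod, Fintype.card_fin]
    exact le_of_eq (by ring)

end Pairs

/-! ### A nonasymptotic converse -/

section FiniteBound

variable {n d : ℕ}

open Classical in
/-- The transpositions whose energy does not exceed `V`. -/
noncomputable def lowEnergySwaps (t₁ t₂ V : ℝ) (a : Coord n d → ℝ) : Finset (Equiv.Perm (Fin n)) :=
  (swaps n).filter fun σ => energy t₁ t₂ σ a ≤ V

open Classical in
/-- The pairs of distinct transpositions that share a vertex. -/
noncomputable def nearSwaps (n : ℕ) : Finset (Equiv.Perm (Fin n) × Equiv.Perm (Fin n)) :=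
  (swaps n ×ˢ swaps n).filter fun p => ¬ p.1.Disjoint p.2 ∧ p.1 ≠ p.2

theorem card_nearSwaps_le : (nearSwaps n).card ≤ n ^ 3 := by
  classical
  refine (Finset.card_le_card ?_).trans (card_not_disjoint_swaps_le (n := n))
  exact Finset.monotone_filter_right _ fun p _ hp => hp.1

/-- The correlation weight of a pair of transpositions. -/
noncomputable def pairWeight (t₁ t₂ : ℝ) (a : Coord n d → ℝ)
    (p : Equiv.Perm (Fin n) × Equiv.Perm (Fin n)) : ℝ :=
  Real.exp (-(energy t₁ t₂ p.1 a + energy t₁ t₂ p.2 a + energy t₁ t₂ (p.1 * p.2⁻¹) a) / 18)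

/-- Markov's inequality for the number of transpositions of high energy; no independence between
them is needed. -/
theorem measure_card_lowEnergySwaps_lt_le {t₁ t₂ V b : ℝ} (hn : 2 ≤ n)
    (hb : ∀ σ : Equiv.Perm (Fin n), σ.IsSwap →
      stdNormalPi (Coord n d) {a | V < energy t₁ t₂ σ a} ≤ ENNReal.ofReal b) :
    stdNormalPi (Coord n d)
      {a | ((lowEnergySwaps t₁ t₂ V a).card : ℝ) < (swaps n).card / 2} ≤
        ENNReal.ofReal (2 * b) := by
  classical
  set N := (swaps n).card with hN
  have hNpos : 0 < N := by
    have h := sq_le_card_swaps hn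
    have h2 : (2 : ℝ) ≤ n := by exact_mod_cast hn
    have : (0 : ℝ) < N := by nlinarith
    exact_mod_cast this
  have hm : ∀ σ : Equiv.Perm (Fin n), MeasurableSet {a : Coord n d → ℝ | V < energy t₁ t₂ σ a} :=
    fun σ => measurableSet_lt measurable_const (measurable_energy _ _ σ)
  set F : (Coord n d → ℝ) → ℝ≥0∞ := fun a =>
    ∑ σ ∈ swaps n, {a | V < energy t₁ t₂ σ a}.indicator 1 a with hF
  have hFm : Measurable F := Finset.measurable_fun_sum _ fun σ _ =>
    measurable_one.indicator (hm σ)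
  have hFeq : ∀ a, F a = ((N - (lowEnergySwaps t₁ t₂ V a).card : ℕ) : ℝ≥0∞) := by
    intro a
    have h1 : F a = (((swaps n).filter fun σ => ¬ energy t₁ t₂ σ a ≤ V).card : ℝ≥0∞) := by
      rw [Finset.card_filter, Nat.cast_sum]
      refine Finset.sum_congr rfl fun σ _ => ?_
      by_cases h : V < energy t₁ t₂ σ a <;> simp [h]
    rw [h1, hN, ← Finset.card_filter_add_card_filter_not (s := swaps n)
      (fun σ => energy t₁ t₂ σ a ≤ V), lowEnergySwaps, Nat.add_sub_cancel_left]
  have hint : ∫⁻ a, F a ∂stdNormalPi (Coord n d) ≤ N * ENNReal.ofReal b := by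
    rw [lintegral_finsetSum _ fun σ _ => measurable_one.indicator (hm σ), ← nsmul_eq_mul]
    refine Finset.sum_le_card_nsmul _ _ _ fun σ hσ => ?_
    rw [lintegral_indicator_one (hm σ)]
    exact hb σ (mem_swaps.1 hσ)
  have hN0 : (N : ℝ≥0∞) ≠ 0 := by exact_mod_cast hNpos.ne'
  have hNt : (N : ℝ≥0∞) ≠ ⊤ := ENNReal.natCast_ne_top N
  have hmk := mul_meas_ge_le_lintegral (μ := stdNormalPi (Coord n d)) (hFm.const_mul 2) N
  rw [lintegral_const_mul _ hFm] at hmk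
  have h2 : (N : ℝ≥0∞) * stdNormalPi (Coord n d) {a | (N : ℝ≥0∞) ≤ 2 * F a} ≤
      N * ENNReal.ofReal (2 * b) := by
    refine hmk.trans ((mul_le_mul_right hint 2).trans (le_of_eq ?_))
    rw [ENNReal.ofReal_mul (by norm_num), ENNReal.ofReal_ofNat]
    ring
  refine (measure_mono fun a ha => ?_).trans ((ENNReal.mul_le_mul_iff_right hN0 hNt).1 h2)
  have ha' : ((lowEnergySwaps t₁ t₂ V a).card : ℝ) < N / 2 := ha
  have h3 : 2 * (lowEnergySwaps t₁ t₂ V a).card < N := by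
    have : (2 * (lowEnergySwaps t₁ t₂ V a).card : ℝ) < N := by linarith
    exact_mod_cast this
  show (N : ℝ≥0∞) ≤ 2 * F a
  rw [hFeq]
  exact_mod_cast (by omega : N ≤ 2 * (N - (lowEnergySwaps t₁ t₂ V a).card))

/-- For fixed `a` the second moment method is applied to the low energy transpositions only, since
the others can only increase the sum. The factor exp(-1/8) is the price of replacing the exponential
by the bump. -/
theorem measure_sum_swaps_lt_le {t₁ t₂ V M M₀ : ℝ} {a : Coord n d → ℝ}
    (ha : ∀ e, a (Sum.inl e) ^ 2 ≤ M) (hM : 0 ≤ M) (hk : 16 * t₁ ^ 2 * M ≤ 1 / 2)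
    (hV : 0 ≤ V) (hT : ((swaps n).card : ℝ) / 2 ≤ (lowEnergySwaps t₁ t₂ V a).card) (hM₀ : 0 < M₀)
    (hM₀le : M₀ ≤ (swaps n).card / 2 * ((1 + V) ^ (-(1 / 2) : ℝ) * Real.exp (-V / 8))) :
    stdNormalPi (Coord n d) {g | ∑ σ ∈ swaps n, ENNReal.ofReal (Real.exp
        (llr (shift (uniformWeights n d t₁ t₂) (act d σ) a) g)) <
          ENNReal.ofReal (Real.exp (-(1 / 8)) * (M₀ / 2))} ≤
      ENNReal.ofReal (24 * (16 * t₁ ^ 2 * M) + 4 * Real.exp (1 / 8) / M₀ +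
        4 * Real.exp (1 / 4) / M₀ ^ 2 * ∑ p ∈ nearSwaps n, pairWeight t₁ t₂ a p) := by
  classical
  set T := lowEnergySwaps t₁ t₂ V a with hTdef
  have hTs : T ⊆ swaps n := Finset.filter_subset _ _
  have hswap : ∀ {σ}, σ ∈ T → σ.IsSwap := fun h => mem_swaps.1 (hTs h)
  have hmain := measure_sum_bump_lt_le T
    (fun σ => shift (uniformWeights n d t₁ t₂) (act d σ) a) (fun σ τ => ¬ σ.Disjoint τ)
    (V := V) (k := 16 * t₁ ^ 2 * M) (M₀ := M₀) (fun σ hσ => (Finset.mem_filter.1 hσ).2)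
    (by positivity) hk
    (fun σ hσ τ hτ _ hn => abs_sum_shift_mul_shift_le ha (hswap hσ) (hswap hτ) (not_not.1 hn))
    hM₀ (hM₀le.trans (by gcongr))
  refine (measure_mono fun g hg => ?_).trans (hmain.trans (ENNReal.ofReal_le_ofReal ?_))
  · have hg' : ∑ σ ∈ swaps n, ENNReal.ofReal (Real.exp
        (llr (shift (uniformWeights n d t₁ t₂) (act d σ) a) g)) <
          ENNReal.ofReal (Real.exp (-(1 / 8)) * (M₀ / 2)) := hg
    show ∑ σ ∈ T, bump (llr (shift (uniformWeights n d t₁ t₂) (act d σ) a) g) < M₀ / 2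
    have h1 : ENNReal.ofReal (Real.exp (-(1 / 8)) *
        ∑ σ ∈ T, bump (llr (shift (uniformWeights n d t₁ t₂) (act d σ) a) g)) ≤
        ∑ σ ∈ swaps n, ENNReal.ofReal (Real.exp
          (llr (shift (uniformWeights n d t₁ t₂) (act d σ) a) g)) := by
      rw [Finset.mul_sum, ENNReal.ofReal_sum_of_nonneg fun σ _ =>
        mul_nonneg (Real.exp_pos _).le (bump_pos _).le]
      refine (Finset.sum_le_sum fun σ _ => ENNReal.ofReal_le_ofReal ?_).trans
        (Finset.sum_le_sum_of_subset hTs)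
      calc _ ≤ Real.exp (-(1 / 8)) * (Real.exp (1 / 8) * Real.exp
            (llr (shift (uniformWeights n d t₁ t₂) (act d σ) a) g)) := by
            gcongr
            exact bump_le_exp _
        _ = _ := by rw [← mul_assoc, ← Real.exp_add]; simp
    have h2 := (ENNReal.ofReal_lt_ofReal_iff (by positivity)).1 (h1.trans_lt hg')
    exact lt_of_mul_lt_mul_left h2 (Real.exp_pos _).le
  · gcongr
    simp_rw [Finset.sum_filter]
    rw [← Finset.sum_product' T T fun σ τ => if ¬ σ.Disjoint τ ∧ σ ≠ τ then
      Real.exp (-(∑ i, shift (uniformWeights n d t₁ t₂) (act d σ) a i ^ 2 +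
        ∑ i, shift (uniformWeights n d t₁ t₂) (act d τ) a i ^ 2 +
          ∑ i, (shift (uniformWeights n d t₁ t₂) (act d σ) a i -
            shift (uniformWeights n d t₁ t₂) (act d τ) a i) ^ 2) / 18) else 0,
      nearSwaps, Finset.sum_filter]
    simp_rw [energy_mul_inv]
    exact Finset.sum_le_sum_of_subset_of_nonneg (Finset.product_subset_product hTs hTs)
      fun p _ _ => by
        split_ifs
        · exact (Real.exp_pos _).le
        · exact le_rfl

/-- A nonasymptotic bound on the success probability of every estimator. -/
theorem successProb_le {ρ η θ M M₀ x y : ℝ} (hρ : ρ ∈ Set.Icc (-1 : ℝ) 1)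
    (hη : η ∈ Set.Icc (-1 : ℝ) 1) (hρ1 : ρ ^ 2 < 1) (hη1 : η ^ 2 < 1) (f : Estimator n d)
    (hx : ρ ^ 2 / (1 - ρ ^ 2) = x) (hy : η ^ 2 / (1 - η ^ 2) = y) (hn : 2 ≤ n) (hθ : 0 ≤ θ)
    (hθx : 16 * (θ * x) ≤ 1) (hθy : 16 * (θ * y) ≤ 1) (hx' : x ≤ 1 / 200) (hy' : y ≤ 1 / 200)
    (hM : 0 ≤ M) (hk : 16 * x * M ≤ 1 / 2) (hM₀ : 0 < M₀)
    (hM₀le : M₀ ≤ (swaps n).card / 2 * ((1 + (4 * (x * n + y * d) + 1)) ^ (-(1 / 2) : ℝ) *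
      Real.exp (-(4 * (x * n + y * d) + 1) / 8))) :
    successProb ρ η f ≤ 2 * Real.exp (1 / 8) / M₀ +
      (n ^ 2 * (2 * Real.exp (-(M / 4))) +
        2 * Real.exp (-θ + 64 * θ ^ 2 * (n * x ^ 2 + d * y ^ 2)) +
        (24 * (16 * x * M) + 4 * Real.exp (1 / 8) / M₀) +
        4 * Real.exp (1 / 4) / M₀ ^ 2 * (n ^ 3 *
          Real.exp (-(23 / 30 * (x * n + y * d - 5 / 2 * x))))) := by
  classical
  have hamp := amp_uniformWeights (n := n) (d := d) ρ η
  have hx1 : (ρ / √(1 - ρ ^ 2)) ^ 2 = x := by rw [div_pow, Real.sq_sqrt (by linarith), hx]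
  have hy1 : (η / √(1 - η ^ 2)) ^ 2 = y := by rw [div_pow, Real.sq_sqrt (by linarith), hy]
  have hbase := ofReal_successProb_le hρ hη hρ1 hη1 f (swaps n)
    (K := ENNReal.ofReal (Real.exp (-(1 / 8)) * (M₀ / 2)))
    (by rw [ne_eq, ENNReal.ofReal_eq_zero, not_le]; positivity) ENNReal.ofReal_ne_top
  rw [hamp] at hbase
  set t₁ := ρ / √(1 - ρ ^ 2)
  set t₂ := η / √(1 - η ^ 2)
  clear_value t₁ t₂
  subst hx1 hy1
  set V := 4 * (t₁ ^ 2 * n + t₂ ^ 2 * d) + 1 with hV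
  have hV0 : 0 ≤ V := by positivity
  set P := stdNormalPi (Coord n d) with hP
  set G₁ : Set (Coord n d → ℝ) := {a | ∃ e, M < a (Sum.inl e) ^ 2} with hG₁
  set G₂ : Set (Coord n d → ℝ) :=
    {a | ((lowEnergySwaps t₁ t₂ V a).card : ℝ) < (swaps n).card / 2} with hG₂
  set b₁ := (n : ℝ) ^ 2 * (2 * Real.exp (-(M / 4))) with hb₁
  set b₂ := 2 * Real.exp (-θ + 64 * θ ^ 2 * (n * (t₁ ^ 2) ^ 2 + d * (t₂ ^ 2) ^ 2)) with hb₂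
  set c₀ := 24 * (16 * t₁ ^ 2 * M) + 4 * Real.exp (1 / 8) / M₀ with hc₀
  set c₁ := 4 * Real.exp (1 / 4) / M₀ ^ 2 with hc₁
  set E := Real.exp (-(23 / 30 * (t₁ ^ 2 * n + t₂ ^ 2 * d - 5 / 2 * t₁ ^ 2))) with hE
  have hb₁0 : 0 ≤ b₁ := by positivity
  have hb₂0 : 0 ≤ b₂ := by positivity
  have hc₀0 : 0 ≤ c₀ := by positivity
  have hc₁0 : 0 ≤ c₁ := by positivity
  have hE0 : 0 ≤ E := (Real.exp_pos _).le
  have h1 : P G₁ ≤ ENNReal.ofReal b₁ := measure_exists_edge_sq_gt_le M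
  have h2 : P G₂ ≤ ENNReal.ofReal b₂ := measure_card_lowEnergySwaps_lt_le hn fun σ hσ =>
    measure_energy_swap_gt_le hθ hθx hθy hσ
  set A : Set ((Coord n d → ℝ) × (Coord n d → ℝ)) := {p | ∑ σ ∈ swaps n, ENNReal.ofReal (Real.exp
    (llr (shift (uniformWeights n d t₁ t₂) (act d σ) p.1) p.2)) <
      ENNReal.ofReal (Real.exp (-(1 / 8)) * (M₀ / 2))} with hA
  have hAm : MeasurableSet A := measurableSet_lt (Finset.measurable_fun_sum _ fun σ _ =>
    (measurable_llr_shift _ _).exp.ennreal_ofReal) measurable_const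
  have hpw0 : ∀ a p, 0 ≤ pairWeight (n := n) (d := d) t₁ t₂ a p := fun a p => (Real.exp_pos _).le
  have hpwm : ∀ p, Measurable fun a => ENNReal.ofReal (pairWeight (n := n) (d := d) t₁ t₂ a p) :=
    fun p => by unfold pairWeight; fun_prop
  -- Exceptional `a` are bounded trivially by 1. The pair weights are kept as functions of `a`,
  -- because their smallness appears only after averaging.
  have hslice : ∀ a, P (Prod.mk a ⁻¹' A) ≤ (G₁ ∪ G₂).indicator 1 a +
      (ENNReal.ofReal c₀ + ENNReal.ofReal c₁ *
        ∑ p ∈ nearSwaps n, ENNReal.ofReal (pairWeight t₁ t₂ a p)) := by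
    intro a
    by_cases ha : a ∈ G₁ ∪ G₂
    · rw [Set.indicator_of_mem ha]
      exact prob_le_one.trans le_self_add
    · rw [Set.indicator_of_notMem ha, zero_add]
      rw [Set.mem_union, not_or] at ha
      have ha1 : ∀ e, a (Sum.inl e) ^ 2 ≤ M := fun e => by
        by_contra h
        exact ha.1 ⟨e, not_le.1 h⟩
      have ha2 : ((swaps n).card : ℝ) / 2 ≤ (lowEnergySwaps t₁ t₂ V a).card := not_lt.1 ha.2
      refine (measure_sum_swaps_lt_le ha1 hM hk hV0 ha2 hM₀ hM₀le).trans (le_of_eq ?_)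
      rw [ENNReal.ofReal_add hc₀0 (mul_nonneg hc₁0 (Finset.sum_nonneg fun p _ => hpw0 a p)),
        ENNReal.ofReal_mul hc₁0, ENNReal.ofReal_sum_of_nonneg fun p _ => hpw0 a p]
  have hnear : ∑ p ∈ nearSwaps n, ∫⁻ a, ENNReal.ofReal (pairWeight t₁ t₂ a p) ∂P ≤
      ENNReal.ofReal (n ^ 3 * E) := by
    calc _ ≤ (nearSwaps n).card • ENNReal.ofReal E := by
          refine Finset.sum_le_card_nsmul _ _ _ fun p hp => ?_
          obtain ⟨hp1, hp2, hp3⟩ := Finset.mem_filter.1 hp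
          obtain ⟨h3, h4⟩ := Finset.mem_product.1 hp1
          exact lintegral_exp_neg_energy_pair_le hx' hy' (mem_swaps.1 h3) (mem_swaps.1 h4) hp3 hp2
      _ ≤ _ := by
          rw [nsmul_eq_mul, ENNReal.ofReal_mul (by positivity),
            ENNReal.ofReal_pow (by positivity), ENNReal.ofReal_natCast]
          gcongr
          exact_mod_cast card_nearSwaps_le
  have hprob : baseLaw n d A ≤ ENNReal.ofReal (b₁ + b₂ + c₀ + c₁ * (n ^ 3 * E)) := by
    rw [Measure.prod_apply hAm]
    calc _ ≤ ∫⁻ a, ((G₁ ∪ G₂).indicator 1 a + (ENNReal.ofReal c₀ + ENNReal.ofReal c₁ *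
          ∑ p ∈ nearSwaps n, ENNReal.ofReal (pairWeight t₁ t₂ a p))) ∂P := lintegral_mono hslice
      _ = ∫⁻ a, (G₁ ∪ G₂).indicator 1 a ∂P + (ENNReal.ofReal c₀ + ENNReal.ofReal c₁ *
          ∑ p ∈ nearSwaps n, ∫⁻ a, ENNReal.ofReal (pairWeight t₁ t₂ a p) ∂P) := by
          have hsum := Finset.measurable_fun_sum (nearSwaps n) fun p _ => hpwm p
          rw [lintegral_add_right _ ((hsum.const_mul _).const_add _),
            lintegral_add_left measurable_const, lintegral_const_mul _ hsum,
            lintegral_finsetSum _ fun p _ => hpwm p]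
          simp
      _ ≤ (ENNReal.ofReal b₁ + ENNReal.ofReal b₂) + (ENNReal.ofReal c₀ + ENNReal.ofReal c₁ *
          ENNReal.ofReal (n ^ 3 * E)) := by
          refine add_le_add ((lintegral_indicator_one_le _).trans
            ((measure_union_le _ _).trans (add_le_add h1 h2))) ?_
          gcongr
      _ = _ := by
          rw [← ENNReal.ofReal_mul hc₁0, ← ENNReal.ofReal_add hb₁0 hb₂0,
            ← ENNReal.ofReal_add hc₀0 (by positivity),
            ← ENNReal.ofReal_add (by positivity) (by positivity)]
          congr 1
          ring
  have hK : (ENNReal.ofReal (Real.exp (-(1 / 8)) * (M₀ / 2)))⁻¹ =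
      ENNReal.ofReal (2 * Real.exp (1 / 8) / M₀) := by
    rw [← ENNReal.ofReal_inv_of_pos (by positivity)]
    congr 1
    rw [Real.exp_neg]
    field_simp
  rw [hK] at hbase
  have hfin := hbase.trans (add_le_add le_rfl hprob)
  rw [← ENNReal.ofReal_add (by positivity) (by positivity),
    ENNReal.ofReal_le_ofReal_iff (by positivity)] at hfin
  linarith

end FiniteBound

/-! ### Asymptotics of the converse -/

section Converse

theorem threshold_le {N n S L : ℝ} (hN : n ^ 2 / 4 ≤ N) (hS : 0 ≤ S) (hL : 1 ≤ L)
    (hSL : S ≤ 4 * L) : n ^ 2 * Real.exp (-(S / 2)) / (40 * √L) ≤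
      N / 2 * ((1 + (4 * S + 1)) ^ (-(1 / 2) : ℝ) * Real.exp (-(4 * S + 1) / 8)) := by
  have hL0 : 0 < √L := Real.sqrt_pos.2 (by linarith)
  have hN0 : 0 ≤ N := le_trans (by positivity) hN
  have h1 : (1 + (4 * S + 1)) ≤ (17 / 4 * √L) ^ 2 := by
    rw [mul_pow, Real.sq_sqrt (by linarith)]
    linarith
  have h2 : (17 / 4 * √L)⁻¹ ≤ (1 + (4 * S + 1)) ^ (-(1 / 2) : ℝ) := by
    rw [Real.rpow_neg (by linarith), ← Real.sqrt_eq_rpow]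
    refine inv_anti₀ (Real.sqrt_pos.2 (by linarith)) ?_
    rw [Real.sqrt_le_left (by positivity)]
    exact h1
  have h3 : 7 / 8 * Real.exp (-(S / 2)) ≤ Real.exp (-(4 * S + 1) / 8) := by
    rw [show -(4 * S + 1) / 8 = -(1 / 8) + -(S / 2) by ring, Real.exp_add]
    gcongr
    linarith [Real.add_one_le_exp (-(1 / 8) : ℝ)]
  calc _ ≤ n ^ 2 / 4 / 2 * ((17 / 4 * √L)⁻¹ * (7 / 8 * Real.exp (-(S / 2)))) := by
        rw [div_le_iff₀ (by positivity)]
        have : n ^ 2 / 4 / 2 * ((17 / 4 * √L)⁻¹ * (7 / 8 * Real.exp (-(S / 2)))) * (40 * √L) =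
            35 / 34 * (n ^ 2 * Real.exp (-(S / 2))) := by
          field_simp
          ring
        rw [this]
        have : 0 ≤ n ^ 2 * Real.exp (-(S / 2)) := by positivity
        linarith
    _ ≤ _ := by gcongr

/-- Used with m = n and with m = d. The fluctuation of the energy is of order m x² ≤ 16 L²/m; for
the features this vanishes because d = ω((log n)²). -/
theorem noise_bounds {x m L q : ℝ} (hm : 0 < m) (hL : 1 ≤ L) (hx : 0 ≤ x) (hxm : x * m ≤ 4 * L)
    (hq : q * m = L ^ 2) : x * L ≤ 4 * q ∧ x ≤ 4 * q ∧ m * x ^ 2 ≤ 16 * q := by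
  have h1 : x * L ≤ 4 * q := by
    refine le_of_mul_le_mul_right ?_ hm
    nlinarith
  refine ⟨h1, (le_mul_of_one_le_right hx hL).trans h1, ?_⟩
  calc m * x ^ 2 = x * m * x := by ring
    _ ≤ 4 * L * x := by gcongr
    _ = 4 * (x * L) := by ring
    _ ≤ 4 * (4 * q) := by gcongr
    _ = 16 * q := by ring

/-- In 1/M₀ the factor √L is exactly cancelled by the term -(log L)/2 in S/2, which is the source of
the log log n correction. The near pairs contribute at most a constant times n³ exp(-23S/30) · L
exp(S)/n⁴, and S ≤ 4L leaves L exp(-L/15) because 28/30 - 1 = -1/15. -/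
theorem inv_threshold_bounds {n S L x a M₀ : ℝ} (hL1 : 1 ≤ L) (hx : x ≤ 1 / 384)
    (hn : n = Real.exp L) (hSL : S ≤ 4 * L) (hS : S ≤ 4 * L - Real.log L - a)
    (hM₀ : n ^ 2 * Real.exp (-(S / 2)) / (40 * √L) = M₀) :
    1 / M₀ ≤ 40 * Real.exp (-(a / 2)) ∧
      4 * Real.exp (1 / 4) / M₀ ^ 2 * (n ^ 3 * Real.exp (-(23 / 30 * (S - 5 / 2 * x)))) ≤
        6400 * Real.exp (1 / 4) * Real.exp 1 * (L * Real.exp (-(L / 15))) := by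
  have hinv : 1 / M₀ = 40 * (√L * Real.exp (S / 2) * Real.exp (-(2 * L))) := by
    rw [← hM₀, hn, ← Real.exp_nat_mul, Real.exp_neg, Real.exp_neg]
    push_cast
    field_simp
  have hsqrt : √L = Real.exp (Real.log L / 2) := by
    rw [Real.sqrt_eq_rpow, Real.rpow_def_of_pos (by linarith)]
    congr 1
    ring
  have hinv1 : 1 / M₀ ≤ 40 * Real.exp (-(a / 2)) := by
    rw [hinv, hsqrt, ← Real.exp_add, ← Real.exp_add]
    gcongr
    linarith
  have hinv2 : 1 / M₀ ^ 2 = 1600 * (L * Real.exp S * Real.exp (-(4 * L))) := by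
    rw [← one_div_pow, hinv, mul_pow, mul_pow, mul_pow, Real.sq_sqrt (by linarith),
      ← Real.exp_nat_mul, ← Real.exp_nat_mul]
    push_cast
    rw [show (2 : ℝ) * (S / 2) = S by ring, show 2 * -(2 * L) = -(4 * L) by ring]
    norm_num
  refine ⟨hinv1, ?_⟩
  calc _ = 4 * Real.exp (1 / 4) * (1 / M₀ ^ 2) *
        (n ^ 3 * Real.exp (-(23 / 30 * (S - 5 / 2 * x)))) := by ring
    _ = 6400 * Real.exp (1 / 4) * (L * (Real.exp S * Real.exp (-(4 * L)) * Real.exp (3 * L) *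
        Real.exp (-(23 / 30 * (S - 5 / 2 * x))))) := by
        rw [hinv2, hn, ← Real.exp_nat_mul L]
        push_cast
        ring
    _ ≤ 6400 * Real.exp (1 / 4) * (L * (Real.exp 1 * Real.exp (-(L / 15)))) := by
        have h : Real.exp S * Real.exp (-(4 * L)) * Real.exp (3 * L) *
            Real.exp (-(23 / 30 * (S - 5 / 2 * x))) ≤ Real.exp 1 * Real.exp (-(L / 15)) := by
          rw [← Real.exp_add, ← Real.exp_add, ← Real.exp_add, ← Real.exp_add, Real.exp_le_exp]
          linarith
        gcongr
    _ = _ := by ring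

theorem successProb_le_of_snr_le {n d : ℕ} {ρ η θ a L q₁ q₂ x y : ℝ}
    (hρ : ρ ∈ Set.Icc (-1 : ℝ) 1) (hη : η ∈ Set.Icc (-1 : ℝ) 1) (hρ1 : ρ ^ 2 < 1)
    (hη1 : η ^ 2 < 1) (f : Estimator n d) (hx : ρ ^ 2 / (1 - ρ ^ 2) = x)
    (hy : η ^ 2 / (1 - η ^ 2) = y)
    (hn : 2 ≤ n) (hd : 0 < d) (hθ : 0 ≤ θ) (ha : 0 ≤ a) (hL : Real.log n = L) (hL1 : 1 ≤ L)
    (hq₁ : L ^ 2 * Real.exp (-L) = q₁) (hq₂ : L ^ 2 / d = q₂) (hq₁' : q₁ ≤ 1 / 1536)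
    (hq₂' : q₂ ≤ 1 / 1536) (hθ₁ : 64 * θ * q₁ ≤ 1) (hθ₂ : 64 * θ * q₂ ≤ 1)
    (hS : x * n + y * d ≤ 4 * L - Real.log L - a) :
    successProb ρ η f ≤ 240 * Real.exp (1 / 8) * Real.exp (-(a / 2)) + 2 * Real.exp (-L) +
      2 * Real.exp (-θ + 1024 * θ ^ 2 * (q₁ + q₂)) + 18432 * q₁ +
      6400 * Real.exp (1 / 4) * Real.exp 1 * (L * Real.exp (-(L / 15))) := by
  have hx0 : 0 ≤ x := hx ▸ div_nonneg (sq_nonneg _) (by linarith)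
  have hy0 : 0 ≤ y := hy ▸ div_nonneg (sq_nonneg _) (by linarith)
  have hn0 : (0 : ℝ) < n := by exact_mod_cast (by omega : 0 < n)
  have hd0 : (0 : ℝ) < d := by exact_mod_cast hd
  have hnL : (n : ℝ) = Real.exp L := by rw [← hL, Real.exp_log hn0]
  have hlogL : 0 ≤ Real.log L := Real.log_nonneg hL1
  obtain ⟨S, hSdef⟩ : ∃ S, x * n + y * d = S := ⟨_, rfl⟩
  have hS0 : 0 ≤ S := hSdef ▸ (by positivity)
  rw [hSdef] at hS
  have hSL : S ≤ 4 * L := by linarith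
  have hxn : x * n ≤ 4 * L := by linarith [mul_nonneg hy0 hd0.le]
  have hyd : y * d ≤ 4 * L := by linarith [mul_nonneg hx0 hn0.le]
  have hexpL : Real.exp (-L) = (n : ℝ)⁻¹ := by rw [hnL, Real.exp_neg]
  have hq₁n : q₁ * n = L ^ 2 := by
    rw [← hq₁, hexpL]
    field_simp
  have hq₂d : q₂ * d = L ^ 2 := by
    rw [← hq₂]
    field_simp
  obtain ⟨hxL, hx4, hx2⟩ := noise_bounds hn0 hL1 hx0 hxn hq₁n
  obtain ⟨-, hy4, hy2⟩ := noise_bounds hd0 hL1 hy0 hyd hq₂d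
  have hLpos : 0 < √L := Real.sqrt_pos.2 (by linarith)
  obtain ⟨M₀, hM₀def⟩ : ∃ M₀, (n : ℝ) ^ 2 * Real.exp (-(S / 2)) / (40 * √L) = M₀ := ⟨_, rfl⟩
  have hM₀ : 0 < M₀ := hM₀def ▸ (by positivity)
  have hthr : M₀ ≤ (swaps n).card / 2 * ((1 + (4 * S + 1)) ^ (-(1 / 2) : ℝ) *
      Real.exp (-(4 * S + 1) / 8)) :=
    hM₀def ▸ threshold_le (sq_le_card_swaps hn) hS0 hL1 hSL
  obtain ⟨hinv1, e3⟩ := inv_threshold_bounds hL1 (show x ≤ 1 / 384 by linarith) hnL hSL hS hM₀def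
  have e1 : (n : ℝ) ^ 2 * (2 * Real.exp (-(12 * L / 4))) = 2 * Real.exp (-L) := by
    rw [hnL, ← Real.exp_nat_mul, mul_left_comm, ← Real.exp_add]
    push_cast
    congr 2
    ring
  have e2 : 2 * Real.exp (-θ + 64 * θ ^ 2 * (n * x ^ 2 + d * y ^ 2)) ≤
      2 * Real.exp (-θ + 1024 * θ ^ 2 * (q₁ + q₂)) := by
    gcongr 2 * Real.exp (-θ + ?_)
    nlinarith [sq_nonneg θ]
  have e4 : 2 * Real.exp (1 / 8) / M₀ + 4 * Real.exp (1 / 8) / M₀ ≤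
      240 * Real.exp (1 / 8) * Real.exp (-(a / 2)) := by
    calc _ = 6 * Real.exp (1 / 8) * (1 / M₀) := by ring
      _ ≤ 6 * Real.exp (1 / 8) * (40 * Real.exp (-(a / 2))) :=
          mul_le_mul_of_nonneg_left hinv1 (by positivity)
      _ = _ := by ring
  have hθx := mul_le_mul_of_nonneg_left hx4 hθ
  have hθy := mul_le_mul_of_nonneg_left hy4 hθ
  -- The cutoff M = 12 log n makes the union over n² edges cost 2/n, while the correlation bound
  -- 16xM still tends to 0.
  have h := successProb_le (θ := θ) (M := 12 * L) (M₀ := M₀) hρ hη hρ1 hη1 f hx hy hn hθ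
    (by linarith) (by linarith) (by linarith) (by linarith) (by linarith) (by linarith) hM₀
    (by rw [hSdef]; exact hthr)
  rw [hSdef, e1] at h
  linarith

theorem successProb_le_of_signal_le {n d : ℕ} {ρ η θ a L q₁ q₂ : ℝ}
    (hρ : ρ ∈ Set.Icc (-1 : ℝ) 1) (hη : η ∈ Set.Icc (-1 : ℝ) 1) (f : Estimator n d)
    (hn : 2 ≤ n) (hd : 0 < d) (hθ : 0 ≤ θ) (ha : 0 ≤ a) (hL : Real.log n = L) (hL1 : 1 ≤ L)
    (hq₁ : L ^ 2 * Real.exp (-L) = q₁) (hq₂ : L ^ 2 / d = q₂) (hq₁' : q₁ ≤ 1 / 1536)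
    (hq₂' : q₂ ≤ 1 / 1536) (hθ₁ : 64 * θ * q₁ ≤ 1) (hθ₂ : 64 * θ * q₂ ≤ 1)
    (hS : signal ρ n + signal η d ≤ ((4 * L - Real.log L - a : ℝ) : EReal)) :
    successProb ρ η f ≤ 240 * Real.exp (1 / 8) * Real.exp (-(a / 2)) + 2 * Real.exp (-L) +
      2 * Real.exp (-θ + 1024 * θ ^ 2 * (q₁ + q₂)) + 18432 * q₁ +
      6400 * Real.exp (1 / 4) * Real.exp 1 * (L * Real.exp (-(L / 15))) := by
  have hsig0 : ∀ {r : ℝ} {m : ℕ}, r ∈ Set.Icc (-1 : ℝ) 1 → 0 ≤ signal r m := by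
    intro r m hr
    have := sq_le_one_of_mem hr
    rw [signal]
    split_ifs with h
    · exact le_top
    · have : 0 < 1 - r ^ 2 := by
        rcases this.lt_or_eq with h' | h'
        · linarith
        · exact absurd h' h
      exact EReal.coe_nonneg.2 (by positivity)
  have hlt : ∀ {r : ℝ} {m : ℕ}, r ∈ Set.Icc (-1 : ℝ) 1 → signal r m ≠ ⊤ → r ^ 2 < 1 := by
    intro r m hr h
    refine lt_of_le_of_ne (sq_le_one_of_mem hr) fun h1 => h ?_
    rw [signal, if_pos h1]
  have hρ1 : ρ ^ 2 < 1 := hlt hρ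
    ((le_add_of_nonneg_right (hsig0 hη)).trans hS |>.trans_lt (EReal.coe_lt_top _)).ne
  have hη1 : η ^ 2 < 1 := hlt hη
    ((le_add_of_nonneg_left (hsig0 hρ)).trans hS |>.trans_lt (EReal.coe_lt_top _)).ne
  rw [signal_eq_coe hρ1, signal_eq_coe hη1, ← EReal.coe_add, EReal.coe_le_coe_iff] at hS
  exact successProb_le_of_snr_le hρ hη hρ1 hη1 f rfl rfl hn hd hθ ha hL hL1 hq₁ hq₂ hq₁' hq₂'
    hθ₁ hθ₂ hS

theorem tendsto_successProb_zero (d : ℕ → ℕ) (ρ η : ℕ → ℝ)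
    (hρ : ∀ n, ρ n ∈ Set.Icc (-1 : ℝ) 1) (hη : ∀ n, η n ∈ Set.Icc (-1 : ℝ) 1)
    (hd : (fun n : ℕ => Real.log n ^ 2) =o[atTop] (fun n : ℕ => (d n : ℝ)))
    (hS : ∃ a : ℕ → ℝ, Tendsto a atTop atTop ∧ ∀ᶠ n : ℕ in atTop,
      signal (ρ n) n + signal (η n) (d n) ≤
        ((4 * Real.log n - Real.log (Real.log n) - a n : ℝ) : EReal))
    (f : (n : ℕ) → Estimator n (d n)) :
    Tendsto (fun n => successProb (ρ n) (η n) (f n)) atTop (𝓝 0) := by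
  obtain ⟨a, hatop, hS⟩ := hS
  set L : ℕ → ℝ := fun n => Real.log n with hL
  set q₁ : ℕ → ℝ := fun n => L n ^ 2 * Real.exp (-L n) with hq₁
  set q₂ : ℕ → ℝ := fun n => L n ^ 2 / d n with hq₂
  have hLtop : Tendsto L atTop atTop := Real.tendsto_log_atTop.comp tendsto_natCast_atTop_atTop
  have hq₁0 : Tendsto q₁ atTop (𝓝 0) :=
    (Real.tendsto_pow_mul_exp_neg_atTop_nhds_zero 2).comp hLtop
  have hq₂0 : Tendsto q₂ atTop (𝓝 0) := hd.tendsto_div_nhds_zero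
  -- For fixed θ every term but the energy deviation vanishes, leaving 2 exp(-θ); θ is then chosen
  -- large.
  have hbound : ∀ θ : ℝ, 0 ≤ θ → Tendsto (fun n =>
      240 * Real.exp (1 / 8) * Real.exp (-(a n / 2)) + 2 * Real.exp (-L n) +
      2 * Real.exp (-θ + 1024 * θ ^ 2 * (q₁ n + q₂ n)) + 18432 * q₁ n +
      6400 * Real.exp (1 / 4) * Real.exp 1 * (L n * Real.exp (-(L n / 15)))) atTop
      (𝓝 (2 * Real.exp (-θ))) := by
    intro θ _
    have h1 := (Real.tendsto_exp_neg_atTop_nhds_zero.comp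
      (hatop.atTop_div_const two_pos)).const_mul (240 * Real.exp (1 / 8))
    have h2 := (Real.tendsto_exp_neg_atTop_nhds_zero.comp hLtop).const_mul 2
    have h3 : Tendsto (fun n => 2 * Real.exp (-θ + 1024 * θ ^ 2 * (q₁ n + q₂ n))) atTop
        (𝓝 (2 * Real.exp (-θ + 1024 * θ ^ 2 * (0 + 0)))) :=
      ((((hq₁0.add hq₂0).const_mul _).const_add _).rexp).const_mul 2
    have h4 := hq₁0.const_mul 18432
    have h5 := (((Real.tendsto_pow_mul_exp_neg_atTop_nhds_zero 1).comp
      (hLtop.atTop_div_const (show (0 : ℝ) < 15 by norm_num))).const_mul 15).const_mul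
        (6400 * Real.exp (1 / 4) * Real.exp 1)
    have h := (((h1.add h2).add h3).add h4).add h5
    simp only [mul_zero, add_zero, zero_add] at h
    refine h.congr fun n => ?_
    simp only [Function.comp, pow_one]
    congr 1
    ring
  refine tendsto_order.2 ⟨fun b hb => Eventually.of_forall fun n =>
    hb.trans_le measureReal_nonneg, fun b hb => ?_⟩
  obtain ⟨θ, hθ, hθb⟩ : ∃ θ : ℝ, 0 < θ ∧ 2 * Real.exp (-θ) < b := by
    have h := (Real.tendsto_exp_neg_atTop_nhds_zero.const_mul 2).eventually_lt_const
      (show 2 * 0 < b by simpa using hb)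
    exact ((eventually_gt_atTop 0).and h).exists
  have hdpos : ∀ᶠ n in atTop, 0 < d n := by
    have h := isLittleO_iff.1 hd one_pos
    filter_upwards [h, hLtop.eventually_ge_atTop 1] with n hn h1
    by_contra h0
    have h0' : d n = 0 := by omega
    rw [h0', Nat.cast_zero, norm_zero, mul_zero, norm_le_zero_iff] at hn
    have : L n ^ 2 = 0 := hn
    nlinarith
  have hsmall : ∀ {q : ℕ → ℝ}, Tendsto q atTop (𝓝 0) → ∀ᶠ n in atTop,
      q n ≤ 1 / 1536 ∧ 64 * θ * q n ≤ 1 := by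
    intro q hq
    have h1 := hq.eventually_le_const (show (0 : ℝ) < 1 / 1536 by norm_num)
    have h2 := (hq.const_mul (64 * θ)).eventually_le_const (show 64 * θ * 0 < 1 by norm_num)
    exact h1.and h2
  filter_upwards [hS, (hbound θ hθ.le).eventually_lt_const hθb, hdpos, hsmall hq₁0, hsmall hq₂0,
    eventually_ge_atTop 2, hatop.eventually_ge_atTop 0, hLtop.eventually_ge_atTop 1]
    with n hn hlt hdn h1 h2 hn2 han hLn
  exact (successProb_le_of_signal_le (hρ n) (hη n) (f n) hn2 hdn hθ.le han rfl hLn rfl rfl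
    h1.1 h2.1 h1.2 h2.2 hn).trans_lt hlt

end Converse

end ContextualMatching

theorem theorem1 (d : ℕ → ℕ) (ρ η : ℕ → ℝ)
    (hρ : ∀ n, ρ n ∈ Set.Icc (-1 : ℝ) 1) (hη : ∀ n, η n ∈ Set.Icc (-1 : ℝ) 1) :
    -- achievability
    ((fun n : ℕ => Real.log n) =o[atTop] (fun n : ℕ => (d n : ℝ)) →
      (∃ ε : ℝ, 0 < ε ∧ ∀ᶠ n : ℕ in atTop,
        ((4 * (1 + ε) * Real.log n : ℝ) : EReal) ≤
          ContextualMatching.signal (ρ n) n + ContextualMatching.signal (η n) (d n)) →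
      (∀ n, ∃ f : ContextualMatching.Estimator n (d n),
        ContextualMatching.IsMAP (ρ n) (η n) f) ∧
      ∀ f : (n : ℕ) → ContextualMatching.Estimator n (d n),
        (∀ n, ContextualMatching.IsMAP (ρ n) (η n) (f n)) →
        Tendsto (fun n => ContextualMatching.successProb (ρ n) (η n) (f n)) atTop (𝓝 1)) ∧
    -- converse
    ((fun n : ℕ => Real.log n ^ 2) =o[atTop] (fun n : ℕ => (d n : ℝ)) →
      (∃ a : ℕ → ℝ, Tendsto a atTop atTop ∧ ∀ᶠ n : ℕ in atTop,
        ContextualMatching.signal (ρ n) n + ContextualMatching.signal (η n) (d n) ≤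
          ((4 * Real.log n - Real.log (Real.log n) - a n : ℝ) : EReal)) →
      ∀ f : (n : ℕ) → ContextualMatching.Estimator n (d n),
        Tendsto (fun n => ContextualMatching.successProb (ρ n) (η n) (f n)) atTop (𝓝 0)) := by
  refine ⟨fun hd hS => ⟨fun n => ContextualMatching.exists_isMAP n (d n) (ρ n) (η n), fun f hf =>
    ContextualMatching.tendsto_successProb_of_isMAP d ρ η hρ hη hd hS f hf⟩, fun hd hS f =>
    ContextualMatching.tendsto_successProb_zero d ρ η hρ hη hd hS f⟩
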